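/- Let $y_i>0$ and $\nu_i>0$ be the measurement and the known gamma shape parameter at point $p_i$ of an input $P=(p_1,\dots,p_n)$ of $n\ge 2$ points in the plane. Put $b(p_i)=\nu_i$, $m(p_i)=\nu_i y_i$, and for a region $R$ $$m_R=\frac{\sum_{p_i\in R} m(p_i)}{\sum_{i} m(p_i)},\qquad b_R=\frac{\sum_{p_i\in R} b(p_i)}{\sum_{i} b(p_i)}.$$ The gamma scan statistic is $$d_\gamma(b_R,m_R)=c\Bigl(b_R\log\frac{b_R}{m_R}+(1-b_R)\log\frac{1-b_R}{1-m_R}\Bigr)$$ with a fixed constant $c>0$. Fix constants $C>0$ and $0<\ell\le h$, and assume $\ell\le m(p_i),b(p_i)\le h$ for all $i$. Call a region $R$ supported if $(m_R,b_R)\in[C/n,\,1-C/n]^2$. The model of computation is the real RAM (unit-cost arithmetic, comparison and natural logarithm of real numbers, unit-cost addition, subtraction and comparison of indices, indirect addressing, no rounding of reals to integers); the parameters $\varepsilon,c,C$ are part of the input. (1) There is an algorithm that, for every such input and every $\varepsilon>0$, halts in time $O\bigl(\max(1,\tfrac1\varepsilon)\,n^2\log^2 n\bigr)$ and, if there is a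 supported closed axis-parallel rectangle, outputs a supported closed axis-parallel rectangle $R$ and the number $d_\gamma(b_R,m_R)$ such that $d_\gamma(b_{R'},m_{R'})\le d_\gamma(b_R,m_R)+\varepsilon$ for every supported closed axis-parallel rectangle $R'$. (2) Let each point in addition carry a time stamp $t(p_i)\in\mathbb R$. There is an algorithm that solves the same problem for prospective windows, that is for the regions $R\times[\tau,\infty)$, where $R$ is a closed axis-parallel rectangle and $\tau\in\mathbb R$, consisting of the points that lie in $R$ and have time stamp at least $\tau$, in time $O\bigl(\max(1,\tfrac1\varepsilon)\,n^3\log^2 n\bigr)$. The algorithms are fixed programs, independent of all parameters. The constants hidden in $O(\cdot)$ depend only on $c$, $C$, $\ell$ and $h$; they do not depend on $n$, on $\varepsilon$ or on the data. -/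

import Mathlib

/-! ## The real random access machine

A program works on finitely many index registers (natural numbers), finitely many real registers
and finitely many arrays of each of the two types. Registers and arrays are named by constants that
occur in the program; array entries are addressed indirectly, through an index register. Indices
can be added and subtracted; reals can be added, subtracted, multiplied, divided, compared, and
their natural logarithm can be taken. There is no rounding from reals to indices, and the only
constants in a program are rational. Every instruction and every test costs one unit of time. -/

namespace RealRAM

/-- The contents of the registers and arrays of the machine. -/
@[ext]
structure State where
  /-- index registers -/
  ireg : ℕ → ℕ
  /-- real registers -/
  rreg : ℕ → ℝ
  /-- index arrays: `iarr a k` is entry `k` of array `a` -/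
  iarr : ℕ → ℕ → ℕ
  /-- real arrays: `rarr a k` is entry `k` of array `a` -/
  rarr : ℕ → ℕ → ℝ

/-- Set index register `i` to `v`. -/
def State.setI (s : State) (i v : ℕ) : State :=
  { s with ireg := Function.update s.ireg i v }

/-- Set real register `i` to `v`. -/
noncomputable def State.setR (s : State) (i : ℕ) (v : ℝ) : State :=
  { s with rreg := Function.update s.rreg i v }

/-- Set entry `k` of index array `a` to `v`. -/
def State.setIArr (s : State) (a k v : ℕ) : State :=
  { s with iarr := Function.update s.iarr a (Function.update (s.iarr a) k v) }

/-- Set entry `k` of real array `a` to `v`. -/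
noncomputable def State.setRArr (s : State) (a k : ℕ) (v : ℝ) : State :=
  { s with rarr := Function.update s.rarr a (Function.update (s.rarr a) k v) }

/-- Elementary tests, on two index registers or on two real registers. -/
inductive Test where
  | ilt (i j : ℕ)
  | ieq (i j : ℕ)
  | rlt (i j : ℕ)
  | rle (i j : ℕ)

/-- The truth of a test in a state. -/
def Test.Holds : Test → State → Prop
  | .ilt i j, s => s.ireg i < s.ireg j
  | .ieq i j, s => s.ireg i = s.ireg j
  | .rlt i j, s => s.rreg i < s.rreg j
  | .rle i j, s => s.rreg i ≤ s.rreg j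

/-- Programs. The effect and the cost of each construct are given by `Exec`. -/
inductive Prog where
  /-- `I i := v` -/
  | iconst (i v : ℕ)
  /-- `I i := I j + I k` -/
  | iadd (i j k : ℕ)
  /-- `I i := I j - I k`, truncated at zero -/
  | isub (i j k : ℕ)
  /-- `I i := IArr a [I j]` -/
  | iload (i a j : ℕ)
  /-- `IArr a [I j] := I i` -/
  | istore (a j i : ℕ)
  /-- `R i := q` -/
  | rconst (i : ℕ) (q : ℚ)
  /-- `R i := I j` -/
  | rofi (i j : ℕ)
  /-- `R i := R j + R k` -/
  | radd (i j k : ℕ)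
  /-- `R i := R j - R k` -/
  | rsub (i j k : ℕ)
  /-- `R i := R j * R k` -/
  | rmul (i j k : ℕ)
  /-- `R i := R j / R k`, for nonzero divisors only -/
  | rdiv (i j k : ℕ)
  /-- `R i := log (R j)`, for positive arguments only -/
  | rlog (i j : ℕ)
  /-- `R i := RArr a [I j]` -/
  | rload (i a j : ℕ)
  /-- `RArr a [I j] := R i` -/
  | rstore (a j i : ℕ)
  /-- do nothing -/
  | skip
  /-- first `p`, then `q` -/
  | seq (p q : Prog)
  /-- if `b` then `p` else `q` -/
  | cond (b : Test) (p q : Prog)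
  /-- while `b` do `p` -/
  | loop (b : Test) (p : Prog)

/-- `Exec p s s' t`: started in state `s`, the program `p` halts in state `s'` after exactly `t`
units of time. Division by zero and logarithms of non-positive numbers get stuck. -/
inductive Exec : Prog → State → State → ℕ → Prop where
  | iconst (s : State) (i v : ℕ) : Exec (.iconst i v) s (s.setI i v) 1
  | iadd (s : State) (i j k : ℕ) :
      Exec (.iadd i j k) s (s.setI i (s.ireg j + s.ireg k)) 1
  | isub (s : State) (i j k : ℕ) :
      Exec (.isub i j k) s (s.setI i (s.ireg j - s.ireg k)) 1
  | iload (s : State) (i a j : ℕ) :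
      Exec (.iload i a j) s (s.setI i (s.iarr a (s.ireg j))) 1
  | istore (s : State) (a j i : ℕ) :
      Exec (.istore a j i) s (s.setIArr a (s.ireg j) (s.ireg i)) 1
  | rconst (s : State) (i : ℕ) (q : ℚ) : Exec (.rconst i q) s (s.setR i (q : ℝ)) 1
  | rofi (s : State) (i j : ℕ) : Exec (.rofi i j) s (s.setR i (s.ireg j : ℝ)) 1
  | radd (s : State) (i j k : ℕ) :
      Exec (.radd i j k) s (s.setR i (s.rreg j + s.rreg k)) 1
  | rsub (s : State) (i j k : ℕ) :
      Exec (.rsub i j k) s (s.setR i (s.rreg j - s.rreg k)) 1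
  | rmul (s : State) (i j k : ℕ) :
      Exec (.rmul i j k) s (s.setR i (s.rreg j * s.rreg k)) 1
  | rdiv (s : State) (i j k : ℕ) (h : s.rreg k ≠ 0) :
      Exec (.rdiv i j k) s (s.setR i (s.rreg j / s.rreg k)) 1
  | rlog (s : State) (i j : ℕ) (h : 0 < s.rreg j) :
      Exec (.rlog i j) s (s.setR i (Real.log (s.rreg j))) 1
  | rload (s : State) (i a j : ℕ) :
      Exec (.rload i a j) s (s.setR i (s.rarr a (s.ireg j))) 1
  | rstore (s : State) (a j i : ℕ) :
      Exec (.rstore a j i) s (s.setRArr a (s.ireg j) (s.rreg i)) 1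
  | skip (s : State) : Exec .skip s s 1
  | seq {p q : Prog} {s s' s'' : State} {t t' : ℕ} :
      Exec p s s' t → Exec q s' s'' t' → Exec (.seq p q) s s'' (t + t')
  | condTrue {b : Test} {p q : Prog} {s s' : State} {t : ℕ} :
      b.Holds s → Exec p s s' t → Exec (.cond b p q) s s' (t + 1)
  | condFalse {b : Test} {p q : Prog} {s s' : State} {t : ℕ} :
      ¬ b.Holds s → Exec q s s' t → Exec (.cond b p q) s s' (t + 1)
  | loopFalse {b : Test} {p : Prog} {s : State} :
      ¬ b.Holds s → Exec (.loop b p) s s 1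
  | loopTrue {b : Test} {p : Prog} {s s' s'' : State} {t t' : ℕ} :
      b.Holds s → Exec p s s' t → Exec (.loop b p) s' s'' t' →
      Exec (.loop b p) s s'' (t + t' + 1)

/-- The machine is deterministic: the final state and the running time are unique. -/
theorem Exec.unique {p : Prog} {s s₁ s₂ : State} {t₁ t₂ : ℕ}
    (h₁ : Exec p s s₁ t₁) (h₂ : Exec p s s₂ t₂) : s₁ = s₂ ∧ t₁ = t₂ := by
  induction h₁ generalizing s₂ t₂ with
  | seq _ _ ih ih' =>
    cases h₂ with
    | seq h h' =>
      obtain ⟨rfl, rfl⟩ := ih h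
      obtain ⟨rfl, rfl⟩ := ih' h'
      exact ⟨rfl, rfl⟩
  | condTrue hb _ ih =>
    cases h₂ with
    | condTrue _ h =>
      obtain ⟨rfl, rfl⟩ := ih h
      exact ⟨rfl, rfl⟩
    | condFalse hb' _ => exact absurd hb hb'
  | condFalse hb _ ih =>
    cases h₂ with
    | condTrue hb' _ => exact absurd hb' hb
    | condFalse _ h =>
      obtain ⟨rfl, rfl⟩ := ih h
      exact ⟨rfl, rfl⟩
  | loopFalse hb =>
    cases h₂ with
    | loopFalse _ => exact ⟨rfl, rfl⟩
    | loopTrue hb' _ _ => exact absurd hb' hb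
  | loopTrue hb _ _ ih ih' =>
    cases h₂ with
    | loopFalse hb' => exact absurd hb hb'
    | loopTrue _ h h' =>
      obtain ⟨rfl, rfl⟩ := ih h
      obtain ⟨rfl, rfl⟩ := ih' h'
      exact ⟨rfl, rfl⟩
  | _ => cases h₂; exact ⟨rfl, rfl⟩

/-- A finite sequence as an array, filled up with zeros. -/
noncomputable def toArr {n : ℕ} (v : Fin n → ℝ) (k : ℕ) : ℝ :=
  if h : k < n then v ⟨k, h⟩ else 0

end RealRAM

/-! ## The gamma scan statistic -/

/-- `n` points in the plane, each with a measurement that is modelled by a gamma distribution with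
a known shape parameter. -/
structure GammaData (n : ℕ) where
  /-- the location of a point -/
  loc : Fin n → ℝ × ℝ
  /-- the measurement at a point -/
  y : Fin n → ℝ
  /-- the shape parameter at a point -/
  shape : Fin n → ℝ

/-- The discrepancy function `d_γ(b_R, m_R)` of the gamma scan statistic, with its constant factor
`c`. -/
noncomputable def gammaDisc (c b m : ℝ) : ℝ :=
  c * (b * Real.log (b / m) + (1 - b) * Real.log ((1 - b) / (1 - m)))

namespace GammaData

variable {n : ℕ}

/-- The weight `m(p)` that a point contributes to the measurement of a region. -/
def m (D : GammaData n) (i : Fin n) : ℝ := D.shape i * D.y i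

/-- The weight `b(p)` that a point contributes to the baseline of a region. -/
def b (D : GammaData n) (i : Fin n) : ℝ := D.shape i

/-- All weights lie between the constants `lo` and `hi`. -/
def WeightsIn (D : GammaData n) (lo hi : ℝ) : Prop :=
  ∀ i, D.m i ∈ Set.Icc lo hi ∧ D.b i ∈ Set.Icc lo hi

/-- `m_R`: the fraction of the total measurement that falls on the points in `S`. -/
noncomputable def mFrac (D : GammaData n) (S : Finset (Fin n)) : ℝ :=
  (∑ i ∈ S, D.m i) / ∑ i, D.m i

/-- `b_R`: the fraction of the total baseline that falls on the points in `S`. -/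
noncomputable def bFrac (D : GammaData n) (S : Finset (Fin n)) : ℝ :=
  (∑ i ∈ S, D.b i) / ∑ i, D.b i

/-- The gamma scan statistic of the region that contains exactly the points in `S`. -/
noncomputable def disc (D : GammaData n) (c : ℝ) (S : Finset (Fin n)) : ℝ :=
  gammaDisc c (D.bFrac S) (D.mFrac S)

/-- The minimum level of support: `(m_R, b_R)` lies in the square `[C/n, 1 - C/n]²`. -/
def Supported (D : GammaData n) (C : ℝ) (S : Finset (Fin n)) : Prop :=
  D.mFrac S ∈ Set.Icc (C / n) (1 - C / n) ∧ D.bFrac S ∈ Set.Icc (C / n) (1 - C / n)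

open Classical in
/-- The points in the closed axis-parallel rectangle with lower left corner `u` and upper right
corner `v` (`Set.Icc` in the product order of `ℝ × ℝ`). -/
noncomputable def inRect (D : GammaData n) (u v : ℝ × ℝ) : Finset (Fin n) :=
  Finset.univ.filter fun i => D.loc i ∈ Set.Icc u v

open Classical in
/-- The points in the rectangle whose time stamp is at least `τ`. -/
noncomputable def inWindow (D : GammaData n) (time : Fin n → ℝ) (u v : ℝ × ℝ) (τ : ℝ) :
    Finset (Fin n) :=
  (D.inRect u v).filter fun i => τ ≤ time i

/-- The input of the machine: index register 0 holds `n`; real registers 0, 1, 2 hold `ε`, `c`,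
`C`; real arrays 0 to 4 hold the two coordinates, the measurements, the shape parameters and the
time stamps; everything else is zero. -/
noncomputable def input (D : GammaData n) (time : Fin n → ℝ) (ε c C : ℝ) : RealRAM.State where
  ireg i := if i = 0 then n else 0
  rreg i := match i with
    | 0 => ε
    | 1 => c
    | 2 => C
    | _ => 0
  iarr _ _ := 0
  rarr a := match a with
    | 0 => RealRAM.toArr fun i => (D.loc i).1
    | 1 => RealRAM.toArr fun i => (D.loc i).2
    | 2 => RealRAM.toArr D.y
    | 3 => RealRAM.toArr D.shape
    | 4 => RealRAM.toArr time
    | _ => fun _ => 0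

/-- The final state `s` holds a solution: real registers 1, 2, 3, 4 hold the corners of a supported
rectangle, real register 0 its discrepancy, and no supported rectangle has a discrepancy that is
larger by more than `ε`. -/
def Solves (D : GammaData n) (ε c C : ℝ) (s : RealRAM.State) : Prop :=
  let R := D.inRect (s.rreg 1, s.rreg 2) (s.rreg 3, s.rreg 4)
  D.Supported C R ∧ s.rreg 0 = D.disc c R ∧
    ∀ u v : ℝ × ℝ, D.Supported C (D.inRect u v) → D.disc c (D.inRect u v) ≤ s.rreg 0 + ε

/-- The same for prospective windows `R × [τ, ∞)`; real register 5 holds `τ`. -/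
def SolvesProspective (D : GammaData n) (time : Fin n → ℝ) (ε c C : ℝ) (s : RealRAM.State) :
    Prop :=
  let R := D.inWindow time (s.rreg 1, s.rreg 2) (s.rreg 3, s.rreg 4) (s.rreg 5)
  D.Supported C R ∧ s.rreg 0 = D.disc c R ∧
    ∀ (u v : ℝ × ℝ) (τ : ℝ), D.Supported C (D.inWindow time u v τ) →
      D.disc c (D.inWindow time u v τ) ≤ s.rreg 0 + ε

end GammaData

/-! The discrepancy is jointly convex in `(b, m)`, and the tangent plane at a point depends only on
the two ratios `r = b / m` and `q = (1 - b) / (1 - m)`. From `1 - 1 / x ≤ log x ≤ x - 1` it follows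
that a tangent lies below the discrepancy (`tangent_le`), and that it falls short by at most `c * δ
^ 2` wherever both ratios exceed its parameters by a factor of at most `1 + δ` (`le_tangent`). Since
the weights lie between two constants, both ratios of every supported region lie in a fixed interval
around 1. A geometric grid with `δ` of order `sqrt (ε / c)` has O(max(1, sqrt(1/ε))) values for each
ratio, so O(max(1, 1/ε)) tangents approximate the discrepancy of every supported region up to `ε`.
It is the quadratic error that makes the cost linear in `1 / ε`.

It remains to maximise one linear function of `m` and `b` over the supported rectangles. For every
bottom point a data structure over the columns is built, and the points are deleted again from the
top downwards. Each strip asks for a heaviest interval of columns among the feasible ones, those in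
which both sums reach `C / n`. A feasible interval consists of its shortest feasible prefix and an
arbitrary extension (`exists_start`). So each column gets a starting value, the best weight of an
interval that becomes feasible exactly there (`StartOK`), and a segment tree for maximum subarrays
joins starting values to extensions (`Node.sem_tree`, `DS.query_ub`, `DS.query_att`). Every single
point carries a fraction of order `1 / n` of the total, so an infeasible interval contains only a
constant number `K` of points. Hence a starting value is found by looking back over O(K) nonempty
columns (`run_scanProg`), and a deletion affects only O(K) starting values (`run_refreshProg`); a
deletion costs O(log n).

The upper bounds `1 - C / n` hold by themselves if the whole strip obeys them. Otherwise the strip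
misses at most `K` points (`Inst.Valid.card_compl_le`); at most `(K + 1) ^ 2` strips are of this
kind for each tangent and starting time, and each is searched exhaustively in time O(n^2).

Of the linear maxima only the best value and its strip are remembered. Because tangents lie below
the discrepancy, an exhaustive search of that single strip finds a region whose discrepancy is at
least the best linear value, and thus optimal up to `ε` (`run_searchProg`). For prospective windows
everything is repeated with each time stamp as starting time; plain rectangles are the case of a
single starting time and equal stamps. Apart from the search for the grid quotient, each starting
time costs O(max(1, 1/ε) n^2 log n), which is relaxed to `log n ^ 2` at the very end. -/

set_option linter.unusedSimpArgs false
open Finset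

namespace RealRAM

/-! ### Reasoning about programs -/

/-- `Run p s Q`: started in `s`, the program `p` halts, and the final state and the running time
satisfy `Q`. -/
def Run (p : Prog) (s : State) (Q : State → ℕ → Prop) : Prop :=
  ∃ s' t, Exec p s s' t ∧ Q s' t

theorem Run.mono {p : Prog} {s : State} {P Q : State → ℕ → Prop} (h : Run p s P)
    (hPQ : ∀ s' t, P s' t → Q s' t) : Run p s Q := by
  obtain ⟨s', t, he, hP⟩ := h
  exact ⟨s', t, he, hPQ _ _ hP⟩

-- These rules are exact weakest preconditions. As `simp` lemmas they execute straight-line code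
-- symbolically, including its cost; only loops need invariants.
@[simp] theorem run_skip {s : State} {Q : State → ℕ → Prop} : Run .skip s Q ↔ Q s 1 :=
  ⟨fun ⟨_, _, h, hQ⟩ => by cases h; exact hQ, fun h => ⟨_, _, .skip s, h⟩⟩

@[simp] theorem run_iconst {s : State} {i v : ℕ} {Q : State → ℕ → Prop} :
    Run (.iconst i v) s Q ↔ Q (s.setI i v) 1 :=
  ⟨fun ⟨_, _, h, hQ⟩ => by cases h; exact hQ, fun h => ⟨_, _, .iconst .., h⟩⟩

@[simp] theorem run_iadd {s : State} {i j k : ℕ} {Q : State → ℕ → Prop} :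
    Run (.iadd i j k) s Q ↔ Q (s.setI i (s.ireg j + s.ireg k)) 1 :=
  ⟨fun ⟨_, _, h, hQ⟩ => by cases h; exact hQ, fun h => ⟨_, _, .iadd .., h⟩⟩

@[simp] theorem run_isub {s : State} {i j k : ℕ} {Q : State → ℕ → Prop} :
    Run (.isub i j k) s Q ↔ Q (s.setI i (s.ireg j - s.ireg k)) 1 :=
  ⟨fun ⟨_, _, h, hQ⟩ => by cases h; exact hQ, fun h => ⟨_, _, .isub .., h⟩⟩

@[simp] theorem run_iload {s : State} {i a j : ℕ} {Q : State → ℕ → Prop} :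
    Run (.iload i a j) s Q ↔ Q (s.setI i (s.iarr a (s.ireg j))) 1 :=
  ⟨fun ⟨_, _, h, hQ⟩ => by cases h; exact hQ, fun h => ⟨_, _, .iload .., h⟩⟩

@[simp] theorem run_istore {s : State} {a j i : ℕ} {Q : State → ℕ → Prop} :
    Run (.istore a j i) s Q ↔ Q (s.setIArr a (s.ireg j) (s.ireg i)) 1 :=
  ⟨fun ⟨_, _, h, hQ⟩ => by cases h; exact hQ, fun h => ⟨_, _, .istore .., h⟩⟩

@[simp] theorem run_rconst {s : State} {i : ℕ} {q : ℚ} {Q : State → ℕ → Prop} :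
    Run (.rconst i q) s Q ↔ Q (s.setR i q) 1 :=
  ⟨fun ⟨_, _, h, hQ⟩ => by cases h; exact hQ, fun h => ⟨_, _, .rconst .., h⟩⟩

@[simp] theorem run_rofi {s : State} {i j : ℕ} {Q : State → ℕ → Prop} :
    Run (.rofi i j) s Q ↔ Q (s.setR i (s.ireg j)) 1 :=
  ⟨fun ⟨_, _, h, hQ⟩ => by cases h; exact hQ, fun h => ⟨_, _, .rofi .., h⟩⟩

@[simp] theorem run_radd {s : State} {i j k : ℕ} {Q : State → ℕ → Prop} :
    Run (.radd i j k) s Q ↔ Q (s.setR i (s.rreg j + s.rreg k)) 1 :=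
  ⟨fun ⟨_, _, h, hQ⟩ => by cases h; exact hQ, fun h => ⟨_, _, .radd .., h⟩⟩

@[simp] theorem run_rsub {s : State} {i j k : ℕ} {Q : State → ℕ → Prop} :
    Run (.rsub i j k) s Q ↔ Q (s.setR i (s.rreg j - s.rreg k)) 1 :=
  ⟨fun ⟨_, _, h, hQ⟩ => by cases h; exact hQ, fun h => ⟨_, _, .rsub .., h⟩⟩

@[simp] theorem run_rmul {s : State} {i j k : ℕ} {Q : State → ℕ → Prop} :
    Run (.rmul i j k) s Q ↔ Q (s.setR i (s.rreg j * s.rreg k)) 1 :=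
  ⟨fun ⟨_, _, h, hQ⟩ => by cases h; exact hQ, fun h => ⟨_, _, .rmul .., h⟩⟩

@[simp] theorem run_rdiv {s : State} {i j k : ℕ} {Q : State → ℕ → Prop} :
    Run (.rdiv i j k) s Q ↔ s.rreg k ≠ 0 ∧ Q (s.setR i (s.rreg j / s.rreg k)) 1 :=
  ⟨fun ⟨_, _, h, hQ⟩ => (by cases h with | rdiv _ _ _ _ h => exact ⟨h, hQ⟩),
    fun h => ⟨_, _, .rdiv _ _ _ _ h.1, h.2⟩⟩

@[simp] theorem run_rlog {s : State} {i j : ℕ} {Q : State → ℕ → Prop} :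
    Run (.rlog i j) s Q ↔ 0 < s.rreg j ∧ Q (s.setR i (Real.log (s.rreg j))) 1 :=
  ⟨fun ⟨_, _, h, hQ⟩ => (by cases h with | rlog _ _ _ h => exact ⟨h, hQ⟩),
    fun h => ⟨_, _, .rlog _ _ _ h.1, h.2⟩⟩

@[simp] theorem run_rload {s : State} {i a j : ℕ} {Q : State → ℕ → Prop} :
    Run (.rload i a j) s Q ↔ Q (s.setR i (s.rarr a (s.ireg j))) 1 :=
  ⟨fun ⟨_, _, h, hQ⟩ => by cases h; exact hQ, fun h => ⟨_, _, .rload .., h⟩⟩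

@[simp] theorem run_rstore {s : State} {a j i : ℕ} {Q : State → ℕ → Prop} :
    Run (.rstore a j i) s Q ↔ Q (s.setRArr a (s.ireg j) (s.rreg i)) 1 :=
  ⟨fun ⟨_, _, h, hQ⟩ => by cases h; exact hQ, fun h => ⟨_, _, .rstore .., h⟩⟩

@[simp] theorem run_seq {p q : Prog} {s : State} {Q : State → ℕ → Prop} :
    Run (.seq p q) s Q ↔ Run p s fun s₁ t₁ => Run q s₁ fun s₂ t₂ => Q s₂ (t₁ + t₂) :=
  ⟨fun ⟨_, _, h, hQ⟩ => by
    cases h with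
    | seq h₁ h₂ => exact ⟨_, _, h₁, _, _, h₂, hQ⟩,
    fun ⟨_, _, h₁, _, _, h₂, hQ⟩ => ⟨_, _, .seq h₁ h₂, hQ⟩⟩

@[simp] theorem run_cond {b : Test} {p q : Prog} {s : State} {Q : State → ℕ → Prop} :
    Run (.cond b p q) s Q ↔
      (b.Holds s → Run p s fun s' t => Q s' (t + 1)) ∧
        (¬ b.Holds s → Run q s fun s' t => Q s' (t + 1)) := by
  constructor
  · rintro ⟨s', t, h, hQ⟩
    cases h with
    | condTrue hb h => exact ⟨fun _ => ⟨_, _, h, hQ⟩, fun h' => absurd hb h'⟩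
    | condFalse hb h => exact ⟨fun h' => absurd h' hb, fun _ => ⟨_, _, h, hQ⟩⟩
  · rintro ⟨h₁, h₂⟩
    by_cases hb : b.Holds s
    · obtain ⟨s', t, h, hQ⟩ := h₁ hb
      exact ⟨_, _, .condTrue hb h, hQ⟩
    · obtain ⟨s', t, h, hQ⟩ := h₂ hb
      exact ⟨_, _, .condFalse hb h, hQ⟩

@[simp] theorem holds_ilt {i j : ℕ} {s : State} : (Test.ilt i j).Holds s ↔ s.ireg i < s.ireg j :=
  Iff.rfl
@[simp] theorem holds_ieq {i j : ℕ} {s : State} : (Test.ieq i j).Holds s ↔ s.ireg i = s.ireg j :=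
  Iff.rfl
@[simp] theorem holds_rlt {i j : ℕ} {s : State} : (Test.rlt i j).Holds s ↔ s.rreg i < s.rreg j :=
  Iff.rfl
@[simp] theorem holds_rle {i j : ℕ} {s : State} : (Test.rle i j).Holds s ↔ s.rreg i ≤ s.rreg j :=
  Iff.rfl

namespace State
variable (s : State) (i j a k b v : ℕ) (x : ℝ)

@[simp] theorem setI_ireg : (s.setI i v).ireg j = if j = i then v else s.ireg j := by
  simp [setI, Function.update_apply]
@[simp] theorem setI_rreg : (s.setI i v).rreg = s.rreg := rfl
@[simp] theorem setI_iarr : (s.setI i v).iarr = s.iarr := rfl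
@[simp] theorem setI_rarr : (s.setI i v).rarr = s.rarr := rfl
@[simp] theorem setR_ireg : (s.setR i x).ireg = s.ireg := rfl
@[simp] theorem setR_rreg : (s.setR i x).rreg j = if j = i then x else s.rreg j := by
  simp [setR, Function.update_apply]
@[simp] theorem setR_iarr : (s.setR i x).iarr = s.iarr := rfl
@[simp] theorem setR_rarr : (s.setR i x).rarr = s.rarr := rfl
@[simp] theorem setIArr_ireg : (s.setIArr a k v).ireg = s.ireg := rfl
@[simp] theorem setIArr_rreg : (s.setIArr a k v).rreg = s.rreg := rfl
@[simp] theorem setIArr_iarr :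
    (s.setIArr a k v).iarr b = if b = a then Function.update (s.iarr a) k v else s.iarr b := by
  simp [setIArr, Function.update_apply]
@[simp] theorem setIArr_rarr : (s.setIArr a k v).rarr = s.rarr := rfl
@[simp] theorem setRArr_ireg : (s.setRArr a k x).ireg = s.ireg := rfl
@[simp] theorem setRArr_rreg : (s.setRArr a k x).rreg = s.rreg := rfl
@[simp] theorem setRArr_iarr : (s.setRArr a k x).iarr = s.iarr := rfl
@[simp] theorem setRArr_rarr :
    (s.setRArr a k x).rarr b = if b = a then Function.update (s.rarr a) k x else s.rarr b := by
  simp [setRArr, Function.update_apply]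

end State

/-! ### The parts of the state that a program does not write to -/

/-- Does the program write to index register `x`? -/
def Prog.wi (x : ℕ) : Prog → Bool
  | .iconst i _ => i == x
  | .iadd i _ _ => i == x
  | .isub i _ _ => i == x
  | .iload i _ _ => i == x
  | .seq p q => p.wi x || q.wi x
  | .cond _ p q => p.wi x || q.wi x
  | .loop _ p => p.wi x
  | _ => false

/-- Does the program write to real register `x`? -/
def Prog.wr (x : ℕ) : Prog → Bool
  | .rconst i _ => i == x
  | .rofi i _ => i == x
  | .radd i _ _ => i == x
  | .rsub i _ _ => i == x
  | .rmul i _ _ => i == x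
  | .rdiv i _ _ => i == x
  | .rlog i _ => i == x
  | .rload i _ _ => i == x
  | .seq p q => p.wr x || q.wr x
  | .cond _ p q => p.wr x || q.wr x
  | .loop _ p => p.wr x
  | _ => false

/-- Does the program write to index array `x`? -/
def Prog.wia (x : ℕ) : Prog → Bool
  | .istore a _ _ => a == x
  | .seq p q => p.wia x || q.wia x
  | .cond _ p q => p.wia x || q.wia x
  | .loop _ p => p.wia x
  | _ => false

/-- Does the program write to real array `x`? -/
def Prog.wra (x : ℕ) : Prog → Bool
  | .rstore a _ _ => a == x
  | .seq p q => p.wra x || q.wra x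
  | .cond _ p q => p.wra x || q.wra x
  | .loop _ p => p.wra x
  | _ => false

/-- The states agree on everything that `p` does not write to. -/
structure Frame (p : Prog) (s s' : State) : Prop where
  i : ∀ x, p.wi x = false → s'.ireg x = s.ireg x
  r : ∀ x, p.wr x = false → s'.rreg x = s.rreg x
  ia : ∀ x, p.wia x = false → s'.iarr x = s.iarr x
  ra : ∀ x, p.wra x = false → s'.rarr x = s.rarr x

theorem Frame.refl (p : Prog) (s : State) : Frame p s s :=
  ⟨fun _ _ => rfl, fun _ _ => rfl, fun _ _ => rfl, fun _ _ => rfl⟩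

theorem Frame.trans {p : Prog} {s s' s'' : State} (h : Frame p s s') (h' : Frame p s' s'') :
    Frame p s s'' :=
  ⟨fun x hx => (h'.i x hx).trans (h.i x hx), fun x hx => (h'.r x hx).trans (h.r x hx),
    fun x hx => (h'.ia x hx).trans (h.ia x hx), fun x hx => (h'.ra x hx).trans (h.ra x hx)⟩

theorem Frame.weaken {p q : Prog} {s s' : State} (h : Frame p s s')
    (hi : ∀ x, q.wi x = false → p.wi x = false) (hr : ∀ x, q.wr x = false → p.wr x = false)
    (hia : ∀ x, q.wia x = false → p.wia x = false)
    (hra : ∀ x, q.wra x = false → p.wra x = false) : Frame q s s' :=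
  ⟨fun x hx => h.i x (hi x hx), fun x hx => h.r x (hr x hx), fun x hx => h.ia x (hia x hx),
    fun x hx => h.ra x (hra x hx)⟩

/-- What a program leaves alone can be read off its text. `wi`, `wr`, `wia` and `wra` are Boolean
functions so that, for concrete programs and registers, the side conditions hold by `rfl`. -/
theorem Exec.frame {p : Prog} {s s' : State} {t : ℕ} (h : Exec p s s' t) : Frame p s s' := by
  induction h with
  | seq _ _ ih ih' =>
    refine (ih.weaken ?_ ?_ ?_ ?_).trans (ih'.weaken ?_ ?_ ?_ ?_) <;>
      simp +contextual [Prog.wi, Prog.wr, Prog.wia, Prog.wra]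
  | condTrue _ _ ih =>
    refine ih.weaken ?_ ?_ ?_ ?_ <;> simp +contextual [Prog.wi, Prog.wr, Prog.wia, Prog.wra]
  | condFalse _ _ ih =>
    refine ih.weaken ?_ ?_ ?_ ?_ <;> simp +contextual [Prog.wi, Prog.wr, Prog.wia, Prog.wra]
  | loopFalse _ => exact Frame.refl _ _
  | @loopTrue b p s s₁ _ _ _ _ _ _ ih ih' =>
    have h : Frame (.loop b p) s s₁ :=
      ih.weaken (fun _ h => h) (fun _ h => h) (fun _ h => h) (fun _ h => h)
    exact h.trans ih'
  | _ =>
    constructor <;> intro x hx <;>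
      simp only [Prog.wi, Prog.wr, Prog.wia, Prog.wra, beq_eq_false_iff_ne, ne_eq] at hx <;>
      simp [eq_comm (a := x)] <;> exact fun h => absurd h hx

theorem Run.frame {p : Prog} {s : State} {Q : State → ℕ → Prop} (h : Run p s Q) :
    Run p s fun s' t => Q s' t ∧ Frame p s s' := by
  obtain ⟨s', t, he, hQ⟩ := h
  exact ⟨s', t, he, hQ, he.frame⟩

/-- Replace the postcondition; the frame of the program may be used. -/
theorem Run.imp {p : Prog} {s : State} {P Q : State → ℕ → Prop} (h : Run p s P)
    (hPQ : ∀ s' t, P s' t → Frame p s s' → Q s' t) : Run p s Q :=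
  h.frame.mono fun s' t h => hPQ s' t h.1 h.2

/-- The rule for loops, with an invariant that may depend on the number of iterations. -/
theorem run_loop {b : Test} {p : Prog} {s : State} {Q : State → ℕ → Prop} (J : ℕ)
    (I : ℕ → State → Prop) (T : ℕ → ℕ) (h0 : I 0 s)
    (hstep : ∀ j s', I j s' → Frame p s s' → b.Holds s' →
      j < J ∧ Run p s' fun s'' t => I (j + 1) s'' ∧ t ≤ T j)
    (hQ : ∀ j s' t, j ≤ J → I j s' → Frame p s s' → ¬ b.Holds s' →
      t ≤ 1 + ∑ i ∈ Finset.range J, (T i + 1) → Q s' t) :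
    Run (.loop b p) s Q := by
  -- Induction on the number `k` of iterations still allowed. `hstep` yields `j < J`, so the body
  -- cannot be entered when `k = 0`.
  have key : ∀ k j s', k + j = J → I j s' → Frame p s s' →
      ∃ s'' t j', Exec (.loop b p) s' s'' t ∧ j' ≤ J ∧ I j' s'' ∧ Frame p s s'' ∧ ¬ b.Holds s'' ∧
        t ≤ 1 + ∑ i ∈ Finset.Ico j J, (T i + 1) := by
    intro k
    induction k with
    | zero =>
      intro j s' hj hI hF
      by_cases hb : b.Holds s'
      · have := (hstep j s' hI hF hb).1
        omega
      · exact ⟨s', 1, j, .loopFalse hb, by omega, hI, hF, hb, by omega⟩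
    | succ k ih =>
      intro j s' hj hI hF
      by_cases hb : b.Holds s'
      · obtain ⟨hlt, s₁, t₁, he, hI₁, ht₁⟩ := hstep j s' hI hF hb
        obtain ⟨s₂, t₂, j', he₂, hj', hI₂, hF₂, hb₂, ht₂⟩ :=
          ih (j + 1) s₁ (by omega) hI₁ (hF.trans he.frame)
        refine ⟨s₂, _, j', .loopTrue hb he he₂, hj', hI₂, hF₂, hb₂, ?_⟩
        rw [Finset.sum_eq_sum_Ico_succ_bot hlt]
        omega
      · exact ⟨s', 1, j, .loopFalse hb, by omega, hI, hF, hb, by omega⟩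
  obtain ⟨s', t, j, he, hj, hI, hF, hb, ht⟩ := key J 0 s (by omega) h0 (Frame.refl _ _)
  exact ⟨s', t, he, hQ j s' t hj hI hF hb (by simpa using ht)⟩

infixr:60 " ;; " => Prog.seq

end RealRAM

/-! ### Maximum subarrays with prescribed starting values -/

/-- The summary of an interval of positions, each with a weight and a starting value. -/
@[ext]
structure Node where
  /-- the total weight -/
  sum : ℝ
  /-- the maximal weight of a prefix -/
  pre : ℝ
  /-- the maximal value of a sequence that ends at the right end -/
  start : ℝ
  /-- the maximal value of a sequence -/
  best : ℝ

namespace Node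

/-- The summary of the concatenation of two intervals. -/
noncomputable def op (a b : Node) : Node :=
  ⟨a.sum + b.sum, max a.pre (a.sum + b.pre), max b.start (a.start + b.sum),
    max (max a.best b.best) (a.start + b.pre)⟩

/-- The summary of a single position with weight `w` and starting value `e`. -/
noncomputable def leaf (w e : ℝ) : Node := ⟨w, max w 0, e, e⟩

/-- `x` is the summary of the interval `[lo, hi)`. -/
structure Sem (w e : ℕ → ℝ) (lo hi : ℕ) (x : Node) : Prop where
  sum : x.sum = ∑ u ∈ Ico lo hi, w u
  pre_ub : ∀ k, lo ≤ k → k ≤ hi → ∑ u ∈ Ico lo k, w u ≤ x.pre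
  pre_att : ∃ k, lo ≤ k ∧ k ≤ hi ∧ x.pre = ∑ u ∈ Ico lo k, w u
  start_ub : ∀ i, lo ≤ i → i < hi → e i + ∑ u ∈ Ico (i + 1) hi, w u ≤ x.start
  start_att : ∃ i, lo ≤ i ∧ i < hi ∧ x.start = e i + ∑ u ∈ Ico (i + 1) hi, w u
  best_ub : ∀ i k, lo ≤ i → i < k → k ≤ hi → e i + ∑ u ∈ Ico (i + 1) k, w u ≤ x.best
  best_att : ∃ i k, lo ≤ i ∧ i < k ∧ k ≤ hi ∧ x.best = e i + ∑ u ∈ Ico (i + 1) k, w u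

theorem sem_leaf (w e : ℕ → ℝ) (u : ℕ) : Sem w e u (u + 1) (leaf (w u) (e u)) where
  sum := by simp [leaf]
  pre_ub k h₁ h₂ := by
    obtain rfl | rfl : k = u ∨ k = u + 1 := by omega
    · simp [leaf]
    · simp [leaf]
  pre_att := by
    rcases le_total (w u) 0 with h | h
    · exact ⟨u, le_rfl, by omega, by simp [leaf, h]⟩
    · exact ⟨u + 1, by omega, le_rfl, by simp [leaf, h]⟩
  start_ub i h₁ h₂ := by
    obtain rfl : i = u := by omega
    simp [leaf]
  start_att := ⟨u, le_rfl, by omega, by simp [leaf]⟩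
  best_ub i k h₁ h₂ h₃ := by
    obtain rfl : i = u := by omega
    obtain rfl : k = i + 1 := by omega
    simp [leaf]
  best_att := ⟨u, u + 1, le_rfl, by omega, le_rfl, by simp [leaf]⟩

/-- A sequence starts at some `i` with value `e i` and then collects the weights after `i`. It lies
in one of the halves, or it is a sequence that reaches the right end of the left half, continued by
a prefix of the right half. Prefixes may be empty, but a sequence always contains its start. -/
theorem Sem.op {w e : ℕ → ℝ} {lo mid hi : ℕ} {x y : Node} (hx : Sem w e lo mid x)
    (hy : Sem w e mid hi y) (h₁ : lo ≤ mid) (h₂ : mid ≤ hi) : Sem w e lo hi (x.op y) where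
  sum := by
    rw [Node.op, hx.sum, hy.sum, sum_Ico_consecutive _ h₁ h₂]
  pre_ub k hk hk' := by
    rcases le_total k mid with h | h
    · exact (hx.pre_ub k hk h).trans (le_max_left _ _)
    · rw [← sum_Ico_consecutive _ h₁ h, ← hx.sum]
      exact (add_le_add_right (hy.pre_ub k h hk') _).trans (le_max_right _ _)
  pre_att := by
    rcases max_choice x.pre (x.sum + y.pre) with h | h
    · obtain ⟨k, hk, hk', he⟩ := hx.pre_att
      exact ⟨k, hk, hk'.trans h₂, h.trans he⟩
    · obtain ⟨k, hk, hk', he⟩ := hy.pre_att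
      refine ⟨k, h₁.trans hk, hk', h.trans ?_⟩
      rw [← sum_Ico_consecutive _ h₁ hk, ← hx.sum, he]
  start_ub i hi' hi'' := by
    rcases lt_or_ge i mid with h | h
    · rw [← sum_Ico_consecutive _ (by omega : i + 1 ≤ mid) h₂, ← hy.sum, ← add_assoc]
      exact (add_le_add_left (hx.start_ub i hi' h) _).trans (le_max_right _ _)
    · exact (hy.start_ub i h hi'').trans (le_max_left _ _)
  start_att := by
    rcases max_choice y.start (x.start + y.sum) with h | h
    · obtain ⟨k, hk, hk', he⟩ := hy.start_att
      exact ⟨k, h₁.trans hk, hk', h.trans he⟩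
    · obtain ⟨k, hk, hk', he⟩ := hx.start_att
      refine ⟨k, hk, hk'.trans_le h₂, h.trans ?_⟩
      rw [← sum_Ico_consecutive _ (by omega : k + 1 ≤ mid) h₂, ← hy.sum, he, add_assoc]
  best_ub i k hi' hik hk := by
    rcases lt_or_ge i mid with h | h
    · rcases le_total k mid with h' | h'
      · exact (hx.best_ub i k hi' hik h').trans ((le_max_left _ _).trans (le_max_left _ _))
      · rw [← sum_Ico_consecutive _ (by omega : i + 1 ≤ mid) h', ← add_assoc]
        exact (add_le_add (hx.start_ub i hi' h) (hy.pre_ub k h' hk)).trans (le_max_right _ _)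
    · exact (hy.best_ub i k h hik hk).trans ((le_max_right _ _).trans (le_max_left _ _))
  best_att := by
    rcases max_choice (max x.best y.best) (x.start + y.pre) with h | h
    · rcases max_choice x.best y.best with h' | h'
      · obtain ⟨i, k, hi', hik, hk, he⟩ := hx.best_att
        exact ⟨i, k, hi', hik, hk.trans h₂, (h.trans h').trans he⟩
      · obtain ⟨i, k, hi', hik, hk, he⟩ := hy.best_att
        exact ⟨i, k, h₁.trans hi', hik, hk, (h.trans h').trans he⟩
    · obtain ⟨i, hi', hi'', he⟩ := hx.start_att
      obtain ⟨k, hk, hk', he'⟩ := hy.pre_att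
      refine ⟨i, k, hi', by omega, hk', h.trans ?_⟩
      rw [← sum_Ico_consecutive _ (by omega : i + 1 ≤ mid) hk, he, he', add_assoc]

/-- In a consistent binary tree the nodes summarize the leaves below them. -/
theorem sem_tree {T : ℕ → Node} {w e : ℕ → ℝ} {h : ℕ}
    (hT : ∀ v, 1 ≤ v → v < 2 ^ h → T v = (T (v + v)).op (T (v + v + 1)))
    (hl : ∀ u, 2 ^ h ≤ u → u < 2 ^ (h + 1) → T u = leaf (w u) (e u)) :
    Sem w e (2 ^ h) (2 ^ (h + 1)) (T 1) := by
  -- The nodes are numbered as in a binary heap, with the leaves from `2 ^ h` on: node `v` at height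
  -- `k` covers the positions in `[v * 2 ^ k, (v + 1) * 2 ^ k)`.
  have key : ∀ k, k ≤ h → ∀ v, 2 ^ (h - k) ≤ v → v < 2 ^ (h - k + 1) →
      Sem w e (v * 2 ^ k) ((v + 1) * 2 ^ k) (T v) := by
    intro k
    induction k with
    | zero =>
      intro _ v hv hv'
      rw [hl v (by simpa using hv) (by simpa using hv')]
      simpa using sem_leaf w e v
    | succ k ih =>
      intro hk v hv hv'
      have hkk : h - k = h - (k + 1) + 1 := by omega
      have hpow : 2 ^ (h - k) = 2 ^ (h - (k + 1)) * 2 := by rw [hkk, pow_succ]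
      have hv1 : 1 ≤ v := Nat.one_le_two_pow.trans hv
      have hvh : v < 2 ^ h := hv'.trans_le (Nat.pow_le_pow_right (by norm_num) (by omega))
      rw [hT v hv1 hvh]
      have e₁ := ih (by omega) (v + v) (by omega) (by rw [pow_succ] at hv' ⊢; omega)
      have e₂ := ih (by omega) (v + v + 1) (by omega) (by rw [pow_succ] at hv' ⊢; omega)
      have a₁ : (v + v) * 2 ^ k = v * 2 ^ (k + 1) := by ring
      have a₂ : (v + v + 1 + 1) * 2 ^ k = (v + 1) * 2 ^ (k + 1) := by ring
      rw [a₁] at e₁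
      rw [a₂] at e₂
      refine e₁.op e₂ ?_ ?_
      · rw [← a₁]; exact Nat.mul_le_mul_right _ (by omega)
      · rw [← a₂]; exact Nat.mul_le_mul_right _ (by omega)
  have := key h le_rfl 1 (by simp) (by simp)
  rwa [one_mul, show (1 + 1) * 2 ^ h = 2 ^ (h + 1) by ring] at this

end Node

/-! ### The segment tree in the machine -/

namespace RealRAM

/-- The segment tree of the state. -/
def State.tree (s : State) (v : ℕ) : Node :=
  ⟨s.rarr 12 v, s.rarr 13 v, s.rarr 14 v, s.rarr 15 v⟩

/-- `R d := max (R a) (R b)`, when real register 3 holds zero. -/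
def maxProg (d a b : ℕ) : Prog := .cond (.rle a b) (.radd d b 3) (.radd d a 3)

-- Adding the zero in register 3 serves as a copy instruction. Both branches cost the same, which
-- allows an equivalence with a fixed time.
@[simp] theorem run_maxProg {d a b : ℕ} {s : State} {Q : State → ℕ → Prop} (h : s.rreg 3 = 0) :
    Run (maxProg d a b) s Q ↔ Q (s.setR d (max (s.rreg a) (s.rreg b))) 2 := by
  simp only [maxProg, run_cond, run_radd, holds_rle, h, add_zero]
  rcases le_or_gt (s.rreg a) (s.rreg b) with h | h
  · simp [h]
  · simp [h.le, h.not_ge]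

/-- Recompute the node in index register 35. -/
def pullProg : Prog :=
  .iadd 36 35 35 ;; .iadd 37 36 2 ;;
  .rload 40 12 36 ;; .rload 41 13 36 ;; .rload 42 14 36 ;; .rload 43 15 36 ;;
  .rload 44 12 37 ;; .rload 45 13 37 ;; .rload 46 14 37 ;; .rload 47 15 37 ;;
  .radd 48 40 44 ;; .rstore 12 35 48 ;;
  .radd 48 40 45 ;; maxProg 48 41 48 ;; .rstore 13 35 48 ;;
  .radd 48 42 44 ;; maxProg 48 46 48 ;; .rstore 14 35 48 ;;
  maxProg 43 43 47 ;; .radd 48 42 45 ;; maxProg 48 43 48 ;; .rstore 15 35 48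

theorem run_pullProg {s : State} (h3 : s.rreg 3 = 0) (h2 : s.ireg 2 = 1) :
    Run pullProg s fun s' t => (∀ u, s'.tree u = if u = s.ireg 35 then
      (s.tree (s.ireg 35 + s.ireg 35)).op (s.tree (s.ireg 35 + s.ireg 35 + 1)) else s.tree u) ∧
      t ≤ 30 := by
  simp only [pullProg, run_seq, run_iadd, run_rload, run_radd, run_rstore, run_maxProg,
    State.setI_ireg, State.setI_rreg, State.setI_rarr, State.setR_rreg, State.setR_ireg,
    State.setR_rarr, State.setRArr_rreg, State.setRArr_ireg, State.setRArr_rarr, h3, h2,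
    Nat.reduceEqDiff, reduceIte]
  refine ⟨fun u => ?_, by norm_num⟩
  split_ifs with hu <;> ext <;> simp [State.tree, Node.op, hu, Function.update_of_ne]

/-- Node `v` of the tree is the summary of its two children. -/
def Cons (T : ℕ → Node) (v : ℕ) : Prop := T v = (T (v + v)).op (T (v + v + 1))

/-- Recompute the ancestors of leaf `I 30`. -/
def pathProg : Prog := .iadd 35 3 30 ;; .loop (.ilt 2 35) (.iload 35 3 35 ;; pullProg)

/-- After a leaf has changed, only its proper ancestors can be inconsistent. The climb keeps the
invariant that only proper ancestors of the current node are in doubt, and at the root there are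
none. Parents come from a table, because the machine cannot halve an index. -/
theorem run_pathProg {s : State} {h : ℕ} (h3 : s.rreg 3 = 0) (h2 : s.ireg 2 = 1)
    (hN : s.ireg 3 = 2 ^ h) (hi : s.ireg 30 < 2 ^ h)
    (hpar : ∀ u, 2 ≤ u → u < 2 ^ (h + 1) → s.iarr 3 u = u / 2)
    (hc : ∀ v, 1 ≤ v → v < 2 ^ h → (∀ k, 1 ≤ k → v ≠ (2 ^ h + s.ireg 30) / 2 ^ k) →
      Cons s.tree v) :
    Run pathProg s fun s' t => (∀ v, 1 ≤ v → v < 2 ^ h → Cons s'.tree v) ∧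
      (∀ u, 2 ^ h ≤ u → s'.tree u = s.tree u) ∧ t ≤ 40 * (h + 1) := by
  have hu1 : 2 ^ h + s.ireg 30 < 2 ^ (h + 1) := by rw [pow_succ]; omega
  simp only [pathProg, run_seq, run_iadd, hN]
  set u₀ := 2 ^ h + s.ireg 30 with hu₀
  refine run_loop h (fun j s' => s'.ireg 35 = u₀ / 2 ^ j ∧
    (∀ u, 2 ^ h ≤ u → s'.tree u = s.tree u) ∧
    ∀ v, 1 ≤ v → v < 2 ^ h → (∀ k, 1 ≤ k → v ≠ u₀ / 2 ^ j / 2 ^ k) → Cons s'.tree v)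
    (fun _ => 31) ?_ ?_ ?_
  · refine ⟨by simp, fun u _ => rfl, fun v hv hv' hk => hc v hv hv' (by simpa using hk)⟩
  · rintro j s' ⟨h35, hleaf, hcons⟩ F hb
    have e2 : s'.ireg 2 = 1 := by rw [F.i 2 rfl]; simpa using h2
    have e3 : s'.rreg 3 = 0 := by rw [F.r 3 rfl]; simpa using h3
    have ep : s'.iarr 3 = s.iarr 3 := by rw [F.ia 3 rfl]; simp
    simp only [holds_ilt, e2, h35] at hb
    have hpos : 0 < 2 ^ j := by positivity
    have hjh : j < h := by
      have : 2 ≤ u₀ / 2 ^ j := hb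
      rw [Nat.le_div_iff_mul_le hpos, ← pow_succ'] at this
      have := (Nat.pow_lt_pow_iff_right (by norm_num : 1 < 2)).1 (this.trans_lt hu1)
      omega
    refine ⟨hjh, ?_⟩
    have hv2 : s'.iarr 3 (u₀ / 2 ^ j) = u₀ / 2 ^ (j + 1) := by
      rw [ep, hpar _ hb ((Nat.div_le_self _ _).trans_lt hu1), Nat.div_div_eq_div_mul, pow_succ]
    simp only [run_seq, run_iload, h35, hv2]
    refine (run_pullProg (by simpa using e3) (by simpa using e2)).imp ?_
    rintro s'' t ⟨htree, ht⟩ F'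
    have e35 : s''.ireg 35 = u₀ / 2 ^ (j + 1) := by rw [F'.i 35 rfl]; simp
    set v₁ := u₀ / 2 ^ (j + 1) with hv₁
    have hv₁h : v₁ < 2 ^ h := by
      rw [hv₁, Nat.div_lt_iff_lt_mul (by positivity), pow_succ 2 j, mul_comm (2 ^ j), ← mul_assoc,
        ← pow_succ]
      exact hu1.trans_le (Nat.le_mul_of_pos_right _ hpos)
    simp only [State.setI_ireg, reduceIte] at htree
    have htree' : ∀ u, s''.tree u = if u = v₁ then
        (s'.tree (v₁ + v₁)).op (s'.tree (v₁ + v₁ + 1)) else s'.tree u := htree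
    have hdiv : ∀ k, u₀ / 2 ^ j / 2 ^ (k + 1) = v₁ / 2 ^ k := fun k => by
      rw [hv₁, Nat.div_div_eq_div_mul, Nat.div_div_eq_div_mul, ← pow_add, ← pow_add]
      congr 2; omega
    refine ⟨⟨e35, fun u hu => ?_, fun v hv hv' hk => ?_⟩, by omega⟩
    · rw [htree', if_neg (by omega), hleaf u hu]
    · by_cases hvv : v = v₁
      · unfold Cons
        rw [htree', if_pos hvv, htree', if_neg (by omega), htree', if_neg (by omega), hvv]
      · have h₁ : v + v ≠ v₁ := fun hh => hk 1 le_rfl (by rw [pow_one, ← hh]; omega)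
        have h₂ : v + v + 1 ≠ v₁ := fun hh => hk 1 le_rfl (by rw [pow_one, ← hh]; omega)
        unfold Cons
        rw [htree', if_neg hvv, htree', if_neg h₁, htree', if_neg h₂]
        refine hcons v hv hv' fun k hk1 => ?_
        obtain ⟨k, rfl⟩ : ∃ k', k = k' + 1 := ⟨k - 1, by omega⟩
        rw [hdiv]
        rcases Nat.eq_zero_or_pos k with rfl | hk0
        · simpa using hvv
        · exact hk k hk0
  · rintro j s' t - ⟨h35, hleaf, hcons⟩ F hb ht
    have e2 : s'.ireg 2 = 1 := by rw [F.i 2 rfl]; simpa using h2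
    simp only [holds_ilt, e2, h35, not_lt] at hb
    refine ⟨fun v hv hv' => hcons v hv hv' fun k hk hh => ?_, hleaf, ?_⟩
    · have : u₀ / 2 ^ j / 2 ^ k = 0 := by
        refine Nat.div_eq_of_lt (hb.trans_lt (Nat.one_lt_two_pow (by omega)))
      omega
    · simp only [Finset.sum_const, Finset.card_range, smul_eq_mul] at ht
      omega

end RealRAM

/-! ### Columns of weights -/

/-- The sum of `f` over `[l, k)`. -/
noncomputable def seg (f : ℕ → ℝ) (l k : ℕ) : ℝ := ∑ c ∈ Ico l k, f c

theorem seg_succ {f : ℕ → ℝ} {l k : ℕ} (h : l ≤ k) : seg f l (k + 1) = seg f l k + f k :=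
  sum_Ico_succ_top h f

theorem seg_add {f : ℕ → ℝ} {l m k : ℕ} (h : l ≤ m) (h' : m ≤ k) :
    seg f l m + seg f m k = seg f l k :=
  sum_Ico_consecutive f h h'

theorem seg_mono {f : ℕ → ℝ} (hf : ∀ c, 0 ≤ f c) {l l' k k' : ℕ} (h : l' ≤ l) (h' : k ≤ k') :
    seg f l k ≤ seg f l' k' :=
  sum_le_sum_of_subset_of_nonneg (Ico_subset_Ico h h') fun c _ _ => hf c

theorem seg_self (f : ℕ → ℝ) (l : ℕ) : seg f l l = 0 := by simp [seg]

theorem seg_comb {am ab : ℝ} {M B : ℕ → ℝ} {l k : ℕ} :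
    seg (fun c => am * M c + ab * B c) l k = am * seg M l k + ab * seg B l k := by
  simp only [seg, sum_add_distrib, mul_sum]

/-- The sums over `[l, k)` of both weights are at least `thr`. -/
def Feas (thr : ℝ) (M B : ℕ → ℝ) (l k : ℕ) : Prop := thr ≤ seg M l k ∧ thr ≤ seg B l k

/-- Two families of column weights for the columns `1, …, N - 1`, such that an interval of columns
has at most `K` nonzero columns unless it is feasible. -/
structure Cols (N K : ℕ) (thr : ℝ) (M B : ℕ → ℝ) : Prop where
  M_nonneg : ∀ c, 0 ≤ M c
  B_nonneg : ∀ c, 0 ≤ B c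
  zero : ∀ c, M c = 0 → B c = 0
  M_zero : M 0 = 0
  few : ∀ l k, ¬ Feas thr M B l k → #{c ∈ Ico l k | 0 < M c} ≤ K

/-- `d` is the last nonzero column before `c`, or zero. -/
structure IsPrev (M : ℕ → ℝ) (c d : ℕ) : Prop where
  lt : d < c
  mem : d = 0 ∨ 0 < M d
  le : ∀ x, 0 < M x → x < c → x ≤ d

/-- `d` is the first nonzero column after `c`, or `N`. -/
structure IsNext (N : ℕ) (M : ℕ → ℝ) (c d : ℕ) : Prop where
  lt : c < d
  mem : d = N ∨ d < N ∧ 0 < M d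
  le : ∀ x, x < N → 0 < M x → c < x → d ≤ x

/-- The maximal weight of an interval `[l, i]` with `l₀ < l` that is minimally feasible, in the
sense that `[l, i)` is not feasible, or `NEG` if there is none. -/
structure StartOK (thr NEG am ab : ℝ) (M B : ℕ → ℝ) (l₀ i : ℕ) (e : ℝ) : Prop where
  att : e = NEG ∨ ∃ l, l₀ < l ∧ l ≤ i ∧ Feas thr M B l (i + 1) ∧ ¬ Feas thr M B l i ∧
    e = am * seg M l (i + 1) + ab * seg B l (i + 1)
  ub : ∀ l, l₀ < l → l ≤ i → Feas thr M B l (i + 1) → ¬ Feas thr M B l i →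
    am * seg M l (i + 1) + ab * seg B l (i + 1) ≤ e

section
variable {N K i l d : ℕ} {thr NEG am ab e : ℝ} {M B M' B' : ℕ → ℝ}

theorem Feas.mono {l' k k' : ℕ} (hC : Cols N K thr M B) (h : Feas thr M B l k) (hl : l' ≤ l)
    (hk : k ≤ k') : Feas thr M B l' k' :=
  ⟨h.1.trans (seg_mono hC.M_nonneg hl hk), h.2.trans (seg_mono hC.B_nonneg hl hk)⟩

theorem IsPrev.eq_zero (hC : Cols N K thr M B) (hp : IsPrev M l d) {x : ℕ} (h : d < x)
    (h' : x < l) : M x = 0 := by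
  by_contra hx
  have := hp.le x (lt_of_le_of_ne (hC.M_nonneg x) (Ne.symm hx)) h'
  omega

theorem seg_of_zero {f : ℕ → ℝ} {x k : ℕ} (hx : x ≤ l) (hk : l ≤ k)
    (h : ∀ c, x ≤ c → c < l → f c = 0) : seg f x k = seg f l k := by
  rw [← seg_add hx hk, seg, sum_eq_zero fun c hc => h c (mem_Ico.1 hc).1 (mem_Ico.1 hc).2, zero_add]

theorem IsPrev.seg_M (hC : Cols N K thr M B) (hp : IsPrev M l d) {x k : ℕ} (h : d < x)
    (h' : x ≤ l) (hk : l ≤ k) : seg M x k = seg M l k :=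
  seg_of_zero h' hk fun _ hc hc' => hp.eq_zero hC (h.trans_le hc) hc'

theorem IsPrev.seg_B (hC : Cols N K thr M B) (hp : IsPrev M l d) {x k : ℕ} (h : d < x)
    (h' : x ≤ l) (hk : l ≤ k) : seg B x k = seg B l k :=
  seg_of_zero h' hk fun _ hc hc' => hC.zero _ (hp.eq_zero hC (h.trans_le hc) hc')

theorem IsPrev.seg_M' (hC : Cols N K thr M B) (hp : IsPrev M l d) {k : ℕ} (hk : l ≤ k) :
    seg M d k = seg M l k + M d := by
  rw [← hp.seg_M hC (Nat.lt_succ_self d) hp.lt hk, ← seg_add (Nat.le_succ d) (hp.lt.trans_le hk),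
    add_comm]
  simp [seg]

theorem IsPrev.seg_B' (hC : Cols N K thr M B) (hp : IsPrev M l d) {k : ℕ} (hk : l ≤ k) :
    seg B d k = seg B l k + B d := by
  rw [← hp.seg_B hC (Nat.lt_succ_self d) hp.lt hk, ← seg_add (Nat.le_succ d) (hp.lt.trans_le hk),
    add_comm]
  simp [seg]

/-- Counts the steps of the scan to the left: each one adds a nonempty column to the interval, and
infeasible intervals have few of them. -/
theorem IsPrev.card (hp : IsPrev M l d) (hd : 0 < d) (hli : l ≤ i) :
    #{c ∈ Ico l i | 0 < M c} + 1 ≤ #{c ∈ Ico d i | 0 < M c} := by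
  rw [← card_insert_of_notMem (a := d) (s := {c ∈ Ico l i | 0 < M c}) (by
    have := hp.lt
    simp only [mem_filter, mem_Ico]; omega)]
  refine card_le_card fun x hx => ?_
  have hdl := hp.lt
  simp only [mem_insert, mem_filter, mem_Ico] at hx ⊢
  rcases hx with rfl | ⟨⟨h₁, h₂⟩, h₃⟩
  · exact ⟨by omega, hp.mem.resolve_left (by omega)⟩
  · exact ⟨by omega, h₃⟩

/-- If `[l, i)` is feasible, then so is `[x, i)` for every `x ≤ l`. No such `x` is a minimal start,
and the scan may stop. -/
theorem StartOK.of_feas (hC : Cols N K thr M B) (h : StartOK thr NEG am ab M B l i e)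
    (hf : Feas thr M B l i) : StartOK thr NEG am ab M B 0 i e where
  att := h.att.imp_right fun ⟨x, hx, h'⟩ => ⟨x, by omega, h'⟩
  ub x _ hx' h₁ h₂ := by
    rcases lt_or_ge l x with hlx | hlx
    · exact h.ub x hlx hx' h₁ h₂
    · exact absurd (hf.mono hC hlx le_rfl) h₂

/-- The columns strictly between `d` and `l` are empty, so all starts in `(d, l]` give the same
sums, and examining `l` alone settles them. -/
theorem StartOK.step (hC : Cols N K thr M B) (h : StartOK thr NEG am ab M B l i e)
    (hp : IsPrev M l d) (hli : l ≤ i) (hf : ¬ Feas thr M B l i) {e' : ℝ}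
    (h₁ : Feas thr M B l (i + 1) → e' = max e (am * seg M l (i + 1) + ab * seg B l (i + 1)))
    (h₂ : ¬ Feas thr M B l (i + 1) → e' = e) : StartOK thr NEG am ab M B d i e' where
  att := by
    have hatt : e = NEG ∨ ∃ l, d < l ∧ l ≤ i ∧ Feas thr M B l (i + 1) ∧ ¬ Feas thr M B l i ∧
        e = am * seg M l (i + 1) + ab * seg B l (i + 1) :=
      h.att.imp_right fun ⟨x, hx, h'⟩ => ⟨x, hp.lt.trans hx, h'⟩
    by_cases hfe : Feas thr M B l (i + 1)
    · rw [h₁ hfe]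
      rcases max_choice e (am * seg M l (i + 1) + ab * seg B l (i + 1)) with he | he
      · rwa [he]
      · exact .inr ⟨l, hp.lt, hli, hfe, hf, he⟩
    · rwa [h₂ hfe]
  ub x hx hxi hf₁ hf₂ := by
    rcases lt_or_ge l x with hlx | hlx
    · refine (h.ub x hlx hxi hf₁ hf₂).trans ?_
      by_cases hfe : Feas thr M B l (i + 1)
      · rw [h₁ hfe]; exact le_max_left _ _
      · rw [h₂ hfe]
    · have eM := hp.seg_M hC hx hlx (k := i + 1) (by omega)
      have eB := hp.seg_B hC hx hlx (k := i + 1) (by omega)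
      have hfe : Feas thr M B l (i + 1) := by
        rw [Feas, ← eM, ← eB]; exact hf₁
      rw [h₁ hfe, eM, eB]
      exact le_max_right _ _

theorem StartOK.init : StartOK thr NEG am ab M B i i NEG where
  att := .inl rfl
  ub x hx hxi := by omega

/-- The starting value of an empty column. -/
theorem StartOK.of_zero (hC : Cols N K thr M B) (h : M i = 0) :
    StartOK thr NEG am ab M B 0 i NEG where
  att := .inl rfl
  ub x hx hxi h₁ h₂ := by
    -- An empty last column adds nothing, so it cannot be the one that makes an interval feasible.
    rw [Feas, seg_succ hxi, seg_succ hxi, h, hC.zero i h, add_zero, add_zero] at h₁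
    exact absurd h₁ h₂

/-- The starting value of column `i` does not change if the weights are only changed in column `p`
and `[p, i)` remains feasible. -/
theorem StartOK.congr {p : ℕ} (h : StartOK thr NEG am ab M B 0 i e)
    (hC : Cols N K thr M B) (hC' : Cols N K thr M' B') (hM : ∀ c, c ≠ p → M' c = M c)
    (hB : ∀ c, c ≠ p → B' c = B c) (hMp : M' p ≤ M p) (hBp : B' p ≤ B p)
    (hi : i < p ∨ p < i ∧ Feas thr M' B' p i) : StartOK thr NEG am ab M' B' 0 i e := by
  have hsM : ∀ l k, p < l ∨ k ≤ p → seg M' l k = seg M l k := fun l k hlk =>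
    sum_congr rfl fun c hc => hM c (by rw [mem_Ico] at hc; omega)
  have hsB : ∀ l k, p < l ∨ k ≤ p → seg B' l k = seg B l k := fun l k hlk =>
    sum_congr rfl fun c hc => hB c (by rw [mem_Ico] at hc; omega)
  have hF : ∀ l k, p < l ∨ k ≤ p → (Feas thr M' B' l k ↔ Feas thr M B l k) := fun l k hlk => by
    rw [Feas, Feas, hsM l k hlk, hsB l k hlk]
  -- If `[p, i)` is feasible even with the reduced weights, every `[l, i)` with `l ≤ p` is feasible
  -- before and after the change. A minimally feasible interval that ends at `i` therefore starts
  -- after `p` and does not see the change.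
  have hfeas : ∀ l, l ≤ p → p < i → Feas thr M B l i := fun l hl hpi => by
    obtain ⟨h₁, h₂⟩ := (hi.resolve_left (by omega)).2
    refine Feas.mono hC ⟨h₁.trans ?_, h₂.trans ?_⟩ hl le_rfl
    · exact sum_le_sum fun c _ => by
        by_cases hc : c = p
        · rw [hc]; exact hMp
        · rw [hM c hc]
    · exact sum_le_sum fun c _ => by
        by_cases hc : c = p
        · rw [hc]; exact hBp
        · rw [hB c hc]
  constructor
  · refine h.att.imp_right ?_
    rintro ⟨l, hl, hli, h₁, h₂, h₃⟩
    have hlp : p < l ∨ i + 1 ≤ p := by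
      by_contra hcon
      exact h₂ (hfeas l (by omega) (by omega))
    refine ⟨l, hl, hli, (hF l _ hlp).2 h₁, fun hh => h₂ ((hF l i (by omega)).1 hh), ?_⟩
    rw [hsM l _ hlp, hsB l _ hlp, h₃]
  · intro l hl hli h₁ h₂
    have hlp : p < l ∨ i + 1 ≤ p := by
      by_contra hcon
      exact h₂ ((hi.resolve_left (by omega)).2.mono hC' (by omega) le_rfl)
    rw [hsM l _ hlp, hsB l _ hlp]
    exact h.ub l hl hli ((hF l _ hlp).1 h₁) fun hh => h₂ ((hF l i (by omega)).2 hh)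

end

/-! ### The computation of a starting value -/

namespace RealRAM

/-- `I f := 1` if `R x` and `R y` are both at least `R 5`, and `I f := 0` otherwise. -/
def feasProg (x y f : ℕ) : Prog :=
  .iconst f 0 ;; .cond (.rle 5 x) (.cond (.rle 5 y) (.iconst f 1) .skip) (.cond (.rle 5 y) .skip .skip)

-- The last branch contains an idle test, so that every path takes four steps and the cost does not
-- depend on the state.
open Classical in
@[simp] theorem run_feasProg {x y f : ℕ} {s : State} {Q : State → ℕ → Prop} :
    Run (feasProg x y f) s Q ↔
      Q (s.setI f (if s.rreg 5 ≤ s.rreg x ∧ s.rreg 5 ≤ s.rreg y then 1 else 0)) 4 := by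
  have e : (s.setI f 0).setI f 1 = s.setI f 1 := by simp [State.setI]
  by_cases h₁ : s.rreg 5 ≤ s.rreg x <;> by_cases h₂ : s.rreg 5 ≤ s.rreg y <;>
    simp [feasProg, -not_le, h₁, h₂, e]

/-- One step of the computation of a starting value. -/
def scanStep : Prog :=
  feasProg 31 32 32 ;; feasProg 33 34 33 ;;
  .cond (.ieq 33 2) (.iconst 31 0) (
    .rmul 37 17 31 ;; .rmul 38 18 32 ;; .radd 37 37 38 ;;
    .cond (.ieq 32 2) (maxProg 30 30 37) .skip ;;
    .iload 31 4 31 ;; .rload 35 10 31 ;; .rload 36 11 31 ;;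
    .radd 31 31 35 ;; .radd 33 33 35 ;; .radd 32 32 36 ;; .radd 34 34 36)

/-- Compute the starting value of the nonempty column `I 30`. -/
def scanProg : Prog :=
  .radd 30 10 3 ;; .iadd 31 30 1 ;; .rload 31 10 31 ;; .rload 32 11 30 ;; .rconst 33 0 ;;
  .rconst 34 0 ;; .loop (.ilt 1 31) scanStep

/-- The scan moves left through the nonempty columns `l` and carries the sums over `[l, i]` and `[l,
i)`. It goes on only while `[l, i)` is infeasible, so `Cols.few` limits it to `K + 2` iterations,
however far left the column `i` reaches. Index 0 ends the scan: column 0 is always empty and stands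
for a missing predecessor. -/
theorem run_scanProg {s : State} {N K : ℕ} {M B : ℕ → ℝ} (hC : Cols N K (s.rreg 5) M B)
    (h3 : s.rreg 3 = 0) (h1 : s.ireg 1 = 0) (h2 : s.ireg 2 = 1)
    (hM : ∀ c < N, s.rarr 10 c = M c) (hB : ∀ c < N, s.rarr 11 c = B c)
    (hi : s.ireg 30 < N) (hMi : 0 < M (s.ireg 30))
    (hprev : ∀ c ≤ s.ireg 30, 0 < M c → IsPrev M c (s.iarr 4 c)) :
    Run scanProg s fun s' t => StartOK (s.rreg 5) (s.rreg 10) (s.rreg 17) (s.rreg 18) M B 0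
      (s.ireg 30) (s'.rreg 30) ∧ t ≤ 30 * (K + 3) := by
  have hi0 : 0 < s.ireg 30 := by
    rcases Nat.eq_zero_or_pos (s.ireg 30) with h | h
    · rw [h, hC.M_zero] at hMi; exact absurd hMi (lt_irrefl _)
    · exact h
  simp only [scanProg, run_seq, run_radd, run_iadd, run_rload, run_rconst, State.setI_ireg,
    State.setI_rreg, State.setI_rarr, State.setR_rreg, State.setR_ireg, State.setR_rarr, h3, h1,
    Nat.reduceEqDiff, reduceIte, add_zero]
  set i := s.ireg 30 with hidef
  refine run_loop (K + 2) (fun j s' =>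
    (s'.ireg 31 = 0 → StartOK (s.rreg 5) (s.rreg 10) (s.rreg 17) (s.rreg 18) M B 0 i (s'.rreg 30)) ∧
    (0 < s'.ireg 31 → s'.ireg 31 ≤ i ∧ 0 < M (s'.ireg 31) ∧
      s'.rreg 31 = seg M (s'.ireg 31) (i + 1) ∧ s'.rreg 32 = seg B (s'.ireg 31) (i + 1) ∧
      s'.rreg 33 = seg M (s'.ireg 31) i ∧ s'.rreg 34 = seg B (s'.ireg 31) i ∧
      StartOK (s.rreg 5) (s.rreg 10) (s.rreg 17) (s.rreg 18) M B (s'.ireg 31) i (s'.rreg 30) ∧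
      j ≤ K + 1 ∧ j ≤ #{c ∈ Ico (s'.ireg 31) i | 0 < M c})) (fun _ => 28) ?_ ?_ ?_
  · refine ⟨fun h => ?_, fun _ => ?_⟩
    · simp at h; omega
    · simp [seg_self, seg_succ, hM i hi, hB i hi, hMi, StartOK.init]
  · rintro j s' ⟨-, hI⟩ F hb
    have e1 : s'.ireg 1 = 0 := by rw [F.i 1 rfl]; simpa using h1
    have e2 : s'.ireg 2 = 1 := by rw [F.i 2 rfl]; simpa using h2
    have e3 : s'.rreg 3 = 0 := by rw [F.r 3 rfl]; simpa using h3
    have e5 : s'.rreg 5 = s.rreg 5 := by rw [F.r 5 rfl]; simp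
    have e17 : s'.rreg 17 = s.rreg 17 := by rw [F.r 17 rfl]; simp
    have e18 : s'.rreg 18 = s.rreg 18 := by rw [F.r 18 rfl]; simp
    have ep : s'.iarr 4 = s.iarr 4 := by rw [F.ia 4 rfl]; simp
    have e10 : s'.rarr 10 = s.rarr 10 := by rw [F.ra 10 rfl]; simp
    have e11 : s'.rarr 11 = s.rarr 11 := by rw [F.ra 11 rfl]; simp
    simp only [holds_ilt, e1] at hb
    obtain ⟨hli, hMl, h31, h32, h33, h34, hS, hjK, hj⟩ := hI hb
    refine ⟨by omega, ?_⟩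
    set l := s'.ireg 31 with hl
    have hp := hprev l hli hMl
    set d := s.iarr 4 l with hd
    have hdl := hp.lt
    simp only [scanStep, run_seq, run_feasProg, run_cond, run_rmul, run_radd, run_iload, run_rload,
      run_iconst, run_skip, run_maxProg, holds_ieq, State.setI_ireg, State.setI_rreg,
      State.setI_rarr, State.setI_iarr, State.setR_rreg, State.setR_ireg, State.setR_rarr,
      State.setR_iarr, e1, e2, e3, e5, e17, e18, ep, e10, e11, h31, h32, h33, h34, ← hl, ← hd,
      Nat.reduceEqDiff, reduceIte, hM d (by omega), hB d (by omega)]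
    have hfeas : ∀ k, (s.rreg 5 ≤ seg M l k ∧ s.rreg 5 ≤ seg B l k) ↔ Feas (s.rreg 5) M B l k :=
      fun k => Iff.rfl
    have hone : ∀ p : Prop, ∀ _ : Decidable p, ((if p then 1 else 0) = 1) ↔ p := fun p _ => by simp
    simp only [hfeas, hone]
    have hfin : ∀ e', ¬ Feas (s.rreg 5) M B l i → StartOK (s.rreg 5) (s.rreg 10) (s.rreg 17)
        (s.rreg 18) M B d i e' → (d = 0 → StartOK (s.rreg 5) (s.rreg 10) (s.rreg 17)
        (s.rreg 18) M B 0 i e') ∧ (0 < d → d ≤ i ∧ 0 < M d ∧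
          seg M l (i + 1) + M d = seg M d (i + 1) ∧ seg B l (i + 1) + B d = seg B d (i + 1) ∧
          seg M l i + M d = seg M d i ∧ seg B l i + B d = seg B d i ∧
          StartOK (s.rreg 5) (s.rreg 10) (s.rreg 17) (s.rreg 18) M B d i e' ∧
          j + 1 ≤ K + 1 ∧ j + 1 ≤ #{c ∈ Ico d i | 0 < M c}) := by
      intro e' hf he'
      refine ⟨fun h => h ▸ he', fun h => ⟨by omega, hp.mem.resolve_left (by omega), ?_, ?_, ?_, ?_,
        he', ?_, ?_⟩⟩
      · rw [hp.seg_M' hC (by omega)]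
      · rw [hp.seg_B' hC (by omega)]
      · rw [hp.seg_M' hC hli]
      · rw [hp.seg_B' hC hli]
      · have := hC.few l i hf; omega
      · have := hp.card h hli; omega
    refine ⟨fun hf => ⟨⟨fun _ => hS.of_feas hC hf, fun h => absurd h (lt_irrefl _)⟩, by norm_num⟩,
      fun hf => ⟨fun hf' => ⟨hfin _ hf (hS.step hC hp hli hf (fun _ => rfl) fun h => absurd hf' h),
        by norm_num⟩, fun hf' => ⟨hfin _ hf (hS.step hC hp hli hf (fun h => absurd h hf')
        fun _ => rfl), by norm_num⟩⟩⟩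
  · rintro j s' t - ⟨hI, -⟩ F hb ht
    have e1 : s'.ireg 1 = 0 := by rw [F.i 1 rfl]; simpa using h1
    simp only [holds_ilt, e1, not_lt, nonpos_iff_eq_zero] at hb
    simp only [sum_const, card_range, smul_eq_mul] at ht
    exact ⟨hI hb, by omega⟩

end RealRAM

/-! ### The dynamic data structure for columns -/

/-- The starting value of an empty column is `NEG`, whatever the other columns hold. This disposes
of the empty columns that a refresh jumps over. -/
theorem StartOK.congr_zero {N K c : ℕ} {thr NEG am ab e : ℝ} {M B M' B' : ℕ → ℝ}
    (hC : Cols N K thr M B) (hC' : Cols N K thr M' B') (h : M c = 0) (h' : M' c = 0)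
    (hS : StartOK thr NEG am ab M B 0 c e) : StartOK thr NEG am ab M' B' 0 c e := by
  have : e = NEG := by
    refine hS.att.resolve_right ?_
    rintro ⟨l, -, hl, h₁, h₂, -⟩
    rw [Feas, seg_succ hl, seg_succ hl, h, hC.zero c h, add_zero, add_zero] at h₁
    exact h₂ h₁
  rw [this]
  exact StartOK.of_zero hC' h'

theorem IsNext.card {N l d i : ℕ} {M : ℕ → ℝ} (hn : IsNext N M i d) (hl : l ≤ i) (hi : 0 < M i) :
    #{c ∈ Ico l i | 0 < M c} + 1 ≤ #{c ∈ Ico l d | 0 < M c} := by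
  rw [← card_insert_of_notMem (a := i) (s := {c ∈ Ico l i | 0 < M c}) (by simp)]
  refine card_le_card fun x hx => ?_
  have hdl := hn.lt
  simp only [mem_insert, mem_filter, mem_Ico] at hx ⊢
  rcases hx with rfl | ⟨⟨h₁, h₂⟩, h₃⟩
  · exact ⟨by omega, hi⟩
  · exact ⟨by omega, h₃⟩

theorem IsNext.eq_zero {N K i d : ℕ} {thr : ℝ} {M B : ℕ → ℝ} (hC : Cols N K thr M B)
    (hn : IsNext N M i d) {x : ℕ} (h : i < x) (h' : x < d) (hx : x < N) : M x = 0 := by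
  by_contra hne
  have := hn.le x hx (lt_of_le_of_ne (hC.M_nonneg x) (Ne.symm hne)) h
  omega

theorem IsNext.seg_eq {N K i d l : ℕ} {thr : ℝ} {M B : ℕ → ℝ} (hC : Cols N K thr M B)
    (hn : IsNext N M i d) (hl : l ≤ i) (hd : d < N) :
    seg M l d = seg M l i + M i ∧ seg B l d = seg B l i + B i := by
  have hdl := hn.lt
  have h0 : ∀ x, x ∈ Ico (i + 1) d → M x = 0 := fun x hx => by
    rw [mem_Ico] at hx
    exact hn.eq_zero hC (by omega) hx.2 (by omega)
  constructor
  · rw [← seg_add (show l ≤ i + 1 by omega) (show i + 1 ≤ d by omega), seg_succ hl]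
    simp [seg, sum_eq_zero h0]
  · rw [← seg_add (show l ≤ i + 1 by omega) (show i + 1 ≤ d by omega), seg_succ hl]
    simp [seg, sum_eq_zero fun x hx => hC.zero x (h0 x hx)]

namespace RealRAM

/-- The constants that the data structure uses. -/
structure Base (h : ℕ) (s : State) : Prop where
  r3 : s.rreg 3 = 0
  i1 : s.ireg 1 = 0
  i2 : s.ireg 2 = 1
  i3 : s.ireg 3 = 2 ^ h
  par : ∀ u, 2 ≤ u → u < 2 ^ (h + 1) → s.iarr 3 u = u / 2

theorem Base.of_eq {h : ℕ} {s s' : State} (hb : Base h s) (e3 : s'.rreg 3 = s.rreg 3)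
    (e1 : s'.ireg 1 = s.ireg 1) (e2 : s'.ireg 2 = s.ireg 2) (e4 : s'.ireg 3 = s.ireg 3)
    (ep : s'.iarr 3 = s.iarr 3) : Base h s' :=
  ⟨e3.trans hb.r3, e1.trans hb.i1, e2.trans hb.i2, e4.trans hb.i3, ep ▸ hb.par⟩

theorem Base.frame {h : ℕ} {s s' : State} {p : Prog} (hb : Base h s) (F : Frame p s s')
    (hr : p.wr 3 = false) (h1 : p.wi 1 = false) (h2 : p.wi 2 = false) (h3 : p.wi 3 = false)
    (hp : p.wia 3 = false) : Base h s' :=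
  hb.of_eq (F.r 3 hr) (F.i 1 h1) (F.i 2 h2) (F.i 3 h3) (F.ia 3 hp)

/-- The leaf of column `c` is correct. -/
def LeafOK (thr NEG am ab : ℝ) (M B : ℕ → ℝ) (N : ℕ) (s : State) (c : ℕ) : Prop :=
  ∃ e, s.tree (N + c) = Node.leaf (am * M c + ab * B c) e ∧ StartOK thr NEG am ab M B 0 c e

/-- The state holds the data structure for the column weights `M` and `B`. -/
structure DS (thr NEG am ab : ℝ) (h : ℕ) (M B : ℕ → ℝ) (s : State) : Prop where
  cellM : ∀ c < 2 ^ h, s.rarr 10 c = M c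
  cellB : ∀ c < 2 ^ h, s.rarr 11 c = B c
  prev : ∀ c < 2 ^ h, 0 < M c → IsPrev M c (s.iarr 4 c)
  next : ∀ c < 2 ^ h, 0 < M c → IsNext (2 ^ h) M c (s.iarr 5 c)
  cons : ∀ v, 1 ≤ v → v < 2 ^ h → Cons s.tree v
  leaf : ∀ c < 2 ^ h, LeafOK thr NEG am ab M B (2 ^ h) s c

/-- Write the leaf of column `I 30` with starting value `R 30`. -/
def writeLeaf : Prog :=
  .iadd 35 3 30 ;; .rload 31 10 30 ;; .rload 32 11 30 ;; .rmul 37 17 31 ;; .rmul 38 18 32 ;;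
  .radd 37 37 38 ;; .rstore 12 35 37 ;; maxProg 38 37 3 ;; .rstore 13 35 38 ;; .rstore 14 35 30 ;;
  .rstore 15 35 30

theorem run_writeLeaf {s : State} (h3 : s.rreg 3 = 0) :
    Run writeLeaf s fun s' t => (∀ u, s'.tree u = if u = s.ireg 3 + s.ireg 30 then
      Node.leaf (s.rreg 17 * s.rarr 10 (s.ireg 30) + s.rreg 18 * s.rarr 11 (s.ireg 30)) (s.rreg 30)
      else s.tree u) ∧ t ≤ 12 := by
  simp only [writeLeaf, run_seq, run_iadd, run_rload, run_radd, run_rmul, run_rstore, run_maxProg,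
    State.setI_ireg, State.setI_rreg, State.setI_rarr, State.setR_rreg, State.setR_ireg,
    State.setR_rarr, State.setRArr_rreg, State.setRArr_ireg, State.setRArr_rarr, h3,
    Nat.reduceEqDiff, reduceIte]
  refine ⟨fun u => ?_, by norm_num⟩
  split_ifs with hu <;> ext <;> simp [State.tree, Node.leaf, hu, Function.update_of_ne]

/-- Recompute the leaf of column `I 30`. -/
def setLeaf : Prog :=
  .rload 31 10 30 ;; .cond (.rlt 3 31) scanProg (.radd 30 10 3) ;; writeLeaf ;; pathProg

theorem run_setLeaf {s : State} {h K : ℕ} {M B : ℕ → ℝ} (hC : Cols (2 ^ h) K (s.rreg 5) M B)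
    (hb : Base h s) (hM : ∀ c < 2 ^ h, s.rarr 10 c = M c) (hB : ∀ c < 2 ^ h, s.rarr 11 c = B c)
    (hi : s.ireg 30 < 2 ^ h)
    (hprev : ∀ c ≤ s.ireg 30, 0 < M c → IsPrev M c (s.iarr 4 c))
    (hcons : ∀ v, 1 ≤ v → v < 2 ^ h → Cons s.tree v) :
    Run setLeaf s fun s' t => (∀ v, 1 ≤ v → v < 2 ^ h → Cons s'.tree v) ∧
      LeafOK (s.rreg 5) (s.rreg 10) (s.rreg 17) (s.rreg 18) M B (2 ^ h) s' (s.ireg 30) ∧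
      (∀ u, 2 ^ h ≤ u → u ≠ 2 ^ h + s.ireg 30 → s'.tree u = s.tree u) ∧
      t ≤ 30 * (K + 3) + 40 * (h + 1) + 20 := by
  simp only [setLeaf, run_seq, run_rload]
  have hscan : Run (.cond (.rlt 3 31) scanProg (.radd 30 10 3)) (s.setR 31 (s.rarr 10 (s.ireg 30)))
      fun s' t => StartOK (s.rreg 5) (s.rreg 10) (s.rreg 17) (s.rreg 18) M B 0 (s.ireg 30)
        (s'.rreg 30) ∧ t ≤ 30 * (K + 3) + 2 := by
    simp only [run_cond, holds_rlt, State.setR_rreg, run_radd, Nat.reduceEqDiff, reduceIte, hb.r3,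
      hM _ hi, add_zero]
    refine ⟨fun hpos => ?_, fun hpos => ⟨?_, by omega⟩⟩
    · refine (run_scanProg (N := 2 ^ h) (M := M) (B := B) (K := K) (by simpa using hC)
        (by simpa using hb.r3) (by simpa using hb.i1) (by simpa using hb.i2) (by simpa using hM)
        (by simpa using hB) (by simpa using hi) (by simpa using hpos) (by simpa using hprev)).mono ?_
      rintro s' t ⟨hS, ht⟩
      exact ⟨by simpa using hS, by omega⟩
    · exact StartOK.of_zero hC (le_antisymm (not_lt.1 hpos) (hC.M_nonneg _))
  refine hscan.imp ?_
  rintro s₁ t₁ ⟨hS, ht₁⟩ F₁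
  have hb₁ : Base h s₁ := (hb.of_eq (by simp) (by simp) (by simp) (by simp) (by simp)).frame F₁
    rfl rfl rfl rfl rfl
  refine (run_writeLeaf hb₁.r3).imp ?_
  rintro s₂ t₂ ⟨hT, ht₂⟩ F₂
  have hb₂ : Base h s₂ := hb₁.frame F₂ rfl rfl rfl rfl rfl
  have e30 : s₁.ireg 30 = s.ireg 30 := by rw [F₁.i 30 rfl]; simp
  have e30' : s₂.ireg 30 = s.ireg 30 := by rw [F₂.i 30 rfl, e30]
  have e17 : s₁.rreg 17 = s.rreg 17 := by rw [F₁.r 17 rfl]; simp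
  have e18 : s₁.rreg 18 = s.rreg 18 := by rw [F₁.r 18 rfl]; simp
  have e10 : s₁.rarr 10 = s.rarr 10 := by rw [F₁.ra 10 rfl]; simp
  have e11 : s₁.rarr 11 = s.rarr 11 := by rw [F₁.ra 11 rfl]; simp
  have eT : s₁.tree = s.tree := by
    funext u
    simp only [State.tree, F₁.ra 12 rfl, F₁.ra 13 rfl, F₁.ra 14 rfl, F₁.ra 15 rfl,
      State.setR_rarr]
  rw [hb₁.i3, e30, e17, e18, e10, e11, eT, hM _ hi, hB _ hi] at hT
  refine (run_pathProg (h := h) hb₂.r3 hb₂.i2 hb₂.i3 (by rwa [e30']) hb₂.par ?_).mono ?_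
  · intro v hv hv' hk
    rw [e30'] at hk
    have h₁ : v + v ≠ 2 ^ h + s.ireg 30 := fun hh => hk 1 le_rfl (by rw [pow_one, ← hh]; omega)
    have h₂ : v + v + 1 ≠ 2 ^ h + s.ireg 30 := fun hh => hk 1 le_rfl (by rw [pow_one, ← hh]; omega)
    unfold Cons
    rw [hT, hT, hT, if_neg (by omega), if_neg h₁, if_neg h₂]
    exact hcons v hv hv'
  · rintro s₃ t₃ ⟨hc, hl, ht₃⟩
    refine ⟨hc, ⟨_, ?_, hS⟩, fun u hu hu' => ?_, by omega⟩
    · rw [hl _ (by omega), hT, if_pos rfl]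
    · rw [hl _ hu, hT, if_neg hu']

/-- Recompute the starting values that depend on column `I 30`. -/
def refreshProg : Prog :=
  setLeaf ;; .rload 53 10 30 ;; .rload 54 11 30 ;; .iload 30 5 30 ;;
  .loop (.ilt 30 3) (feasProg 53 54 42 ;; .cond (.ieq 42 2) (.iadd 30 3 1)
    (setLeaf ;; .rload 55 10 30 ;; .rload 56 11 30 ;; .radd 53 53 55 ;; .radd 54 54 56 ;;
      .iload 30 5 30))

/-- A reduction in column `p` can affect the starting value of a later column `i` only if `[p, i)`
is infeasible for the new weights (`StartOK.congr`), which leaves at most `K + 1` nonempty columns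
after `p`. During the walk the leaves before the current column are right for the new weights, and
those from it on are still right for the old ones. `hnextp` is a separate hypothesis because column
`p` may be empty by now, yet its successor is where the walk begins. -/
theorem run_refreshProg {s : State} {h K : ℕ} {M B M' B' : ℕ → ℝ}
    (hC : Cols (2 ^ h) K (s.rreg 5) M B) (hC' : Cols (2 ^ h) K (s.rreg 5) M' B')
    (hb : Base h s) (hi : s.ireg 30 < 2 ^ h)
    (hMM : ∀ c, c ≠ s.ireg 30 → M' c = M c) (hBB : ∀ c, c ≠ s.ireg 30 → B' c = B c)
    (hMp : M' (s.ireg 30) ≤ M (s.ireg 30)) (hBp : B' (s.ireg 30) ≤ B (s.ireg 30))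
    (hM : ∀ c < 2 ^ h, s.rarr 10 c = M' c) (hB : ∀ c < 2 ^ h, s.rarr 11 c = B' c)
    (hprev : ∀ c < 2 ^ h, 0 < M' c → IsPrev M' c (s.iarr 4 c))
    (hnext : ∀ c < 2 ^ h, 0 < M' c → IsNext (2 ^ h) M' c (s.iarr 5 c))
    (hnextp : IsNext (2 ^ h) M' (s.ireg 30) (s.iarr 5 (s.ireg 30)))
    (hcons : ∀ v, 1 ≤ v → v < 2 ^ h → Cons s.tree v)
    (hleaf : ∀ c < 2 ^ h,
      LeafOK (s.rreg 5) (s.rreg 10) (s.rreg 17) (s.rreg 18) M B (2 ^ h) s c) :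
    Run refreshProg s fun s' t => DS (s.rreg 5) (s.rreg 10) (s.rreg 17) (s.rreg 18) h M' B' s' ∧
      t ≤ (K + 3) * (30 * (K + 3) + 40 * (h + 1) + 40) := by
  simp only [refreshProg, run_seq]
  refine (run_setLeaf hC' hb hM hB hi (fun c hc => hprev c (by omega)) hcons).imp ?_
  rintro s₁ t₁ ⟨hc₁, hl₁, hr₁, ht₁⟩ F₁
  have hb₁ : Base h s₁ := hb.frame F₁ rfl rfl rfl rfl rfl
  simp only [run_rload, run_iload, State.setI_ireg, State.setI_rreg, State.setI_rarr,
    State.setR_rreg, State.setR_ireg, State.setR_rarr, State.setR_iarr, F₁.i 30 rfl,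
    F₁.ra 10 rfl, F₁.ra 11 rfl, F₁.ia 5 rfl, hM _ hi, hB _ hi]
  set p := s.ireg 30 with hp
  set d := s.iarr 5 p with hd
  have hpd := hnextp.lt
  -- a leaf that is correct for the old weights is correct for the new ones
  have hconv : ∀ s' c, c < 2 ^ h → c ≠ p →
      (c < p ∨ p < c ∧ Feas (s.rreg 5) M' B' p c ∨ M' c = 0) →
      LeafOK (s.rreg 5) (s.rreg 10) (s.rreg 17) (s.rreg 18) M B (2 ^ h) s' c →
      LeafOK (s.rreg 5) (s.rreg 10) (s.rreg 17) (s.rreg 18) M' B' (2 ^ h) s' c := by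
    rintro s' c hc hcp hor ⟨e, he, hS⟩
    refine ⟨e, by rw [he, hMM c hcp, hBB c hcp], ?_⟩
    rcases hor with h | h | h
    · exact hS.congr hC hC' hMM hBB hMp hBp (.inl h)
    · exact hS.congr hC hC' hMM hBB hMp hBp (.inr h)
    · exact hS.congr_zero hC hC' (by rw [← hMM c hcp, h]) h
  have hcopy : ∀ s' s'' c, s''.tree (2 ^ h + c) = s'.tree (2 ^ h + c) → ∀ X Y,
      LeafOK (s.rreg 5) (s.rreg 10) (s.rreg 17) (s.rreg 18) X Y (2 ^ h) s' c →
      LeafOK (s.rreg 5) (s.rreg 10) (s.rreg 17) (s.rreg 18) X Y (2 ^ h) s'' c := by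
    rintro s' s'' c hcc X Y ⟨e, he, hS⟩
    exact ⟨e, hcc.trans he, hS⟩
  refine run_loop (K + 2) (fun j s' =>
    (∀ v, 1 ≤ v → v < 2 ^ h → Cons s'.tree v) ∧ p < s'.ireg 30 ∧
    (∀ c < 2 ^ h, c < s'.ireg 30 →
      LeafOK (s.rreg 5) (s.rreg 10) (s.rreg 17) (s.rreg 18) M' B' (2 ^ h) s' c) ∧
    (∀ c < 2 ^ h, s'.ireg 30 ≤ c →
      LeafOK (s.rreg 5) (s.rreg 10) (s.rreg 17) (s.rreg 18) M B (2 ^ h) s' c) ∧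
    (s'.ireg 30 < 2 ^ h → 0 < M' (s'.ireg 30) ∧ s'.rreg 53 = seg M' p (s'.ireg 30) ∧
      s'.rreg 54 = seg B' p (s'.ireg 30) ∧ j ≤ K + 1 ∧
      j ≤ #{c ∈ Ico p (s'.ireg 30) | 0 < M' c}))
    (fun _ => 30 * (K + 3) + 40 * (h + 1) + 20 + 15) ?_ ?_ ?_
  · refine ⟨hc₁, by simpa using hpd, fun c hc hcd => ?_, fun c hc hcd => ?_, fun hdN => ?_⟩
    · simp only [State.setI_ireg, reduceIte] at hcd
      by_cases hcp : c = p
      · exact hcp ▸ hl₁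
      · refine hcopy s _ c (hr₁ _ (by omega) (by omega)) _ _ (hconv s c hc hcp ?_ (hleaf c hc))
        rcases lt_or_ge c p with h' | h'
        · exact .inl h'
        · exact .inr (.inr (hnextp.eq_zero hC' (by omega) hcd hc))
    · simp only [State.setI_ireg, reduceIte] at hcd
      exact hcopy s _ c (hr₁ _ (by omega) (by omega)) _ _ (hleaf c hc)
    · simp only [State.setI_ireg, reduceIte] at hdN
      obtain ⟨e₁, e₂⟩ := hnextp.seg_eq hC' le_rfl hdN
      rw [seg_self, zero_add] at e₁ e₂
      rcases hnextp.mem with h' | h'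
      · omega
      · simp [e₁, e₂, h'.2]
  · rintro j s' ⟨hcons', hpi, hnew, hold, hI⟩ F hlt
    have hb' : Base h s' := (hb₁.of_eq (by simp) (by simp) (by simp) (by simp) (by simp)).frame F
      rfl rfl rfl rfl rfl
    have e5 : s'.rreg 5 = s.rreg 5 := by rw [F.r 5 rfl]; simpa using F₁.r 5 rfl
    have e10 : s'.rreg 10 = s.rreg 10 := by rw [F.r 10 rfl]; simpa using F₁.r 10 rfl
    have e17 : s'.rreg 17 = s.rreg 17 := by rw [F.r 17 rfl]; simpa using F₁.r 17 rfl
    have e18 : s'.rreg 18 = s.rreg 18 := by rw [F.r 18 rfl]; simpa using F₁.r 18 rfl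
    have a10 : s'.rarr 10 = s.rarr 10 := by rw [F.ra 10 rfl]; simpa using F₁.ra 10 rfl
    have a11 : s'.rarr 11 = s.rarr 11 := by rw [F.ra 11 rfl]; simpa using F₁.ra 11 rfl
    have a4 : s'.iarr 4 = s.iarr 4 := by rw [F.ia 4 rfl]; simpa using F₁.ia 4 rfl
    have a5 : s'.iarr 5 = s.iarr 5 := by rw [F.ia 5 rfl]; simpa using F₁.ia 5 rfl
    simp only [holds_ilt, hb'.i3] at hlt
    obtain ⟨hMi, h53, h54, hjK, hj⟩ := hI hlt
    refine ⟨by omega, ?_⟩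
    simp only [run_seq, run_feasProg, run_cond, run_iadd, holds_ieq, State.setI_ireg, hb'.i2,
      Nat.reduceEqDiff, reduceIte, e5, h53, h54]
    set i := s'.ireg 30 with hidef
    have hfeas : (s.rreg 5 ≤ seg M' p i ∧ s.rreg 5 ≤ seg B' p i) ↔ Feas (s.rreg 5) M' B' p i :=
      Iff.rfl
    have hone : ∀ p : Prop, ∀ _ : Decidable p, ((if p then 1 else 0) = 1) ↔ p := fun p _ => by simp
    simp only [hfeas, hone]
    -- As soon as `[p, i)` is feasible, no further leaf has to change, and jumping to the sentinel
    -- `2 ^ h` ends the loop.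
    refine ⟨fun hf => ⟨⟨hcons', ?_, fun c hc _ => ?_, fun c hc hcN => ?_, fun hN => ?_⟩, by omega⟩,
      fun hf => ?_⟩
    · simp only [hb'.i3, hb'.i1]; omega
    · rcases lt_or_ge c i with hci | hci
      · exact hnew c hc hci
      · exact hconv s' c hc (by omega) (.inr (.inl ⟨by omega, hf.mono hC' le_rfl hci⟩))
          (hold c hc hci)
    · simp only [hb'.i3, hb'.i1] at hcN; omega
    · simp only [hb'.i3, hb'.i1] at hN; omega
    · refine (run_setLeaf (h := h) (K := K) (M := M') (B := B') (by simpa [e5] using hC')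
        (hb'.of_eq (by simp) (by simp) (by simp) (by simp) (by simp)) (by simpa [a10] using hM)
        (by simpa [a11] using hB) (by simpa using hlt) ?_ (by exact hcons')).imp ?_
      · intro c hc
        simp only [State.setI_ireg, Nat.reduceEqDiff, reduceIte] at hc
        simpa [a4] using hprev c (by omega)
      · rintro s₂ t₂ ⟨hc₂, hl₂, hr₂, ht₂⟩ F₂
        have b30 : s₂.ireg 30 = i := by rw [F₂.i 30 rfl]; simp [hidef]
        have b53 : s₂.rreg 53 = seg M' p i := by rw [F₂.r 53 rfl]; simpa using h53
        have b54 : s₂.rreg 54 = seg B' p i := by rw [F₂.r 54 rfl]; simpa using h54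
        have b10 : s₂.rarr 10 = s.rarr 10 := by rw [F₂.ra 10 rfl]; simpa using a10
        have b11 : s₂.rarr 11 = s.rarr 11 := by rw [F₂.ra 11 rfl]; simpa using a11
        have b5 : s₂.iarr 5 = s.iarr 5 := by rw [F₂.ia 5 rfl]; simpa using a5
        simp only [run_rload, run_iload, run_radd, State.setI_ireg, State.setI_rreg,
          State.setI_rarr, State.setR_rreg, State.setR_ireg, State.setR_rarr, State.setR_iarr,
          b30, b53, b54, b10, b11, b5, Nat.reduceEqDiff, reduceIte, hM _ hlt, hB _ hlt]
        simp only [State.setI_ireg, State.setI_rreg, Nat.reduceEqDiff, reduceIte, e5, e10, e17, e18,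
          ← hidef] at hl₂ hr₂
        have hn := hnext i hlt hMi
        have hid := hn.lt
        set d' := s.iarr 5 i
        refine ⟨⟨hc₂, by omega, fun c hc hcd => ?_, fun c hc hcd => ?_, fun hdN => ?_⟩, by omega⟩
        · rcases lt_trichotomy c i with hci | hci | hci
          · exact hcopy s' _ c (hr₂ _ (by omega) (by omega)) _ _ (hnew c hc hci)
          · exact hci ▸ hl₂
          · exact hcopy s' _ c (hr₂ _ (by omega) (by omega)) _ _ (hconv s' c hc (by omega)
              (.inr (.inr (hn.eq_zero hC' hci hcd hc))) (hold c hc (by omega)))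
        · exact hcopy s' _ c (hr₂ _ (by omega) (by omega)) _ _ (hold c hc (by omega))
        · obtain ⟨q₁, q₂⟩ := hn.seg_eq hC' hpi.le hdN
          refine ⟨?_, q₁.symm, q₂.symm, ?_, ?_⟩
          · rcases hn.mem with h' | h'
            · omega
            · exact h'.2
          · have := hC'.few p i hf; omega
          · have := hn.card hpi.le hMi; omega
  · rintro j s' t - ⟨hcons', hpi, hnew, hold, hI⟩ F hlt ht
    have hb' : Base h s' := (hb₁.of_eq (by simp) (by simp) (by simp) (by simp) (by simp)).frame F
      rfl rfl rfl rfl rfl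
    simp only [holds_ilt, hb'.i3, not_lt] at hlt
    have a10 : s'.rarr 10 = s.rarr 10 := by rw [F.ra 10 rfl]; simpa using F₁.ra 10 rfl
    have a11 : s'.rarr 11 = s.rarr 11 := by rw [F.ra 11 rfl]; simpa using F₁.ra 11 rfl
    have a4 : s'.iarr 4 = s.iarr 4 := by rw [F.ia 4 rfl]; simpa using F₁.ia 4 rfl
    have a5 : s'.iarr 5 = s.iarr 5 := by rw [F.ia 5 rfl]; simpa using F₁.ia 5 rfl
    refine ⟨⟨by rwa [a10], by rwa [a11], by rwa [a4], by rwa [a5], hcons',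
      fun c hc => hnew c hc (by omega)⟩, ?_⟩
    simp only [sum_const, card_range, smul_eq_mul] at ht
    set X := 30 * (K + 3) + 40 * (h + 1) with hX
    have : (K + 3) * (X + 40) = (K + 2) * (X + 36) + 4 * (K + 2) + X + 40 := by ring
    have : (K + 2) * (X + 20 + 15 + 1) = (K + 2) * (X + 36) := by ring
    omega

end RealRAM

/-! ### Points and columns -/

/-- The total weight of the points of `A` in column `c`. -/
noncomputable def colSum (f : ℕ → ℝ) (col : ℕ → ℕ) (A : Finset ℕ) (c : ℕ) : ℝ :=
  ∑ a ∈ A with col a = c, f a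

/-- The points of `A` in the columns `[l, k)`. -/
def inCols (col : ℕ → ℕ) (A : Finset ℕ) (l k : ℕ) : Finset ℕ := {a ∈ A | l ≤ col a ∧ col a < k}

/-- Weighted points in the columns `1, …, 2 ^ h - 1`, such that a set of points has at most `K`
elements unless both its weights are at least `thr`. -/
structure Pts (n h K : ℕ) (thr : ℝ) (mv bv : ℕ → ℝ) (col : ℕ → ℕ) : Prop where
  m_pos : ∀ a < n, 0 < mv a
  b_pos : ∀ a < n, 0 < bv a
  col_pos : ∀ a < n, 0 < col a
  col_lt : ∀ a < n, col a < 2 ^ h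
  few : ∀ S ⊆ range n, (∑ a ∈ S, mv a < thr ∨ ∑ a ∈ S, bv a < thr) → #S ≤ K

section
variable {n h K : ℕ} {thr : ℝ} {mv bv f : ℕ → ℝ} {col : ℕ → ℕ} {A : Finset ℕ}

theorem seg_colSum (l k : ℕ) : seg (colSum f col A) l k = ∑ a ∈ inCols col A l k, f a := by
  have hmap : ∀ a ∈ inCols col A l k, col a ∈ Ico l k := fun a ha => by
    simpa [inCols] using (mem_filter.1 ha).2
  rw [seg, ← sum_fiberwise_of_maps_to hmap]
  refine sum_congr rfl fun c hc => ?_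
  rw [colSum, inCols, filter_filter]
  refine sum_congr (filter_congr fun a _ => ?_) fun _ _ => rfl
  rw [mem_Ico] at hc
  constructor
  · rintro rfl; exact ⟨hc, rfl⟩
  · exact fun h => h.2

theorem colSum_pos_iff (hf : ∀ a ∈ A, 0 < f a) {c : ℕ} :
    0 < colSum f col A c ↔ ∃ a ∈ A, col a = c := by
  constructor
  · intro h
    by_contra hcon
    push Not at hcon
    rw [colSum, filter_eq_empty_iff.2 fun a ha => hcon a ha] at h
    simp at h
  · rintro ⟨a, ha, hac⟩
    exact sum_pos (fun x hx => hf x (mem_filter.1 hx).1) ⟨a, mem_filter.2 ⟨ha, hac⟩⟩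

theorem colSum_erase {a : ℕ} (ha : a ∈ A) (c : ℕ) :
    colSum f col (A.erase a) c = if c = col a then colSum f col A c - f a else colSum f col A c := by
  rw [colSum, colSum, filter_erase]
  split_ifs with hc
  · rw [eq_sub_iff_add_eq]
    exact sum_erase_add _ _ (mem_filter.2 ⟨ha, hc.symm⟩)
  · rw [erase_eq_of_notMem]
    exact fun hh => hc (mem_filter.1 hh).2.symm

/-- Different nonempty columns contain different points, so the bound on the number of points of a
light set also bounds its nonempty columns. -/
theorem Pts.cols (hP : Pts n h K thr mv bv col) (hA : A ⊆ range n) :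
    Cols (2 ^ h) K thr (colSum mv col A) (colSum bv col A) where
  M_nonneg c := sum_nonneg fun a ha => (hP.m_pos a (mem_range.1 (hA (mem_filter.1 ha).1))).le
  B_nonneg c := sum_nonneg fun a ha => (hP.b_pos a (mem_range.1 (hA (mem_filter.1 ha).1))).le
  zero c hc := by
    rw [colSum, filter_eq_empty_iff.2, sum_empty]
    intro a ha hac
    exact absurd hc ((colSum_pos_iff fun x hx => hP.m_pos x (mem_range.1 (hA hx))).2
      ⟨a, ha, hac⟩).ne'
  M_zero := by
    rw [colSum, filter_eq_empty_iff.2, sum_empty]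
    exact fun a ha => (hP.col_pos a (mem_range.1 (hA ha))).ne'
  few l k hf := by
    rw [Feas, seg_colSum, seg_colSum, not_and_or, not_le, not_le] at hf
    refine le_trans ?_ (hP.few (inCols col A l k) ((filter_subset _ _).trans hA) hf)
    refine le_trans (card_le_card ?_) (card_image_le (f := col))
    intro c hc
    obtain ⟨h₁, h₂⟩ := mem_filter.1 hc
    obtain ⟨a, ha, rfl⟩ := (colSum_pos_iff fun x hx => hP.m_pos x (mem_range.1 (hA hx))).1 h₂
    exact mem_image_of_mem _ (mem_filter.2 ⟨ha, mem_Ico.1 h₁⟩)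

end

theorem IsPrev.congr {M M' : ℕ → ℝ} {c d : ℕ} (h : IsPrev M c d)
    (hM : ∀ x, 0 < M' x ↔ 0 < M x) : IsPrev M' c d :=
  ⟨h.lt, h.mem.imp_right (hM d).2, fun x hx => h.le x ((hM x).1 hx)⟩

theorem IsNext.congr {N : ℕ} {M M' : ℕ → ℝ} {c d : ℕ} (h : IsNext N M c d)
    (hM : ∀ x, c < x → (0 < M' x ↔ 0 < M x)) : IsNext N M' c d :=
  ⟨h.lt, h.mem.imp_right fun hd => ⟨hd.1, (hM d h.lt).2 hd.2⟩,
    fun x hxN hx hcx => h.le x hxN ((hM x hcx).1 hx) hcx⟩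

/-- Unlinking a column keeps the predecessors correct. -/
theorem IsPrev.unlink {N : ℕ} {M M' : ℕ → ℝ} {pr : ℕ → ℕ} {p q : ℕ} (hp : p < N) (hMp : 0 < M p)
    (hM : ∀ x, 0 < M' x ↔ x ≠ p ∧ 0 < M x)
    (hprev : ∀ c < N, 0 < M c → IsPrev M c (pr c)) (hq : IsNext N M p q) {c : ℕ}
    (hc : c < N) (hMc : 0 < M' c) : IsPrev M' c (Function.update pr q (pr p) c) := by
  obtain ⟨hcp, hMc'⟩ := (hM c).1 hMc
  have h₁ := hprev c hc hMc'
  have h₂ := hprev p hp hMp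
  have l₁ := h₁.lt
  have l₂ := h₂.lt
  have l₃ := hq.lt
  by_cases hcq : c = q
  · rw [hcq, Function.update_self]
    refine ⟨by omega, h₂.mem.imp_right fun h => (hM _).2 ⟨by omega, h⟩, fun x hx hxq => ?_⟩
    obtain ⟨hxp, hx'⟩ := (hM x).1 hx
    refine h₂.le x hx' ?_
    by_contra hcon
    have := hq.le x (by omega) hx' (by omega)
    omega
  · rw [Function.update_of_ne hcq]
    refine ⟨l₁, h₁.mem.imp_right fun h => (hM _).2 ⟨fun hpc => ?_, h⟩, fun x hx => h₁.le x
      ((hM x).1 hx).2⟩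
    -- If `p` were the predecessor of `c`, then the successor `q` of `p` would be a nonempty column
    -- strictly between the two.
    have a₁ := hq.le c hc hMc' (by omega)
    rcases hq.mem with h' | h'
    · omega
    · have := h₁.le q h'.2 (by omega)
      omega

/-- Unlinking a column keeps the successors correct. -/
theorem IsNext.unlink {N : ℕ} {M M' : ℕ → ℝ} {nx : ℕ → ℕ} {p q : ℕ} (hp : p < N) (hMp : 0 < M p)
    (hM : ∀ x, 0 < M' x ↔ x ≠ p ∧ 0 < M x)
    (hnext : ∀ c < N, 0 < M c → IsNext N M c (nx c)) (hq : IsPrev M p q) {c : ℕ}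
    (hc : c < N) (hMc : 0 < M' c) : IsNext N M' c (Function.update nx q (nx p) c) := by
  obtain ⟨hcp, hMc'⟩ := (hM c).1 hMc
  have h₁ := hnext c hc hMc'
  have h₂ := hnext p hp hMp
  have l₁ := h₁.lt
  have l₂ := h₂.lt
  have l₃ := hq.lt
  by_cases hcq : c = q
  · rw [hcq, Function.update_self]
    refine ⟨by omega, h₂.mem.imp_right fun h => ⟨h.1, (hM _).2 ⟨by omega, h.2⟩⟩,
      fun x hxN hx hxq => ?_⟩
    obtain ⟨hxp, hx'⟩ := (hM x).1 hx
    refine h₂.le x hxN hx' ?_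
    by_contra hcon
    have := hq.le x hx' (by omega)
    omega
  · rw [Function.update_of_ne hcq]
    refine ⟨l₁, h₁.mem.imp_right fun h => ⟨h.1, (hM _).2 ⟨fun hpc => ?_, h.2⟩⟩,
      fun x hxN hx => h₁.le x hxN ((hM x).1 hx).2⟩
    have a₁ := hq.le c hMc' (by omega)
    rcases hq.mem with h' | h'
    · omega
    · have := h₁.le q (by omega) h' (by omega)
      omega

/-! ### The deletion of a point -/

namespace RealRAM

/-- Delete the point `I 12`. -/
def deleteProg : Prog :=
  .iload 30 0 12 ;; .rload 50 6 12 ;; .rload 51 7 12 ;;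
  .rload 52 11 30 ;; .rsub 52 52 51 ;; .rstore 11 30 52 ;;
  .rload 52 10 30 ;; .rsub 52 52 50 ;; .rstore 10 30 52 ;;
  .rsub 27 27 50 ;; .rsub 28 28 51 ;;
  .cond (.rlt 3 52) .skip
    (.iload 40 4 30 ;; .iload 41 5 30 ;; .istore 5 40 41 ;; .istore 4 41 40) ;;
  refreshProg

/-- Arithmetic is exact, so a column sum is zero precisely when its last point has left; only then
is the column unlinked. The sentinels 0 and `2 ^ h` need no special treatment, as `DS` makes no
claim about their links. -/
theorem run_deleteProg {s : State} {n h K : ℕ} {mv bv : ℕ → ℝ} {col : ℕ → ℕ} {A : Finset ℕ}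
    (hP : Pts n h K (s.rreg 5) mv bv col) (hA : A ⊆ range n) (hb : Base h s)
    (hD : DS (s.rreg 5) (s.rreg 10) (s.rreg 17) (s.rreg 18) h (colSum mv col A) (colSum bv col A) s)
    (ha : s.ireg 12 ∈ A) (hcol : s.iarr 0 (s.ireg 12) = col (s.ireg 12))
    (hmv : s.rarr 6 (s.ireg 12) = mv (s.ireg 12)) (hbv : s.rarr 7 (s.ireg 12) = bv (s.ireg 12)) :
    Run deleteProg s fun s' t =>
      DS (s.rreg 5) (s.rreg 10) (s.rreg 17) (s.rreg 18) h (colSum mv col (A.erase (s.ireg 12)))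
        (colSum bv col (A.erase (s.ireg 12))) s' ∧
      s'.rreg 27 = s.rreg 27 - mv (s.ireg 12) ∧ s'.rreg 28 = s.rreg 28 - bv (s.ireg 12) ∧
      t ≤ (K + 3) * (30 * (K + 3) + 40 * (h + 1) + 40) + 20 := by
  set a := s.ireg 12 with haI
  have han : a < n := mem_range.1 (hA ha)
  set M := colSum mv col A with hMdef
  set B := colSum bv col A with hBdef
  set M' := colSum mv col (A.erase a) with hMdef'
  set B' := colSum bv col (A.erase a) with hBdef'
  set p := col a with hp
  have hpN : p < 2 ^ h := hP.col_lt a han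
  have hC := hP.cols hA
  have hC' := hP.cols ((erase_subset a A).trans hA)
  have hMpos : 0 < M p := (colSum_pos_iff fun x hx => hP.m_pos x (mem_range.1 (hA hx))).2
    ⟨a, ha, rfl⟩
  have hM' : ∀ c, M' c = if c = p then M c - mv a else M c := fun c => colSum_erase ha c
  have hB' : ∀ c, B' c = if c = p then B c - bv a else B c := fun c => colSum_erase ha c
  have hMne : ∀ c, c ≠ p → M' c = M c := fun c hc => by rw [hM', if_neg hc]
  have hBne : ∀ c, c ≠ p → B' c = B c := fun c hc => by rw [hB', if_neg hc]
  have hMp : M' p = M p - mv a := by rw [hM', if_pos rfl]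
  have hBp : B' p = B p - bv a := by rw [hB', if_pos rfl]
  have hpp := hD.prev p hpN hMpos
  have hpn := hD.next p hpN hMpos
  have hpl := hpp.lt
  simp only [deleteProg, run_seq, run_iload, run_rload, run_rsub, run_rstore, run_cond, run_skip,
    run_istore, holds_rlt,
    State.setI_ireg, State.setI_rreg, State.setI_rarr, State.setI_iarr, State.setR_rreg,
    State.setR_ireg, State.setR_rarr, State.setR_iarr, State.setRArr_rreg, State.setRArr_ireg,
    State.setRArr_rarr, State.setRArr_iarr, State.setIArr_ireg, State.setIArr_iarr,
    State.setIArr_rreg, ← haI, hcol, hmv, hbv, hD.cellM p hpN, hD.cellB p hpN, hb.r3,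
    Nat.reduceEqDiff, reduceIte, ← hMp, ← hBp]
  have hcM : ∀ c < 2 ^ h, Function.update (s.rarr 10) p (M' p) c = M' c := fun c hc => by
    by_cases hcp : c = p
    · rw [hcp, Function.update_self]
    · rw [Function.update_of_ne hcp, hMne c hcp, hD.cellM c hc]
  have hcB : ∀ c < 2 ^ h, Function.update (s.rarr 11) p (B' p) c = B' c := fun c hc => by
    by_cases hcp : c = p
    · rw [hcp, Function.update_self]
    · rw [Function.update_of_ne hcp, hBne c hcp, hD.cellB c hc]
  have hiff : ∀ x, x ≠ p → (0 < M' x ↔ 0 < M x) := fun x hx => by rw [hMne x hx]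
  refine ⟨fun hpos => ?_, fun hpos => ?_⟩
  · have hiff' : ∀ x, 0 < M' x ↔ 0 < M x := fun x => by
      by_cases hx : x = p
      · rw [hx]; exact ⟨fun _ => hMpos, fun _ => hpos⟩
      · exact hiff x hx
    refine (run_refreshProg (h := h) (K := K) (M := M) (B := B) (M' := M') (B' := B') ?_ ?_
      (hb.of_eq ?_ ?_ ?_ ?_ ?_) ?_ ?_ ?_ ?_ ?_ ?_ ?_ ?_ ?_ ?_ ?_ ?_).imp ?_
    all_goals try simp only [State.setI_ireg, State.setI_rreg, State.setI_rarr, State.setI_iarr,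
      State.setR_rreg, State.setR_ireg, State.setR_rarr, State.setR_iarr, State.setRArr_rreg,
      State.setRArr_ireg, State.setRArr_rarr, State.setRArr_iarr, State.setIArr_ireg,
      State.setIArr_iarr, State.setIArr_rreg, Nat.reduceEqDiff, reduceIte]
    · exact hC
    · exact hC'
    · exact hpN
    · exact hMne
    · exact hBne
    · rw [hMp]; linarith [hP.m_pos a han]
    · rw [hBp]; linarith [hP.b_pos a han]
    · exact hcM
    · exact hcB
    · exact fun c hc hMc => (hD.prev c hc ((hiff' c).1 hMc)).congr hiff'
    · exact fun c hc hMc => (hD.next c hc ((hiff' c).1 hMc)).congr fun x _ => hiff' x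
    · exact hpn.congr fun x _ => hiff' x
    · exact hD.cons
    · exact hD.leaf
    · rintro s' t ⟨h₁, h₂⟩ F
      refine ⟨h₁, ?_, ?_, by omega⟩
      · rw [F.r 27 rfl]; simp
      · rw [F.r 28 rfl]; simp
  · have hzero : M' p = 0 := le_antisymm (not_lt.1 hpos) (hC'.M_nonneg p)
    have hiff' : ∀ x, 0 < M' x ↔ x ≠ p ∧ 0 < M x := fun x => by
      by_cases hx : x = p
      · rw [hx, hzero]; simp
      · rw [hiff x hx]; simp [hx]
    refine (run_refreshProg (h := h) (K := K) (M := M) (B := B) (M' := M') (B' := B') ?_ ?_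
      (hb.of_eq ?_ ?_ ?_ ?_ ?_) ?_ ?_ ?_ ?_ ?_ ?_ ?_ ?_ ?_ ?_ ?_ ?_).imp ?_
    all_goals try simp only [State.setI_ireg, State.setI_rreg, State.setI_rarr, State.setI_iarr,
      State.setR_rreg, State.setR_ireg, State.setR_rarr, State.setR_iarr, State.setRArr_rreg,
      State.setRArr_ireg, State.setRArr_rarr, State.setRArr_iarr, State.setIArr_ireg,
      State.setIArr_iarr, State.setIArr_rreg, State.setIArr_rarr, Nat.reduceEqDiff, reduceIte]
    · exact hC
    · exact hC'
    · exact hpN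
    · exact hMne
    · exact hBne
    · rw [hMp]; linarith [hP.m_pos a han]
    · rw [hBp]; linarith [hP.b_pos a han]
    · exact hcM
    · exact hcB
    · exact fun c hc hMc => IsPrev.unlink hpN hMpos hiff' hD.prev hpn hc hMc
    · exact fun c hc hMc => IsNext.unlink hpN hMpos hiff' hD.next hpp hc hMc
    · rw [Function.update_of_ne (by omega)]
      exact hpn.congr fun x hx => hiff x (by omega)
    · exact hD.cons
    · exact hD.leaf
    · rintro s' t ⟨h₁, h₂⟩ F
      refine ⟨h₁, ?_, ?_, by omega⟩
      · rw [F.r 27 rfl]; simp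
      · rw [F.r 28 rfl]; simp

end RealRAM

/-! ### Building the data structure -/

theorem colSum_insert {f : ℕ → ℝ} {col : ℕ → ℕ} {A : Finset ℕ} {a : ℕ} (ha : a ∉ A) (c : ℕ) :
    colSum f col (insert a A) c = if c = col a then colSum f col A c + f a else colSum f col A c := by
  rw [colSum, colSum, filter_insert]
  split_ifs with h₁ h₂ h₂
  · rw [sum_insert fun h => ha (mem_filter.1 h).1, add_comm]
  · exact absurd h₁.symm h₂
  · exact absurd h₂.symm h₁
  · rfl

/-- The points with an index in `[lo, hi)` and a time stamp of at least `τ`. -/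
noncomputable def alive (ts : ℕ → ℝ) (τ : ℝ) (lo hi : ℕ) : Finset ℕ := {a ∈ Ico lo hi | τ ≤ ts a}

theorem alive_succ {ts : ℕ → ℝ} {τ : ℝ} {lo hi : ℕ} (h : lo ≤ hi) :
    alive ts τ lo (hi + 1) = if τ ≤ ts hi then insert hi (alive ts τ lo hi) else alive ts τ lo hi := by
  rw [alive, ← Order.succ_eq_add_one, ← insert_Ico_right_eq_Ico_succ h, filter_insert]
  rfl

theorem notMem_alive {ts : ℕ → ℝ} {τ : ℝ} {lo hi : ℕ} : hi ∉ alive ts τ lo hi := by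
  simp [alive]

namespace RealRAM

/-- Clear the columns. -/
def clearProg : Prog :=
  .iconst 30 0 ;; .loop (.ilt 30 3) (.rstore 10 30 3 ;; .rstore 11 30 3 ;; .iadd 30 30 2)

theorem run_clearProg {s : State} {h : ℕ} (hb : Base h s) :
    Run clearProg s fun s' t => (∀ c < 2 ^ h, s'.rarr 10 c = 0) ∧ (∀ c < 2 ^ h, s'.rarr 11 c = 0) ∧
      t ≤ 10 * 2 ^ h + 10 := by
  simp only [clearProg, run_seq, run_iconst]
  refine run_loop (2 ^ h) (fun j s' => s'.ireg 30 = j ∧ (∀ c < j, s'.rarr 10 c = 0) ∧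
    ∀ c < j, s'.rarr 11 c = 0) (fun _ => 3) ?_ ?_ ?_
  · simp
  · rintro j s' ⟨h30, hM, hB⟩ F hlt
    have hb' : Base h s' := (hb.of_eq (by simp) (by simp) (by simp) (by simp) (by simp)).frame F
      rfl rfl rfl rfl rfl
    simp only [holds_ilt, h30, hb'.i3] at hlt
    refine ⟨hlt, ?_⟩
    simp only [run_seq, run_rstore, run_iadd, State.setI_ireg, State.setI_rarr,
      State.setRArr_rreg, State.setRArr_ireg, State.setRArr_rarr, Nat.reduceEqDiff, reduceIte, h30,
      hb'.i2, hb'.r3]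
    refine ⟨⟨trivial, fun c hc => ?_, fun c hc => ?_⟩, by norm_num⟩
    · by_cases hcj : c = j
      · rw [hcj, Function.update_self]
      · rw [Function.update_of_ne hcj, hM c (by omega)]
    · by_cases hcj : c = j
      · rw [hcj, Function.update_self]
      · rw [Function.update_of_ne hcj, hB c (by omega)]
  · rintro j s' t hj ⟨h30, hM, hB⟩ F hlt ht
    have hb' : Base h s' := (hb.of_eq (by simp) (by simp) (by simp) (by simp) (by simp)).frame F
      rfl rfl rfl rfl rfl
    simp only [holds_ilt, h30, hb'.i3, not_lt] at hlt
    simp only [sum_const, card_range, smul_eq_mul] at ht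
    exact ⟨fun c hc => hM c (by omega), fun c hc => hB c (by omega), by omega⟩

/-- Add point `I 31` to its column and to the total weights if its time stamp is at least `R 12`. -/
def addPoint : Prog :=
  .rload 31 8 31 ;; .cond (.rle 12 31) (.iload 32 0 31 ;; .rload 32 6 31 ;; .rload 33 7 31 ;;
    .rload 34 10 32 ;; .radd 34 34 32 ;; .rstore 10 32 34 ;;
    .rload 34 11 32 ;; .radd 34 34 33 ;; .rstore 11 32 34 ;;
    .radd 27 27 32 ;; .radd 28 28 33) .skip

/-- Compute the column sums of the points with index in `[I 11, I 13)` and a time stamp of at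
least `R 12`. -/
def colSumProg : Prog :=
  clearProg ;; .rconst 27 0 ;; .rconst 28 0 ;; .iadd 31 11 1 ;;
  .loop (.ilt 31 13) (addPoint ;; .iadd 31 31 2)

/-- The sorted input arrays. -/
structure Arrays (n : ℕ) (mv bv ts : ℕ → ℝ) (col : ℕ → ℕ) (s : State) : Prop where
  col : ∀ a < n, s.iarr 0 a = col a
  m : ∀ a < n, s.rarr 6 a = mv a
  b : ∀ a < n, s.rarr 7 a = bv a
  t : ∀ a < n, s.rarr 8 a = ts a

theorem Arrays.of_eq {n : ℕ} {mv bv ts : ℕ → ℝ} {col : ℕ → ℕ} {s s' : State}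
    (h : Arrays n mv bv ts col s) (e0 : s'.iarr 0 = s.iarr 0) (e6 : s'.rarr 6 = s.rarr 6)
    (e7 : s'.rarr 7 = s.rarr 7) (e8 : s'.rarr 8 = s.rarr 8) : Arrays n mv bv ts col s' :=
  ⟨e0 ▸ h.col, e6 ▸ h.m, e7 ▸ h.b, e8 ▸ h.t⟩

/-- The columns hold the column sums of the points of `A`. -/
structure Cells (h : ℕ) (mv bv : ℕ → ℝ) (col : ℕ → ℕ) (A : Finset ℕ) (s : State) : Prop where
  M : ∀ c < 2 ^ h, s.rarr 10 c = colSum mv col A c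
  B : ∀ c < 2 ^ h, s.rarr 11 c = colSum bv col A c
  m : s.rreg 27 = ∑ a ∈ A, mv a
  b : s.rreg 28 = ∑ a ∈ A, bv a

theorem run_addPoint {s : State} {n h K : ℕ} {thr : ℝ} {mv bv ts : ℕ → ℝ} {col : ℕ → ℕ} {lo : ℕ}
    (hP : Pts n h K thr mv bv col) (hArr : Arrays n mv bv ts col s)
    (hlo : lo ≤ s.ireg 31) (hn : s.ireg 31 < n)
    (hc : Cells h mv bv col (alive ts (s.rreg 12) lo (s.ireg 31)) s) :
    Run addPoint s fun s' t => Cells h mv bv col (alive ts (s.rreg 12) lo (s.ireg 31 + 1)) s' ∧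
      t ≤ 13 := by
  set a := s.ireg 31 with ha
  simp only [addPoint, run_seq, run_iload, run_rload, run_radd, run_rstore, run_cond, run_skip,
    holds_rle,
    State.setI_ireg, State.setI_rreg, State.setI_rarr, State.setI_iarr, State.setR_rreg,
    State.setR_ireg, State.setR_rarr, State.setR_iarr, State.setRArr_rreg, State.setRArr_ireg,
    State.setRArr_rarr, State.setRArr_iarr, ← ha, hArr.col a hn, hArr.m a hn, hArr.b a hn,
    hArr.t a hn, Nat.reduceEqDiff, reduceIte, hc.M _ (hP.col_lt a hn), hc.B _ (hP.col_lt a hn)]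
  refine ⟨fun hτ => ⟨?_, by norm_num⟩, fun hτ => ⟨?_, by norm_num⟩⟩
  · rw [alive_succ hlo, if_pos hτ]
    constructor
    · intro c hcN
      simp only [State.setR_rarr, State.setRArr_rarr, Nat.reduceEqDiff, reduceIte]
      rw [colSum_insert notMem_alive]
      split_ifs with hcc
      · rw [hcc, Function.update_self]
      · rw [Function.update_of_ne hcc]; exact hc.M c hcN
    · intro c hcN
      simp only [State.setR_rarr, State.setRArr_rarr, Nat.reduceEqDiff, reduceIte]
      rw [colSum_insert notMem_alive]
      split_ifs with hcc
      · rw [hcc, Function.update_self]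
      · rw [Function.update_of_ne hcc]; exact hc.B c hcN
    · simp [sum_insert notMem_alive, hc.m, add_comm]
    · simp [sum_insert notMem_alive, hc.b, add_comm]
  · rw [alive_succ hlo, if_neg hτ]
    exact ⟨hc.M, hc.B, hc.m, hc.b⟩

theorem run_colSumProg {s : State} {n h K : ℕ} {thr : ℝ} {mv bv ts : ℕ → ℝ} {col : ℕ → ℕ}
    (hP : Pts n h K thr mv bv col) (hArr : Arrays n mv bv ts col s) (hb : Base h s)
    (hn : s.ireg 13 ≤ n) :
    Run colSumProg s fun s' t =>
      Cells h mv bv col (alive ts (s.rreg 12) (s.ireg 11) (s.ireg 13)) s' ∧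
      t ≤ 10 * 2 ^ h + 20 * n + 20 := by
  simp only [colSumProg, run_seq]
  refine (run_clearProg hb).imp ?_
  rintro s₁ t₁ ⟨hM, hB, ht₁⟩ F₁
  have hb₁ := hb.frame F₁ rfl rfl rfl rfl rfl
  simp only [run_rconst, run_iadd, Rat.cast_zero]
  -- The range of indices may be empty or reversed. Then the loop is never entered, which is the
  -- second alternative.
  refine run_loop n (fun j s' => s'.ireg 31 = s.ireg 11 + j ∧
    (s.ireg 11 + j ≤ s.ireg 13 ∨ s.ireg 13 ≤ s.ireg 11 ∧ j = 0) ∧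
    Cells h mv bv col (alive ts (s.rreg 12) (s.ireg 11) (s.ireg 11 + j)) s') (fun _ => 15) ?_ ?_ ?_
  · refine ⟨?_, by omega, ?_⟩
    · simp [F₁.i 11 rfl, hb₁.i1]
    · constructor <;> simp [alive, colSum] <;> assumption
  · rintro j s' ⟨h31, hle, hc⟩ F hlt
    have e13 : s'.ireg 13 = s.ireg 13 := by rw [F.i 13 rfl]; simpa using F₁.i 13 rfl
    have e12 : s'.rreg 12 = s.rreg 12 := by rw [F.r 12 rfl]; simpa using F₁.r 12 rfl
    have e2 : s'.ireg 2 = 1 := by rw [F.i 2 rfl]; simpa using hb₁.i2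
    simp only [holds_ilt, h31, e13] at hlt
    refine ⟨by omega, ?_⟩
    simp only [run_seq]
    refine (run_addPoint (n := n) (h := h) (mv := mv) (bv := bv) (ts := ts) (col := col)
      (lo := s.ireg 11) hP (hArr.of_eq ?_ ?_ ?_ ?_) ?_ ?_ ?_).imp ?_
    · rw [F.ia 0 rfl]; simpa using F₁.ia 0 rfl
    · rw [F.ra 6 rfl]; simpa using F₁.ra 6 rfl
    · rw [F.ra 7 rfl]; simpa using F₁.ra 7 rfl
    · rw [F.ra 8 rfl]; simpa using F₁.ra 8 rfl
    · rw [h31]; omega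
    · rw [h31]; omega
    · rwa [h31, e12]
    · rintro s'' t ⟨hc', ht⟩ F'
      simp only [run_iadd, State.setI_ireg, reduceIte]
      have g31 : s''.ireg 31 = s.ireg 11 + j := by rw [F'.i 31 rfl, h31]
      have g2 : s''.ireg 2 = 1 := by rw [F'.i 2 rfl, e2]
      rw [h31, e12] at hc'
      refine ⟨⟨by omega, by omega, ?_⟩, by omega⟩
      exact ⟨hc'.M, hc'.B, hc'.m, hc'.b⟩
  · rintro j s' t hj ⟨h31, hle, hc⟩ F hlt ht
    have e13 : s'.ireg 13 = s.ireg 13 := by rw [F.i 13 rfl]; simpa using F₁.i 13 rfl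
    simp only [holds_ilt, h31, e13, not_lt] at hlt
    simp only [sum_const, card_range, smul_eq_mul] at ht
    have hal : alive ts (s.rreg 12) (s.ireg 11) (s.ireg 11 + j) =
        alive ts (s.rreg 12) (s.ireg 11) (s.ireg 13) := by
      rcases hle with hle | ⟨hle, rfl⟩
      · rw [show s.ireg 11 + j = s.ireg 13 by omega]
      · simp [alive, Ico_eq_empty_of_le hle]
    exact ⟨hal ▸ hc, by omega⟩

/-- Link the nonempty columns. -/
def linkProg : Prog :=
  .iconst 31 0 ;; .iconst 30 0 ;;
  .loop (.ilt 30 3) (.rload 31 10 30 ;;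
    .cond (.rlt 3 31) (.istore 4 30 31 ;; .istore 5 31 30 ;; .iadd 31 30 1) .skip ;;
    .iadd 30 30 2) ;;
  .istore 5 31 3

/-- `I 31` is the last nonempty column met so far, or 0. Its successor is not known yet, so the
invariant exempts it; the final store supplies the sentinel `2 ^ h`. -/
theorem run_linkProg {s : State} {h K : ℕ} {thr : ℝ} {M B : ℕ → ℝ} (hC : Cols (2 ^ h) K thr M B)
    (hb : Base h s) (hM : ∀ c < 2 ^ h, s.rarr 10 c = M c) :
    Run linkProg s fun s' t => (∀ c < 2 ^ h, 0 < M c → IsPrev M c (s'.iarr 4 c)) ∧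
      (∀ c < 2 ^ h, 0 < M c → IsNext (2 ^ h) M c (s'.iarr 5 c)) ∧ t ≤ 10 * 2 ^ h + 10 := by
  simp only [linkProg, run_seq, run_iconst]
  refine run_loop (2 ^ h) (fun j s' => s'.ireg 30 = j ∧
    (s'.ireg 31 < j ∨ s'.ireg 31 = 0 ∧ j = 0) ∧ (s'.ireg 31 = 0 ∨ 0 < M (s'.ireg 31)) ∧
    (∀ x < j, 0 < M x → x ≤ s'.ireg 31) ∧
    (∀ c < j, 0 < M c → IsPrev M c (s'.iarr 4 c)) ∧
    ∀ c < j, 0 < M c → c ≠ s'.ireg 31 → IsNext (2 ^ h) M c (s'.iarr 5 c)) (fun _ => 7) ?_ ?_ ?_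
  · simp
  · rintro j s' ⟨h30, hl, hact, hle, hp, hn⟩ F hlt
    have hb' : Base h s' := (hb.of_eq (by simp) (by simp) (by simp) (by simp) (by simp)).frame F
      rfl rfl rfl rfl rfl
    have e10 : s'.rarr 10 = s.rarr 10 := by rw [F.ra 10 rfl]; simp
    simp only [holds_ilt, h30, hb'.i3] at hlt
    refine ⟨hlt, ?_⟩
    simp only [run_seq, run_rload, run_istore, run_cond, run_skip, run_iadd, holds_rlt,
      State.setI_ireg, State.setI_rreg, State.setI_iarr, State.setR_ireg, State.setR_rreg,
      State.setR_iarr, State.setIArr_ireg, State.setIArr_iarr, Nat.reduceEqDiff, reduceIte,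
      h30, hb'.i2, hb'.i1, hb'.r3, e10, hM j hlt]
    set l := s'.ireg 31 with hldef
    refine ⟨fun hpos => ⟨⟨trivial, by omega, .inr hpos, fun x hx _ => by omega, fun c hc hMc => ?_,
      fun c hc hMc hcj => ?_⟩, by norm_num⟩,
      fun hpos => ⟨⟨trivial, by omega, hact, fun x hx hMx => ?_, fun c hc hMc => ?_,
      fun c hc hMc hcl => ?_⟩, by norm_num⟩⟩
    · by_cases hcj : c = j
      · rw [hcj, Function.update_self]
        rw [hcj] at hMc
        have hj0 : j ≠ 0 := fun h0 => by rw [h0, hC.M_zero] at hMc; exact lt_irrefl _ hMc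
        exact ⟨by omega, hact, fun x hx hxj => hle x hxj hx⟩
      · rw [Function.update_of_ne hcj]
        exact hp c (by omega) hMc
    · by_cases hcl : c = l
      · rw [hcl, Function.update_self]
        refine ⟨by omega, .inr ⟨hlt, hpos⟩, fun x hxN hx hlx => ?_⟩
        by_contra hcon
        have := hle x (by omega) hx
        omega
      · rw [Function.update_of_ne hcl]
        exact hn c (by omega) hMc hcl
    · by_cases hxj : x = j
      · rw [hxj] at hMx; exact absurd hMx hpos
      · exact hle x (by omega) hMx
    · by_cases hcj : c = j
      · rw [hcj] at hMc; exact absurd hMc hpos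
      · exact hp c (by omega) hMc
    · by_cases hcj : c = j
      · rw [hcj] at hMc; exact absurd hMc hpos
      · exact hn c (by omega) hMc hcl
  · rintro j s' t hj ⟨h30, hl, hact, hle, hp, hn⟩ F hlt ht
    have hb' : Base h s' := (hb.of_eq (by simp) (by simp) (by simp) (by simp) (by simp)).frame F
      rfl rfl rfl rfl rfl
    simp only [holds_ilt, h30, hb'.i3, not_lt] at hlt
    obtain rfl : j = 2 ^ h := by omega
    simp only [sum_const, card_range, smul_eq_mul] at ht
    simp only [run_istore, State.setIArr_iarr, Nat.reduceEqDiff, reduceIte, hb'.i3]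
    have hpos : 0 < 2 ^ h := by positivity
    refine ⟨hp, fun c hc hMc => ?_, by omega⟩
    by_cases hcl : c = s'.ireg 31
    · rw [hcl, Function.update_self]
      refine ⟨by omega, .inl rfl, fun x hxN hx hlx => ?_⟩
      have := hle x hxN hx
      omega
    · rw [Function.update_of_ne hcl]
      exact hn c hc hMc hcl

/-- Compute all leaves. -/
def leavesProg : Prog := .iconst 30 0 ;; .loop (.ilt 30 3) (setLeaf ;; .iadd 30 30 2)

/-- The tree is consistent throughout, at first with outdated leaves, and each `setLeaf` corrects
one of them. The total O(n log n) is affordable because it is paid once per bottom point, for each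
tangent and starting time. -/
theorem run_leavesProg {s : State} {h K : ℕ} {M B : ℕ → ℝ} (hC : Cols (2 ^ h) K (s.rreg 5) M B)
    (hb : Base h s) (hM : ∀ c < 2 ^ h, s.rarr 10 c = M c) (hB : ∀ c < 2 ^ h, s.rarr 11 c = B c)
    (hprev : ∀ c < 2 ^ h, 0 < M c → IsPrev M c (s.iarr 4 c))
    (hnext : ∀ c < 2 ^ h, 0 < M c → IsNext (2 ^ h) M c (s.iarr 5 c))
    (hcons : ∀ v, 1 ≤ v → v < 2 ^ h → Cons s.tree v) :
    Run leavesProg s fun s' t => DS (s.rreg 5) (s.rreg 10) (s.rreg 17) (s.rreg 18) h M B s' ∧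
      t ≤ 2 ^ h * (30 * (K + 3) + 40 * (h + 1) + 30) + 10 := by
  simp only [leavesProg, run_seq, run_iconst]
  refine run_loop (2 ^ h) (fun j s' => s'.ireg 30 = j ∧
    (∀ v, 1 ≤ v → v < 2 ^ h → Cons s'.tree v) ∧
    ∀ c < j, LeafOK (s.rreg 5) (s.rreg 10) (s.rreg 17) (s.rreg 18) M B (2 ^ h) s' c)
    (fun _ => 30 * (K + 3) + 40 * (h + 1) + 21) ?_ ?_ ?_
  · exact ⟨by simp, hcons, by simp⟩
  · rintro j s' ⟨h30, hc, hl⟩ F hlt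
    have hb' : Base h s' := (hb.of_eq (by simp) (by simp) (by simp) (by simp) (by simp)).frame F
      rfl rfl rfl rfl rfl
    have e5 : s'.rreg 5 = s.rreg 5 := by rw [F.r 5 rfl]; simp
    have e10 : s'.rreg 10 = s.rreg 10 := by rw [F.r 10 rfl]; simp
    have e17 : s'.rreg 17 = s.rreg 17 := by rw [F.r 17 rfl]; simp
    have e18 : s'.rreg 18 = s.rreg 18 := by rw [F.r 18 rfl]; simp
    have a10 : s'.rarr 10 = s.rarr 10 := by rw [F.ra 10 rfl]; simp
    have a11 : s'.rarr 11 = s.rarr 11 := by rw [F.ra 11 rfl]; simp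
    have a4 : s'.iarr 4 = s.iarr 4 := by rw [F.ia 4 rfl]; simp
    simp only [holds_ilt, h30, hb'.i3] at hlt
    refine ⟨hlt, ?_⟩
    simp only [run_seq]
    refine (run_setLeaf (h := h) (K := K) (M := M) (B := B) (by rwa [e5]) hb' (by rwa [a10])
      (by rwa [a11]) (by rwa [h30]) (fun c hcc => ?_) hc).imp ?_
    · rw [a4]; exact hprev c (by omega)
    · rintro s'' t ⟨hc', hl', hr, ht⟩ F'
      rw [h30, e5, e10, e17, e18] at hl'
      rw [h30] at hr
      simp only [run_iadd, State.setI_ireg, reduceIte]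
      have g30 : s''.ireg 30 = j := by rw [F'.i 30 rfl, h30]
      have g2 : s''.ireg 2 = 1 := by rw [F'.i 2 rfl, hb'.i2]
      refine ⟨⟨by omega, hc', fun c hcj => ?_⟩, by omega⟩
      by_cases hcc : c = j
      · exact hcc ▸ hl'
      · obtain ⟨e, he, hS⟩ := hl c (by omega)
        exact ⟨e, (hr _ (by omega) (by omega)).trans he, hS⟩
  · rintro j s' t hj ⟨h30, hc, hl⟩ F hlt ht
    have hb' : Base h s' := (hb.of_eq (by simp) (by simp) (by simp) (by simp) (by simp)).frame F
      rfl rfl rfl rfl rfl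
    have a10 : s'.rarr 10 = s.rarr 10 := by rw [F.ra 10 rfl]; simp
    have a11 : s'.rarr 11 = s.rarr 11 := by rw [F.ra 11 rfl]; simp
    have a4 : s'.iarr 4 = s.iarr 4 := by rw [F.ia 4 rfl]; simp
    have a5 : s'.iarr 5 = s.iarr 5 := by rw [F.ia 5 rfl]; simp
    simp only [holds_ilt, h30, hb'.i3, not_lt] at hlt
    simp only [sum_const, card_range, smul_eq_mul] at ht
    refine ⟨⟨by rwa [a10], by rwa [a11], by rwa [a4], by rwa [a5], hc, fun c hcN => hl c (by omega)⟩,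
      ?_⟩
    have : 2 ^ h * (30 * (K + 3) + 40 * (h + 1) + 21 + 1) ≤
        2 ^ h * (30 * (K + 3) + 40 * (h + 1) + 30) := Nat.mul_le_mul_left _ (by omega)
    omega

/-- Build the data structure for the points with index in `[I 11, I 13)` and a time stamp of at
least `R 12`. -/
def buildProg : Prog := colSumProg ;; linkProg ;; leavesProg

theorem run_buildProg {s : State} {n h K : ℕ} {mv bv ts : ℕ → ℝ} {col : ℕ → ℕ}
    (hP : Pts n h K (s.rreg 5) mv bv col) (hArr : Arrays n mv bv ts col s) (hb : Base h s)
    (hn : s.ireg 13 ≤ n) (hcons : ∀ v, 1 ≤ v → v < 2 ^ h → Cons s.tree v) :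
    Run buildProg s fun s' t =>
      Cells h mv bv col (alive ts (s.rreg 12) (s.ireg 11) (s.ireg 13)) s' ∧
      DS (s.rreg 5) (s.rreg 10) (s.rreg 17) (s.rreg 18) h
        (colSum mv col (alive ts (s.rreg 12) (s.ireg 11) (s.ireg 13)))
        (colSum bv col (alive ts (s.rreg 12) (s.ireg 11) (s.ireg 13))) s' ∧
      t ≤ 2 ^ h * (30 * (K + 3) + 40 * (h + 1) + 50) + 20 * n + 40 := by
  have hA : alive ts (s.rreg 12) (s.ireg 11) (s.ireg 13) ⊆ range n := fun a ha => by
    have := mem_Ico.1 (mem_filter.1 ha).1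
    exact mem_range.2 (by omega)
  simp only [buildProg, run_seq]
  refine (run_colSumProg hP hArr hb hn).imp ?_
  rintro s₁ t₁ ⟨hc, ht₁⟩ F₁
  have hb₁ := hb.frame F₁ rfl rfl rfl rfl rfl
  have hC := hP.cols hA
  refine (run_linkProg hC hb₁ hc.M).imp ?_
  rintro s₂ t₂ ⟨hp, hnx, ht₂⟩ F₂
  have hb₂ := hb₁.frame F₂ rfl rfl rfl rfl rfl
  have e : ∀ x, colSumProg.wr x = false → linkProg.wr x = false → s₂.rreg x = s.rreg x :=
    fun x h₁ h₂ => (F₂.r x h₂).trans (F₁.r x h₁)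
  have eT : s₂.tree = s.tree := by
    funext u
    simp only [State.tree, F₂.ra 12 rfl, F₂.ra 13 rfl, F₂.ra 14 rfl, F₂.ra 15 rfl, F₁.ra 12 rfl,
      F₁.ra 13 rfl, F₁.ra 14 rfl, F₁.ra 15 rfl]
  have hleaves := run_leavesProg (s := s₂) (h := h) (K := K) (by rw [e 5 rfl rfl]; exact hC) hb₂
    (by rw [F₂.ra 10 rfl]; exact hc.M) (by rw [F₂.ra 11 rfl]; exact hc.B) hp hnx (by rwa [eT])
  rw [e 5 rfl rfl, e 10 rfl rfl, e 17 rfl rfl, e 18 rfl rfl] at hleaves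
  refine hleaves.imp ?_
  rintro s₃ t₃ ⟨hD, ht₃⟩ F₃
  refine ⟨⟨hD.cellM, hD.cellB, ?_, ?_⟩, hD, ?_⟩
  · rw [F₃.r 27 rfl, F₂.r 27 rfl, hc.m]
  · rw [F₃.r 28 rfl, F₂.r 28 rfl, hc.b]
  · have : 2 ^ h * (30 * (K + 3) + 40 * (h + 1) + 50) =
        2 ^ h * (30 * (K + 3) + 40 * (h + 1) + 30) + 20 * 2 ^ h := by ring
    omega

end RealRAM

/-! ### Exhaustive search over the intervals of columns -/

/-- The weights `m` and `b` of a region are in `[thr, 1 - thr]`. -/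
structure Supp (thr m b : ℝ) : Prop where
  m_ge : thr ≤ m
  b_ge : thr ≤ b
  m_le : m ≤ 1 - thr
  b_le : b ≤ 1 - thr

namespace RealRAM

/-- Real register 21 holds the maximal discrepancy of an interval of columns that satisfies `P`
if this exceeds its value in `s₀`; then the registers 22 to 26 describe this interval. -/
structure BruteOK (c thr : ℝ) (N : ℕ) (M B : ℕ → ℝ) (P : ℕ → ℕ → Prop) (s₀ s : State) : Prop where
  sound : (∀ x, 21 ≤ x → x ≤ 26 → s.rreg x = s₀.rreg x) ∨ ∃ l r, l ≤ r ∧ r < N ∧ 0 < M l ∧ 0 < M r ∧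
    Supp thr (seg M l (r + 1)) (seg B l (r + 1)) ∧
    s.rreg 21 = gammaDisc c (seg B l (r + 1)) (seg M l (r + 1)) ∧
    s.rreg 22 = s₀.rarr 9 l ∧ s.rreg 23 = s₀.rarr 5 (s₀.ireg 11) ∧ s.rreg 24 = s₀.rarr 9 r ∧
    s.rreg 25 = s₀.rarr 5 (s₀.ireg 12) ∧ s.rreg 26 = s₀.rreg 12
  mono : s₀.rreg 21 ≤ s.rreg 21
  complete : ∀ l r, P l r → l ≤ r → r < N → 0 < M l → 0 < M r →
    Supp thr (seg M l (r + 1)) (seg B l (r + 1)) →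
    gammaDisc c (seg B l (r + 1)) (seg M l (r + 1)) ≤ s.rreg 21

theorem BruteOK.weaken {c thr : ℝ} {N : ℕ} {M B : ℕ → ℝ} {P P' : ℕ → ℕ → Prop} {s₀ s s' : State}
    (h : BruteOK c thr N M B P s₀ s) (hs : ∀ x, 21 ≤ x → x ≤ 26 → s'.rreg x = s.rreg x)
    (hP : ∀ l r, P' l r → l ≤ r → r < N → 0 < M l → 0 < M r →
      Supp thr (seg M l (r + 1)) (seg B l (r + 1)) → P l r) :
    BruteOK c thr N M B P' s₀ s' where
  sound := by
    rw [hs 21 (by norm_num) (by norm_num), hs 22 (by norm_num) (by norm_num),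
      hs 23 (by norm_num) (by norm_num), hs 24 (by norm_num) (by norm_num),
      hs 25 (by norm_num) (by norm_num), hs 26 (by norm_num) (by norm_num)]
    exact h.sound.imp_left fun h x hx hx' => (hs x hx hx').trans (h x hx hx')
  mono := by rw [hs 21 (by norm_num) (by norm_num)]; exact h.mono
  complete l r hp h₁ h₂ h₃ h₄ h₅ := by
    rw [hs 21 (by norm_num) (by norm_num)]
    exact h.complete l r (hP l r hp h₁ h₂ h₃ h₄ h₅) h₁ h₂ h₃ h₄ h₅

/-- Compare the discrepancy for the weights `R 31` and `R 32` with the best known one. -/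
def bruteVal : Prog :=
  .rdiv 35 32 31 ;; .rlog 35 35 ;; .rmul 35 32 35 ;; .rsub 36 4 32 ;; .rsub 37 4 31 ;;
  .rdiv 37 36 37 ;; .rlog 37 37 ;; .rmul 37 36 37 ;; .radd 35 35 37 ;; .rmul 35 1 35 ;;
  .cond (.rlt 21 35)
    (.radd 21 35 3 ;; .rload 22 9 30 ;; .rload 23 5 11 ;; .rload 24 9 31 ;; .rload 25 5 12 ;;
      .radd 26 12 3) .skip

/-- As `thr` is positive, support keeps both weights strictly between 0 and 1, so no division or
logarithm gets stuck. -/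
theorem run_bruteVal {s : State} {m b thr : ℝ} (h31 : s.rreg 31 = m) (h32 : s.rreg 32 = b)
    (h4 : s.rreg 4 = 1) (h3 : s.rreg 3 = 0) (hthr : 0 < thr) (hS : Supp thr m b) :
    Run bruteVal s fun s' t => t ≤ 18 ∧
      (s.rreg 21 < gammaDisc (s.rreg 1) b m → s'.rreg 21 = gammaDisc (s.rreg 1) b m ∧
        s'.rreg 22 = s.rarr 9 (s.ireg 30) ∧ s'.rreg 23 = s.rarr 5 (s.ireg 11) ∧
        s'.rreg 24 = s.rarr 9 (s.ireg 31) ∧ s'.rreg 25 = s.rarr 5 (s.ireg 12) ∧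
        s'.rreg 26 = s.rreg 12) ∧
      (¬ s.rreg 21 < gammaDisc (s.rreg 1) b m →
        ∀ x, 21 ≤ x → x ≤ 26 → s'.rreg x = s.rreg x) := by
  have hm : 0 < m := hthr.trans_le hS.m_ge
  have hb : 0 < b := hthr.trans_le hS.b_ge
  have hm' : 0 < 1 - m := by linarith [hS.m_le]
  have hb' : 0 < 1 - b := by linarith [hS.b_le]
  simp only [bruteVal, run_seq, run_rdiv, run_rlog, run_rmul, run_rsub, run_radd, run_rload,
    run_cond, run_skip, holds_rlt, State.setR_rreg, State.setR_ireg, State.setR_rarr,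
    Nat.reduceEqDiff, reduceIte, h31, h32, h4, h3, add_zero]
  refine ⟨hm.ne', by positivity, hm'.ne', by positivity, ?_⟩
  rw [← gammaDisc]
  refine ⟨fun h => ⟨by norm_num, fun _ => by simp, fun h' => absurd h h'⟩,
    fun h => ⟨by norm_num, fun h' => absurd h' h, fun _ x hx hx' => ?_⟩⟩
  rw [if_neg (by omega), if_neg (by omega), if_neg (by omega), if_neg (by omega),
    if_neg (by omega), if_neg (by omega), if_neg (by omega), if_neg (by omega),
    if_neg (by omega), if_neg (by omega)]

/-- Treat the interval `[I 30, I 31]` of columns with weights `R 31` and `R 32`. -/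
def bruteCell : Prog :=
  feasProg 31 32 32 ;; .cond (.ieq 32 2) (.cond (.rle 31 6) (.cond (.rle 32 6) bruteVal .skip) .skip)
    .skip

theorem run_bruteCell {s₀ s : State} {N l r : ℕ} {c thr : ℝ} {M B : ℕ → ℝ} {P : ℕ → ℕ → Prop}
    (hl : s.ireg 30 = l) (hr : s.ireg 31 = r) (hlr : l ≤ r) (hrN : r < N) (hMl : 0 < M l)
    (hMr : 0 < M r) (hm : s.rreg 31 = seg M l (r + 1)) (hb : s.rreg 32 = seg B l (r + 1))
    (h4 : s.rreg 4 = 1) (h3 : s.rreg 3 = 0) (h2 : s.ireg 2 = 1) (h1 : s.rreg 1 = c)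
    (h5 : s.rreg 5 = thr) (h6 : s.rreg 6 = 1 - thr) (hthr : 0 < thr)
    (h9 : s.rarr 9 = s₀.rarr 9) (ha5 : s.rarr 5 = s₀.rarr 5) (h11 : s.ireg 11 = s₀.ireg 11)
    (h12 : s.ireg 12 = s₀.ireg 12) (hr12 : s.rreg 12 = s₀.rreg 12)
    (hB : BruteOK c thr N M B P s₀ s) :
    Run bruteCell s fun s' t =>
      BruteOK c thr N M B (fun l' r' => P l' r' ∨ l' = l ∧ r' = r) s₀ s' ∧ t ≤ 25 := by
  simp only [bruteCell, run_seq, run_feasProg, run_cond, run_skip, holds_ieq, holds_rle,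
    State.setI_ireg, State.setI_rreg, Nat.reduceEqDiff, reduceIte, h2, h5, h6, hm, hb]
  have hone : ∀ p : Prop, ∀ _ : Decidable p, ((if p then 1 else 0) = 1) ↔ p := fun p _ => by simp
  simp only [hone]
  have hno : ∀ v, ¬ Supp thr (seg M l (r + 1)) (seg B l (r + 1)) →
      BruteOK c thr N M B (fun l' r' => P l' r' ∨ l' = l ∧ r' = r) s₀ (s.setI 32 v) :=
    fun v hS => hB.weaken (fun _ _ _ => rfl) fun l' r' hP _ _ _ _ hS' =>
      hP.resolve_right fun h => hS (by rwa [h.1, h.2] at hS')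
  refine ⟨fun hge => ⟨fun hm' => ⟨fun hb' => ?_, fun hb' => ⟨hno _ fun hS => hb' hS.b_le, by
    norm_num⟩⟩, fun hm' => ⟨hno _ fun hS => hm' hS.m_le, by norm_num⟩⟩,
    fun hge => ⟨hno _ fun hS => hge ⟨hS.m_ge, hS.b_ge⟩, by norm_num⟩⟩
  have hS : Supp thr (seg M l (r + 1)) (seg B l (r + 1)) := ⟨hge.1, hge.2, hm', hb'⟩
  refine (run_bruteVal (m := seg M l (r + 1)) (b := seg B l (r + 1)) (by simpa using hm)
    (by simpa using hb) (by simpa using h4) (by simpa using h3) hthr hS).mono ?_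
  rintro s' t ⟨ht, hyes, hnot⟩
  simp only [State.setI_rreg, State.setI_rarr, State.setI_ireg, Nat.reduceEqDiff, reduceIte, h1, hl,
    hr, h9, ha5, h11, h12, hr12] at hyes hnot
  refine ⟨?_, by omega⟩
  by_cases hlt : s.rreg 21 < gammaDisc c (seg B l (r + 1)) (seg M l (r + 1))
  · obtain ⟨e1, e2, e3, e4, e5, e6⟩ := hyes hlt
    refine ⟨.inr ⟨l, r, hlr, hrN, hMl, hMr, hS, e1, e2, e3, e4, e5, e6⟩, ?_, ?_⟩
    · rw [e1]; exact hB.mono.trans hlt.le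
    · rintro l' r' (hP | ⟨rfl, rfl⟩) a₁ a₂ a₃ a₄ a₅
      · rw [e1]; exact (hB.complete l' r' hP a₁ a₂ a₃ a₄ a₅).trans hlt.le
      · rw [e1]
  · have hB' := hB.weaken (P' := P) (hnot hlt) fun _ _ h _ _ _ _ _ => h
    refine ⟨hB'.sound, hB'.mono, ?_⟩
    rintro l' r' (hP | ⟨rfl, rfl⟩) a₁ a₂ a₃ a₄ a₅
    · exact hB'.complete l' r' hP a₁ a₂ a₃ a₄ a₅
    · rw [hnot hlt 21 (by norm_num) (by norm_num)]
      exact not_lt.1 hlt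

/-- Treat the intervals that start with column `I 30`. -/
def bruteRow : Prog :=
  .rconst 31 0 ;; .rconst 32 0 ;; .iadd 31 30 1 ;;
  .loop (.ilt 31 3) (.rload 33 10 31 ;; .rload 34 11 31 ;; .radd 31 31 33 ;; .radd 32 32 34 ;;
    .cond (.rlt 3 33) bruteCell .skip ;; .iadd 31 31 2)

/-- The constants that the exhaustive search uses. -/
structure BruteBase (c thr : ℝ) (h : ℕ) (M B : ℕ → ℝ) (s₀ s : State) : Prop where
  base : Base h s
  r4 : s.rreg 4 = 1
  r1 : s.rreg 1 = c
  r5 : s.rreg 5 = thr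
  r6 : s.rreg 6 = 1 - thr
  M : ∀ x < 2 ^ h, s.rarr 10 x = M x
  B : ∀ x < 2 ^ h, s.rarr 11 x = B x
  a9 : s.rarr 9 = s₀.rarr 9
  a5 : s.rarr 5 = s₀.rarr 5
  i11 : s.ireg 11 = s₀.ireg 11
  i12 : s.ireg 12 = s₀.ireg 12
  r12 : s.rreg 12 = s₀.rreg 12

theorem BruteBase.of_eq {c thr : ℝ} {h : ℕ} {M B : ℕ → ℝ} {s₀ s s' : State}
    (hb : BruteBase c thr h M B s₀ s) (hi : ∀ x, x < 30 → s'.ireg x = s.ireg x)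
    (hr : ∀ x, x < 20 → s'.rreg x = s.rreg x) (hia : s'.iarr = s.iarr) (hra : s'.rarr = s.rarr) :
    BruteBase c thr h M B s₀ s' where
  base := hb.base.of_eq (hr 3 (by norm_num)) (hi 1 (by norm_num)) (hi 2 (by norm_num))
    (hi 3 (by norm_num)) (by rw [hia])
  r4 := (hr 4 (by norm_num)).trans hb.r4
  r1 := (hr 1 (by norm_num)).trans hb.r1
  r5 := (hr 5 (by norm_num)).trans hb.r5
  r6 := (hr 6 (by norm_num)).trans hb.r6
  M := by rw [hra]; exact hb.M
  B := by rw [hra]; exact hb.B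
  a9 := by rw [hra]; exact hb.a9
  a5 := by rw [hra]; exact hb.a5
  i11 := (hi 11 (by norm_num)).trans hb.i11
  i12 := (hi 12 (by norm_num)).trans hb.i12
  r12 := (hr 12 (by norm_num)).trans hb.r12

theorem run_bruteRow {s₀ s : State} {h l : ℕ} {c thr : ℝ} {M B : ℕ → ℝ}
    (hb : BruteBase c thr h M B s₀ s) (hthr : 0 < thr) (hl : s.ireg 30 = l) (hMl : 0 < M l)
    (hB : BruteOK c thr (2 ^ h) M B (fun l' _ => l' < l) s₀ s) :
    Run bruteRow s fun s' t =>
      BruteOK c thr (2 ^ h) M B (fun l' _ => l' < l + 1) s₀ s' ∧ t ≤ 40 * 2 ^ h + 10 := by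
  simp only [bruteRow, run_seq, run_rconst, run_iadd, Rat.cast_zero]
  refine run_loop (2 ^ h) (fun j s' => s'.ireg 31 = l + j ∧ (l + j ≤ 2 ^ h ∨ j = 0) ∧
    s'.rreg 31 = seg M l (l + j) ∧ s'.rreg 32 = seg B l (l + j) ∧
    BruteOK c thr (2 ^ h) M B (fun l' r' => l' < l ∨ l' = l ∧ r' < l + j) s₀ s')
    (fun _ => 34) ?_ ?_ ?_
  · refine ⟨by simp [hl, hb.base.i1], by simp, by simp [seg_self], by simp [seg_self], ?_⟩
    refine hB.weaken (fun x hx hx' => ?_) fun l' r' h h' _ _ _ _ => ?_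
    · simp only [State.setI_rreg, State.setR_rreg]
      rw [if_neg (by omega), if_neg (by omega)]
    · omega
  · rintro j s' ⟨h31, hle, hm, hbb, hOK⟩ F hlt
    have hb' : BruteBase c thr h M B s₀ s' := by
      refine hb.of_eq (fun x hx => ?_) (fun x hx => ?_) ?_ ?_
      · rw [F.i x (by
          simp only [Prog.wi, bruteCell, feasProg, bruteVal, Bool.or_false, Bool.false_or,
            Bool.or_eq_false_iff, beq_eq_false_iff_ne]; omega)]
        simp only [State.setI_ireg, State.setR_ireg]; rw [if_neg (by omega)]
      · rw [F.r x (by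
          simp only [Prog.wr, bruteCell, feasProg, bruteVal, Bool.or_false, Bool.false_or,
            Bool.or_eq_false_iff, beq_eq_false_iff_ne]; omega)]
        simp only [State.setI_rreg, State.setR_rreg]; rw [if_neg (by omega), if_neg (by omega)]
      · funext x; exact F.ia x rfl
      · funext x; exact F.ra x rfl
    have e30 : s'.ireg 30 = l := by rw [F.i 30 rfl]; simpa using hl
    simp only [holds_ilt, h31, hb'.base.i3] at hlt
    refine ⟨by omega, ?_⟩
    simp only [run_seq, run_rload, run_radd, run_cond, run_skip, run_iadd, holds_rlt,
      State.setI_ireg, State.setI_rreg, State.setI_rarr, State.setR_ireg, State.setR_rreg,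
      State.setR_rarr, Nat.reduceEqDiff, reduceIte, h31, hb'.M _ hlt, hb'.B _ hlt, hm, hbb,
      hb'.base.r3, hb'.base.i2]
    refine ⟨fun hpos => ?_, fun hpos => ⟨⟨by omega, by omega, ?_, ?_, ?_⟩, by norm_num⟩⟩
    · refine (run_bruteCell (s₀ := s₀) (N := 2 ^ h) (l := l) (r := l + j) (c := c) (thr := thr)
        (M := M) (B := B) (P := fun l' r' => l' < l ∨ l' = l ∧ r' < l + j) ?_ ?_ ?_ ?_ ?_ ?_ ?_ ?_
        ?_ ?_ ?_ ?_ ?_ ?_ ?_ ?_ ?_ ?_ ?_ ?_ ?_).imp ?_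
      all_goals try simp only [State.setR_ireg, State.setR_rreg, State.setR_rarr, Nat.reduceEqDiff,
        reduceIte]
      · exact e30
      · exact h31
      · omega
      · exact hlt
      · exact hMl
      · exact hpos
      · rw [seg_succ (by omega)]
      · rw [seg_succ (by omega)]
      · exact hb'.r4
      · exact hb'.base.r3
      · exact hb'.base.i2
      · exact hb'.r1
      · exact hb'.r5
      · exact hb'.r6
      · exact hthr
      · exact hb'.a9
      · exact hb'.a5
      · exact hb'.i11
      · exact hb'.i12
      · exact hb'.r12
      · refine hOK.weaken (fun x hx hx' => ?_) fun l' r' h' _ _ _ _ _ => h'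
        simp only [State.setR_rreg]
        rw [if_neg (by omega), if_neg (by omega), if_neg (by omega), if_neg (by omega)]
      · rintro s'' t ⟨hOK', ht⟩ F'
        have g31 : s''.ireg 31 = l + j := by rw [F'.i 31 rfl]; simpa using h31
        have g2 : s''.ireg 2 = 1 := by rw [F'.i 2 rfl]; simpa using hb'.base.i2
        refine ⟨⟨by omega, by omega, ?_, ?_, ?_⟩, by omega⟩
        · rw [F'.r 31 rfl]; simp [hm, ← add_assoc, seg_succ]
        · rw [F'.r 32 rfl]; simp [hbb, ← add_assoc, seg_succ]
        · refine hOK'.weaken (fun x hx hx' => rfl) fun l' r' h' _ _ _ _ _ => ?_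
          omega
    · rw [← add_assoc, seg_succ (by omega)]
    · rw [← add_assoc, seg_succ (by omega)]
    · refine hOK.weaken (fun x hx hx' => ?_) fun l' r' h' h₁ h₂ h₃ h₄ _ => ?_
      · simp only [State.setI_rreg, State.setR_rreg]
        rw [if_neg (by omega), if_neg (by omega), if_neg (by omega), if_neg (by omega)]
      · rcases eq_or_ne r' (l + j) with hr | hr
        · rw [hr] at h₄; exact absurd h₄ hpos
        · omega
  · rintro j s' t hj ⟨h31, hle, hm, hbb, hOK⟩ F hlt ht
    have e3 : s'.ireg 3 = 2 ^ h := by rw [F.i 3 rfl]; simpa using hb.base.i3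
    simp only [holds_ilt, h31, e3, not_lt] at hlt
    simp only [sum_const, card_range, smul_eq_mul] at ht
    refine ⟨hOK.weaken (fun x hx hx' => rfl) fun l' r' h' h₁ h₂ _ _ _ => ?_, by omega⟩
    omega

/-- Find the interval of columns with the largest discrepancy. -/
def bruteProg : Prog :=
  .iconst 30 0 ;;
  .loop (.ilt 30 3) (.rload 33 10 30 ;; .cond (.rlt 3 33) bruteRow .skip ;; .iadd 30 30 2)

theorem run_bruteProg {s : State} {h : ℕ} {c thr : ℝ} {M B : ℕ → ℝ}
    (hb : BruteBase c thr h M B s s) (hthr : 0 < thr) :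
    Run bruteProg s fun s' t =>
      BruteOK c thr (2 ^ h) M B (fun _ _ => True) s s' ∧ t ≤ 2 ^ h * (40 * 2 ^ h + 20) + 10 := by
  simp only [bruteProg, run_seq, run_iconst]
  refine run_loop (2 ^ h) (fun j s' => s'.ireg 30 = j ∧
    BruteOK c thr (2 ^ h) M B (fun l' _ => l' < j) s s') (fun _ => 40 * 2 ^ h + 15) ?_ ?_ ?_
  · refine ⟨by simp, .inl fun _ _ _ => rfl, le_rfl, fun l r hl => ?_⟩
    exact absurd hl (Nat.not_lt_zero _)
  · rintro j s' ⟨h30, hOK⟩ F hlt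
    have hb' : BruteBase c thr h M B s s' := by
      refine hb.of_eq (fun x hx => ?_) (fun x hx => ?_) ?_ ?_
      · rw [F.i x (by
          simp only [Prog.wi, bruteRow, bruteCell, feasProg, bruteVal, Bool.or_false,
            Bool.false_or, Bool.or_eq_false_iff, beq_eq_false_iff_ne]; omega)]
        simp only [State.setI_ireg]; rw [if_neg (by omega)]
      · rw [F.r x (by
          simp only [Prog.wr, bruteRow, bruteCell, feasProg, bruteVal, Bool.or_false,
            Bool.false_or, Bool.or_eq_false_iff, beq_eq_false_iff_ne]; omega)]
        rfl
      · funext x; exact F.ia x rfl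
      · funext x; exact F.ra x rfl
    simp only [holds_ilt, h30, hb'.base.i3] at hlt
    refine ⟨by omega, ?_⟩
    simp only [run_seq, run_rload, run_cond, run_skip, run_iadd, holds_rlt,
      State.setI_ireg, State.setI_rreg, State.setI_rarr, State.setR_ireg, State.setR_rreg,
      State.setR_rarr, Nat.reduceEqDiff, reduceIte, h30, hb'.M _ hlt, hb'.base.r3, hb'.base.i2]
    refine ⟨fun hpos => ?_, fun hpos => ⟨⟨trivial, hOK.weaken (fun x hx hx' => ?_)
      fun l' r' hl' _ _ h₃ _ _ => ?_⟩, by omega⟩⟩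
    · refine (run_bruteRow (s₀ := s) (s := s'.setR 33 (M j)) (h := h) (l := j) (c := c) (thr := thr) (M := M) (B := B)
        (hb'.of_eq (fun _ _ => rfl) (fun x hx => ?_) rfl rfl) hthr (by simpa using h30) hpos
        (hOK.weaken (fun x hx hx' => ?_) fun _ _ h' _ _ _ _ _ => h')).imp ?_
      · simp only [State.setR_rreg]; rw [if_neg (by omega)]
      · simp only [State.setR_rreg]; rw [if_neg (by omega)]
      · rintro s'' t ⟨hOK', ht⟩ F'
        have g30 : s''.ireg 30 = j := by rw [F'.i 30 rfl]; simpa using h30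
        have g2 : s''.ireg 2 = 1 := by rw [F'.i 2 rfl]; simpa using hb'.base.i2
        exact ⟨⟨by omega, hOK'.weaken (fun x hx hx' => rfl) fun l' r' h' _ _ _ _ _ => h'⟩, by omega⟩
    · simp only [State.setI_rreg, State.setR_rreg]; rw [if_neg (by omega)]
    · rcases eq_or_ne l' j with hl | hl
      · rw [hl] at h₃; exact absurd h₃ hpos
      · omega
  · rintro j s' t hj ⟨h30, hOK⟩ F hlt ht
    have e3 : s'.ireg 3 = 2 ^ h := by rw [F.i 3 rfl]; simpa using hb.base.i3
    simp only [holds_ilt, h30, e3, not_lt] at hlt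
    simp only [sum_const, card_range, smul_eq_mul] at ht
    refine ⟨hOK.weaken (fun x hx hx' => rfl) fun l' r' h' h₁ h₂ _ _ _ => ?_, ?_⟩
    · omega
    · have : 2 ^ h * (40 * 2 ^ h + 15 + 1) ≤ 2 ^ h * (40 * 2 ^ h + 20) :=
        Nat.mul_le_mul_left _ (by omega)
      omega

end RealRAM

/-! ### The query -/

/-- Take the first `i` for which `[l, i]` is feasible. Then `[l, i)` is infeasible, by minimality or
because it is empty and `thr` is positive. Hence `l` competes for the starting value of `i`, and the
columns after `i` are a free extension. -/
theorem exists_start {l r : ℕ} {thr NEG am ab : ℝ} {M B : ℕ → ℝ}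
    (hthr : 0 < thr) (hl : 0 < l) (hlr : l ≤ r) (hf : Feas thr M B l (r + 1)) {e : ℕ → ℝ}
    (he : ∀ i ≤ r, StartOK thr NEG am ab M B 0 i (e i)) :
    ∃ i, l ≤ i ∧ i ≤ r ∧ am * seg M l (i + 1) + ab * seg B l (i + 1) ≤ e i := by
  classical
  have hex : ∃ i, l ≤ i ∧ Feas thr M B l (i + 1) := ⟨r, hlr, hf⟩
  set i := Nat.find hex with hi
  obtain ⟨h₁, h₂⟩ := Nat.find_spec hex
  have hir : i ≤ r := Nat.find_min' hex ⟨hlr, hf⟩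
  refine ⟨i, h₁, hir, (he i hir).ub l hl h₁ h₂ fun hcon => ?_⟩
  rcases Nat.eq_or_lt_of_le h₁ with hli | hli
  · rw [← hi] at hli
    rw [Feas, ← hli, seg_self] at hcon
    linarith [hcon.1]
  · obtain ⟨i', hi'⟩ : ∃ i', i = i' + 1 := ⟨i - 1, by omega⟩
    rw [hi'] at hcon
    have := Nat.find_min' hex (m := i') ⟨by omega, hcon⟩
    omega

theorem seg_shift {f : ℕ → ℝ} {N l k : ℕ} : ∑ u ∈ Ico (N + l) (N + k), f (u - N) = seg f l k := by
  rw [add_comm N l, add_comm N k, ← Finset.sum_Ico_add' (fun u => f (u - N)) l k N]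
  simp [seg]

namespace RealRAM

/-- The root of the tree in terms of columns. The leaf of column `c` has number `2 ^ h + c`, whence
the shifts; `rarr 15 1` is the component `best` of the root. -/
theorem DS.sem {thr NEG am ab : ℝ} {h : ℕ} {M B : ℕ → ℝ} {s : State}
    (hD : DS thr NEG am ab h M B s) :
    ∃ e : ℕ → ℝ, (∀ i < 2 ^ h, StartOK thr NEG am ab M B 0 i (e i)) ∧
      (∀ i r, i ≤ r → r < 2 ^ h → e i + (am * seg M (i + 1) (r + 1) + ab * seg B (i + 1) (r + 1)) ≤
        s.rarr 15 1) ∧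
      ∃ i r, i ≤ r ∧ r < 2 ^ h ∧
        s.rarr 15 1 = e i + (am * seg M (i + 1) (r + 1) + ab * seg B (i + 1) (r + 1)) := by
  have hex : ∀ i, ∃ e, i < 2 ^ h → s.tree (2 ^ h + i) = Node.leaf (am * M i + ab * B i) e ∧
      StartOK thr NEG am ab M B 0 i e := fun i => by
    by_cases hi : i < 2 ^ h
    · obtain ⟨e, he⟩ := hD.leaf i hi
      exact ⟨e, fun _ => he⟩
    · exact ⟨0, fun h => absurd h hi⟩
  choose e he using hex
  have hsem := Node.sem_tree (T := s.tree) (h := h)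
    (w := fun u => (fun c => am * M c + ab * B c) (u - 2 ^ h)) (e := fun u => e (u - 2 ^ h))
    hD.cons fun u hu hu' => by
      have := (he (u - 2 ^ h) (by rw [pow_succ] at hu'; omega)).1
      rwa [show 2 ^ h + (u - 2 ^ h) = u by omega] at this
  have hseg : ∀ i k, ∑ u ∈ Ico (2 ^ h + i) (2 ^ h + k), (fun c => am * M c + ab * B c) (u - 2 ^ h) =
      am * seg M i k + ab * seg B i k := fun i k =>
    (seg_shift (f := fun c => am * M c + ab * B c)).trans seg_comb
  refine ⟨e, fun i hi => (he i hi).2, fun i r hir hr => ?_, ?_⟩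
  · have := hsem.best_ub (2 ^ h + i) (2 ^ h + (r + 1)) (by omega) (by omega)
      (by rw [pow_succ]; omega)
    rw [add_assoc (2 ^ h) i 1, hseg] at this
    simpa [State.tree] using this
  · obtain ⟨i, k, h₁, h₂, h₃, h₄⟩ := hsem.best_att
    rw [pow_succ] at h₃
    refine ⟨i - 2 ^ h, k - 1 - 2 ^ h, by omega, by omega, ?_⟩
    have hi : i + 1 = 2 ^ h + (i - 2 ^ h + 1) := by omega
    have hk : k = 2 ^ h + (k - 1 - 2 ^ h + 1) := by omega
    rw [hi, hk, hseg] at h₄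
    have h₅ : (s.tree 1).best = s.rarr 15 1 := rfl
    rw [h₅] at h₄
    rw [h₄]

/-- The root of the tree bounds the linear function on all feasible intervals. -/
theorem DS.query_ub {thr NEG am ab : ℝ} {h : ℕ} {M B : ℕ → ℝ} {s : State}
    (hD : DS thr NEG am ab h M B s) (hthr : 0 < thr) {l r : ℕ}
    (hl : 0 < l) (hlr : l ≤ r) (hr : r < 2 ^ h) (hf : Feas thr M B l (r + 1)) :
    am * seg M l (r + 1) + ab * seg B l (r + 1) ≤ s.rarr 15 1 := by
  obtain ⟨e, he, hub, -⟩ := hD.sem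
  obtain ⟨i, h₁, h₂, h₃⟩ := exists_start hthr hl hlr hf fun i hi => he i (by omega)
  have := hub i r h₂ hr
  rw [← seg_add (f := M) (show l ≤ i + 1 by omega) (show i + 1 ≤ r + 1 by omega),
    ← seg_add (f := B) (show l ≤ i + 1 by omega) (show i + 1 ≤ r + 1 by omega)]
  linarith

/-- The root of the tree is attained at a feasible interval, or very small. -/
theorem DS.query_att {thr NEG am ab : ℝ} {h K : ℕ} {M B : ℕ → ℝ} {s : State}
    (hD : DS thr NEG am ab h M B s) (hC : Cols (2 ^ h) K thr M B)
    (hM : seg M 0 (2 ^ h) ≤ 1) (hB : seg B 0 (2 ^ h) ≤ 1) :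
    (∃ l r, 0 < l ∧ l ≤ r ∧ r < 2 ^ h ∧ Feas thr M B l (r + 1) ∧
      s.rarr 15 1 = am * seg M l (r + 1) + ab * seg B l (r + 1)) ∨
      s.rarr 15 1 ≤ NEG + |am| + |ab| := by
  obtain ⟨e, he, -, i, r, hir, hr, hbest⟩ := hD.sem
  have hM0 : 0 ≤ seg M (i + 1) (r + 1) := sum_nonneg fun c _ => hC.M_nonneg c
  have hB0 : 0 ≤ seg B (i + 1) (r + 1) := sum_nonneg fun c _ => hC.B_nonneg c
  -- A default start `NEG` can gain at most `|am| + |ab|`, as both total weights are at most 1. Any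
  -- other start is a feasible interval, and it stays feasible when extended.
  rcases (he i (by omega)).att with hneg | ⟨l, h₁, h₂, h₃, -, h₅⟩
  · right
    have a₁ : am * seg M (i + 1) (r + 1) ≤ |am| := by
      have := (seg_mono hC.M_nonneg (Nat.zero_le (i + 1)) (show r + 1 ≤ 2 ^ h by omega)).trans hM
      calc am * seg M (i + 1) (r + 1) ≤ |am| * seg M (i + 1) (r + 1) :=
            mul_le_mul_of_nonneg_right (le_abs_self am) hM0
        _ ≤ |am| * 1 := mul_le_mul_of_nonneg_left this (abs_nonneg _)
        _ = |am| := mul_one _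
    have a₂ : ab * seg B (i + 1) (r + 1) ≤ |ab| := by
      have := (seg_mono hC.B_nonneg (Nat.zero_le (i + 1)) (show r + 1 ≤ 2 ^ h by omega)).trans hB
      calc ab * seg B (i + 1) (r + 1) ≤ |ab| * seg B (i + 1) (r + 1) :=
            mul_le_mul_of_nonneg_right (le_abs_self ab) hB0
        _ ≤ |ab| * 1 := mul_le_mul_of_nonneg_left this (abs_nonneg _)
        _ = |ab| := mul_one _
    rw [hbest, hneg]; linarith
  · left
    refine ⟨l, r, h₁, by omega, hr, h₃.mono hC le_rfl (by omega), ?_⟩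
    rw [hbest, h₅, ← seg_add (f := M) (show l ≤ i + 1 by omega) (show i + 1 ≤ r + 1 by omega),
      ← seg_add (f := B) (show l ≤ i + 1 by omega) (show i + 1 ≤ r + 1 by omega)]
    ring

end RealRAM

/-! ### Tangents to the discrepancy function -/

/-- The coefficients of the tangent to the discrepancy function along the region where
`b / m = r` and `(1 - b) / (1 - m) = q`. -/
noncomputable def tanM (c r q : ℝ) : ℝ := c * (q - r)
/-- The coefficient of the baseline weight. -/
noncomputable def tanB (c r q : ℝ) : ℝ := c * (Real.log r - Real.log q)
/-- The constant coefficient. -/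
noncomputable def tanC (c q : ℝ) : ℝ := c * (1 + Real.log q - q)

/-- The tangent to the discrepancy function. -/
noncomputable def tangent (c r q b m : ℝ) : ℝ := tanM c r q * m + tanB c r q * b + tanC c q

/-- With `x = b / (r * m)` this is `1 - 1 / x ≤ log x` multiplied by `b`; equality holds at `b / m =
r`. -/
theorem tangent_half_le {b m r : ℝ} (hb : 0 < b) (hm : 0 < m) (hr : 0 < r) :
    b * (1 + Real.log r) - r * m ≤ b * Real.log (b / m) := by
  have h₁ : Real.log (b / m) = Real.log r + Real.log (b / (r * m)) := by
    rw [← Real.log_mul hr.ne' (by positivity)]; congr 1; field_simp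
  have h₂ := Real.one_sub_inv_le_log_of_pos (show 0 < b / (r * m) by positivity)
  rw [h₁]
  have h₃ : b * (1 - (b / (r * m))⁻¹) = b - r * m := by field_simp
  nlinarith [mul_le_mul_of_nonneg_left h₂ hb.le]

/-- With the same `x`, now between 1 and `1 + δ`, the gap is `b * (log x - 1 + 1 / x)`. By `log x ≤
x - 1` it is at most `b * (x - 1) ^ 2 / x`, which is quadratic in `δ`. -/
theorem tangent_half_ge {b m r δ : ℝ} (hb : 0 < b) (hm : 0 < m) (hr : 0 < r)
    (h₁ : r ≤ b / m) (h₂ : b / m ≤ r * (1 + δ)) :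
    b * Real.log (b / m) ≤ b * (1 + Real.log r) - r * m + b * δ ^ 2 := by
  have e₁ : Real.log (b / m) = Real.log r + Real.log (b / (r * m)) := by
    rw [← Real.log_mul hr.ne' (by positivity)]; congr 1; field_simp
  set x := b / (r * m) with hx
  have hx0 : 0 < x := by positivity
  have hrm : r * m = b / x := by rw [hx]; field_simp
  have hx1 : 1 ≤ x := by
    rw [hx, le_div_iff₀ (by positivity)]
    rw [le_div_iff₀ hm] at h₁; linarith
  have hx2 : x ≤ 1 + δ := by
    rw [hx, div_le_iff₀ (by positivity)]
    rw [div_le_iff₀ hm] at h₂; linarith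
  have h₃ := Real.log_le_sub_one_of_pos hx0
  have h₄ : x - 2 + 1 / x ≤ δ ^ 2 := by
    have : x - 2 + 1 / x = (x - 1) ^ 2 / x := by field_simp; ring
    rw [this]
    calc (x - 1) ^ 2 / x ≤ (x - 1) ^ 2 := div_le_self (sq_nonneg _) hx1
      _ ≤ δ ^ 2 := pow_le_pow_left₀ (by linarith) (by linarith) 2
  rw [e₁, hrm]
  have h₅ : b / x = b * (1 / x) := by ring
  rw [h₅]
  nlinarith [mul_le_mul_of_nonneg_left h₃ hb.le, mul_le_mul_of_nonneg_left h₄ hb.le]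

/-- The inequality for a half is applied to `b`, `m`, `r` and again to `1 - b`, `1 - m`, `q`. -/
theorem tangent_le {c r q b m : ℝ} (hc : 0 < c) (hr : 0 < r) (hq : 0 < q) (hb : 0 < b) (hb' : b < 1)
    (hm : 0 < m) (hm' : m < 1) : tangent c r q b m ≤ gammaDisc c b m := by
  have h₁ := tangent_half_le hb hm hr
  have h₂ := tangent_half_le (show 0 < 1 - b by linarith) (show 0 < 1 - m by linarith) hq
  have := mul_le_mul_of_nonneg_left (add_le_add h₁ h₂) hc.le
  rw [tangent, tanM, tanB, tanC, gammaDisc]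
  linarith

/-- The errors `b * δ ^ 2` and `(1 - b) * δ ^ 2` of the two halves add up to `δ ^ 2`. -/
theorem le_tangent {c r q b m δ : ℝ} (hc : 0 < c) (hr : 0 < r) (hq : 0 < q) (hb : 0 < b)
    (hb' : b < 1) (hm : 0 < m) (hm' : m < 1) (h₁ : r ≤ b / m) (h₂ : b / m ≤ r * (1 + δ))
    (h₃ : q ≤ (1 - b) / (1 - m)) (h₄ : (1 - b) / (1 - m) ≤ q * (1 + δ)) :
    gammaDisc c b m ≤ tangent c r q b m + c * δ ^ 2 := by
  have h₁ := tangent_half_ge hb hm hr h₁ h₂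
  have h₂ := tangent_half_ge (show 0 < 1 - b by linarith) (show 0 < 1 - m by linarith) hq h₃ h₄
  have := mul_le_mul_of_nonneg_left (add_le_add h₁ h₂) hc.le
  rw [tangent, tanM, tanB, tanC, gammaDisc]
  linarith

/-- The tangent for `r = q = 1` is the zero function. -/
theorem gammaDisc_nonneg {c b m : ℝ} (hc : 0 < c) (hb : 0 < b) (hb' : b < 1) (hm : 0 < m)
    (hm' : m < 1) : 0 ≤ gammaDisc c b m := by
  refine le_trans (le_of_eq ?_) (tangent_le hc one_pos one_pos hb hb' hm hm')
  simp [tangent, tanM, tanB, tanC]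

/-- A bound for the coefficients of all tangents with parameters in `[lo, hi]`. -/
noncomputable def tanBound (c lo hi : ℝ) : ℝ := c * (1 + (Real.log hi - Real.log lo) + hi)

theorem tanBound_pos {c lo hi : ℝ} (hc : 0 < c) (hlo : 0 < lo) (h1 : lo ≤ 1) (h1' : 1 ≤ hi) :
    0 < tanBound c lo hi := by
  have := Real.log_le_log hlo (h1.trans h1')
  exact mul_pos hc (by linarith)

theorem abs_tan_le {c lo hi r q : ℝ} (hc : 0 < c) (hlo : 0 < lo)
    (hr : lo ≤ r) (hr' : r ≤ hi) (hq : lo ≤ q) (hq' : q ≤ hi) :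
    |tanM c r q| + |tanB c r q| ≤ tanBound c lo hi := by
  have l₁ := Real.log_le_log hlo hr
  have l₂ := Real.log_le_log (hlo.trans_le hr) hr'
  have l₃ := Real.log_le_log hlo hq
  have l₄ := Real.log_le_log (hlo.trans_le hq) hq'
  rw [tanM, tanB, abs_mul, abs_mul, abs_of_pos hc, tanBound, ← mul_add]
  refine mul_le_mul_of_nonneg_left ?_ hc.le
  have a₁ : |q - r| ≤ hi := abs_le.2 ⟨by linarith, by linarith⟩
  have a₂ : |Real.log r - Real.log q| ≤ Real.log hi - Real.log lo :=
    abs_le.2 ⟨by linarith, by linarith⟩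
  linarith

theorem abs_tanC_le {c lo hi q : ℝ} (hc : 0 < c) (hlo : 0 < lo) (h1 : lo ≤ 1) (h1' : 1 ≤ hi)
    (hq : lo ≤ q) (hq' : q ≤ hi) : |tanC c q| ≤ tanBound c lo hi := by
  have l₁ := Real.log_nonpos hlo.le h1
  have l₂ := Real.log_nonneg h1'
  have l₃ := Real.log_le_log hlo hq
  have l₄ := Real.log_le_log (hlo.trans_le hq) hq'
  rw [tanC, abs_mul, abs_of_pos hc, tanBound]
  refine mul_le_mul_of_nonneg_left (abs_le.2 ⟨?_, ?_⟩) hc.le <;> linarith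

/-- Justifies the initial value of the linear record: a tangent is at least `-2 * tanBound` on the
unit square, so `-3 * tanBound` is exceeded by every supported region. -/
theorem neg_lt_tangent {c lo hi r q b m : ℝ} (hc : 0 < c) (hlo : 0 < lo) (h1 : lo ≤ 1)
    (h1' : 1 ≤ hi) (hr : lo ≤ r) (hr' : r ≤ hi) (hq : lo ≤ q) (hq' : q ≤ hi) (hb : 0 < b)
    (hb' : b < 1) (hm : 0 < m) (hm' : m < 1) : -(3 * tanBound c lo hi) < tangent c r q b m := by
  have h₁ := abs_tan_le hc hlo hr hr' hq hq'
  have h₂ := abs_tanC_le hc hlo h1 h1' hq hq'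
  have h₃ := tanBound_pos hc hlo h1 h1'
  have h₄ : -|tanM c r q| ≤ tanM c r q * m := by
    rw [neg_le, ← neg_mul]
    calc -tanM c r q * m ≤ |tanM c r q| * m := mul_le_mul_of_nonneg_right (neg_le_abs _) hm.le
      _ ≤ |tanM c r q| * 1 := mul_le_mul_of_nonneg_left hm'.le (abs_nonneg _)
      _ = _ := mul_one _
  have h₅ : -|tanB c r q| ≤ tanB c r q * b := by
    rw [neg_le, ← neg_mul]
    calc -tanB c r q * b ≤ |tanB c r q| * b := mul_le_mul_of_nonneg_right (neg_le_abs _) hb.le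
      _ ≤ |tanB c r q| * 1 := mul_le_mul_of_nonneg_left hb'.le (abs_nonneg _)
      _ = _ := mul_one _
  have h₆ := (abs_le.1 h₂).1
  rw [tangent]
  linarith

/-! ### The search for the best strip -/

/-- The preprocessed input. -/
structure Inst where
  /-- number of points -/
  n : ℕ
  /-- the height of the search tree -/
  h : ℕ
  /-- a bound for the number of points in a region with too little weight -/
  K : ℕ
  /-- number of starting times -/
  cnt : ℕ
  /-- a bound for the size of the grid of ratios -/
  J : ℕ
  /-- normalized measurements -/
  mv : ℕ → ℝ
  /-- normalized baseline weights -/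
  bv : ℕ → ℝ
  /-- time stamps -/
  ts : ℕ → ℝ
  /-- second coordinates, in increasing order -/
  ys : ℕ → ℝ
  /-- columns -/
  col : ℕ → ℕ
  /-- the first coordinate of a column -/
  xc : ℕ → ℝ
  /-- starting times -/
  tau : ℕ → ℝ
  /-- minimal support -/
  thr : ℝ
  /-- the factor of the discrepancy function -/
  c : ℝ
  /-- lower bound for the ratios -/
  lo : ℝ
  /-- upper bound for the ratios -/
  hi : ℝ
  /-- quotient of the grid of ratios -/
  g : ℝ

namespace Inst

/-- The properties of the preprocessed input. -/
structure Valid (P : Inst) : Prop where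
  pts : Pts P.n P.h P.K P.thr P.mv P.bv P.col
  thr_pos : 0 < P.thr
  c_pos : 0 < P.c
  lo_pos : 0 < P.lo
  lo_le : P.lo ≤ 1
  le_hi : 1 ≤ P.hi
  g_gt : 1 < P.g
  sum_m : ∑ a ∈ range P.n, P.mv a = 1
  sum_b : ∑ a ∈ range P.n, P.bv a = 1
  grid : P.hi < P.lo * P.g ^ P.J

/-- The points of a strip that are recent enough. -/
noncomputable def A (P : Inst) (κ a t : ℕ) : Finset ℕ := alive P.ts (P.tau κ) a t

/-- The column sums of the measurements in a strip. -/
noncomputable def M (P : Inst) (κ a t : ℕ) : ℕ → ℝ := colSum P.mv P.col (P.A κ a t)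

/-- The column sums of the baseline weights in a strip. -/
noncomputable def B (P : Inst) (κ a t : ℕ) : ℕ → ℝ := colSum P.bv P.col (P.A κ a t)

/-- The region is sufficiently supported. -/
def Sup (P : Inst) (κ a t l r : ℕ) : Prop :=
  Supp P.thr (seg (P.M κ a t) l (r + 1)) (seg (P.B κ a t) l (r + 1))

/-- The discrepancy of a region. -/
noncomputable def disc (P : Inst) (κ a t l r : ℕ) : ℝ :=
  gammaDisc P.c (seg (P.B κ a t) l (r + 1)) (seg (P.M κ a t) l (r + 1))

/-- A bound for the coefficients of the tangents. -/
noncomputable def bound (P : Inst) : ℝ := tanBound P.c P.lo P.hi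

/-- `a` is the first point with its second coordinate. -/
def First (P : Inst) (a : ℕ) : Prop := 0 < a → P.ys (a - 1) < P.ys a

/-- `t` is the last point with its second coordinate. -/
def Last (P : Inst) (t : ℕ) : Prop := t + 1 < P.n → P.ys t < P.ys (t + 1)

/-- The points from `a` to `t` form a horizontal strip. -/
structure Strip (P : Inst) (κ a t : ℕ) : Prop where
  κ_lt : κ < P.cnt
  le : a ≤ t
  lt : t < P.n
  first : P.First a
  last : P.Last t

variable {P : Inst}

theorem A_subset {κ a t : ℕ} (ht : t ≤ P.n) : P.A κ a t ⊆ range P.n := fun x hx => by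
  have := mem_Ico.1 (mem_filter.1 hx).1
  exact mem_range.2 (by omega)

theorem Valid.cols (hP : P.Valid) {κ a t : ℕ} (ht : t ≤ P.n) :
    Cols (2 ^ P.h) P.K P.thr (P.M κ a t) (P.B κ a t) := hP.pts.cols (A_subset ht)

theorem Valid.seg_M_le (hP : P.Valid) {κ a t : ℕ} (ht : t ≤ P.n) (l r : ℕ) :
    seg (P.M κ a t) l r ≤ ∑ x ∈ P.A κ a t, P.mv x := by
  rw [M, seg_colSum]
  exact sum_le_sum_of_subset_of_nonneg (filter_subset _ _) fun x hx _ =>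
    (hP.pts.m_pos x (mem_range.1 (A_subset ht hx))).le

theorem Valid.seg_B_le (hP : P.Valid) {κ a t : ℕ} (ht : t ≤ P.n) (l r : ℕ) :
    seg (P.B κ a t) l r ≤ ∑ x ∈ P.A κ a t, P.bv x := by
  rw [B, seg_colSum]
  exact sum_le_sum_of_subset_of_nonneg (filter_subset _ _) fun x hx _ =>
    (hP.pts.b_pos x (mem_range.1 (A_subset ht hx))).le

theorem Valid.sum_A_m_le (hP : P.Valid) {κ a t : ℕ} (ht : t ≤ P.n) :
    ∑ x ∈ P.A κ a t, P.mv x ≤ 1 := by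
  rw [← hP.sum_m]
  exact sum_le_sum_of_subset_of_nonneg (A_subset ht) fun x hx _ =>
    (hP.pts.m_pos x (mem_range.1 hx)).le

theorem Valid.sum_A_b_le (hP : P.Valid) {κ a t : ℕ} (ht : t ≤ P.n) :
    ∑ x ∈ P.A κ a t, P.bv x ≤ 1 := by
  rw [← hP.sum_b]
  exact sum_le_sum_of_subset_of_nonneg (A_subset ht) fun x hx _ =>
    (hP.pts.b_pos x (mem_range.1 hx)).le

/-- A strip of too large weight contains almost all points. -/
theorem Valid.card_compl_le (hP : P.Valid) {κ a t : ℕ} (hat : a ≤ t) (ht : t < P.n)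
    (hw : ¬ (∑ x ∈ P.A κ a (t + 1), P.mv x ≤ 1 - P.thr ∧
      ∑ x ∈ P.A κ a (t + 1), P.bv x ≤ 1 - P.thr)) : a + (P.n - 1 - t) ≤ P.K := by
  have hA : P.A κ a (t + 1) ⊆ range P.n := A_subset (by omega)
  -- Outside a strip that is too heavy, one of the two weights is less than `thr`, so at most `K`
  -- points are there. Among them are all points with an index below `a` or above `t`.
  have h₁ := hP.pts.few (range P.n \ P.A κ a (t + 1)) sdiff_subset (by
    rw [sum_sdiff_eq_sub hA, sum_sdiff_eq_sub hA, hP.sum_m, hP.sum_b]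
    by_contra hcon
    rw [not_or, not_lt, not_lt] at hcon
    exact hw ⟨by linarith [hcon.1], by linarith [hcon.2]⟩)
  have h₂ : (range P.n \ Ico a (t + 1)) ⊆ range P.n \ P.A κ a (t + 1) :=
    sdiff_subset_sdiff le_rfl (filter_subset _ _)
  have h₃ := (card_le_card h₂).trans h₁
  rw [card_sdiff_of_subset (fun x hx => by rw [mem_Ico] at hx; rw [mem_range]; omega), card_range,
    Nat.card_Ico] at h₃
  omega

theorem Sup.bounds (hP : P.Valid) {κ a t l r : ℕ} (h : P.Sup κ a t l r) :
    0 < seg (P.B κ a t) l (r + 1) ∧ seg (P.B κ a t) l (r + 1) < 1 ∧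
      0 < seg (P.M κ a t) l (r + 1) ∧ seg (P.M κ a t) l (r + 1) < 1 := by
  have := hP.thr_pos
  exact ⟨by linarith [h.b_ge], by linarith [h.b_le], by linarith [h.m_ge], by linarith [h.m_le]⟩

end Inst

/-! ### The records of the search, and the treatment of one strip -/

namespace RealRAM

/-- The state holds the preprocessed input. -/
structure Env (P : Inst) (s : State) : Prop where
  base : Base P.h s
  i0 : s.ireg 0 = P.n
  i4 : s.ireg 4 = P.cnt
  r1 : s.rreg 1 = P.c
  r4 : s.rreg 4 = 1
  r5 : s.rreg 5 = P.thr
  r6 : s.rreg 6 = 1 - P.thr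
  r7 : s.rreg 7 = P.lo
  r8 : s.rreg 8 = P.hi
  r9 : s.rreg 9 = P.g
  r10 : s.rreg 10 = -(6 * P.bound)
  arr : Arrays P.n P.mv P.bv P.ts P.col s
  ys : s.rarr 5 = P.ys
  xc : s.rarr 9 = P.xc
  tau : s.rarr 4 = P.tau

/-- Does the program leave the preprocessed input unchanged? -/
def Prog.keeps (p : Prog) : Bool :=
  !(p.wi 0 || p.wi 1 || p.wi 2 || p.wi 3 || p.wi 4 || p.wr 1 || p.wr 3 || p.wr 4 || p.wr 5 ||
    p.wr 6 || p.wr 7 || p.wr 8 || p.wr 9 || p.wr 10 || p.wia 0 || p.wia 3 || p.wra 4 || p.wra 5 ||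
    p.wra 6 || p.wra 7 || p.wra 8 || p.wra 9)

theorem Env.of_eq {P : Inst} {s s' : State} (hE : Env P s) (hi : ∀ x, x < 5 → s'.ireg x = s.ireg x)
    (hr : ∀ x, 0 < x → x < 11 → x ≠ 2 → s'.rreg x = s.rreg x) (h0 : s'.iarr 0 = s.iarr 0)
    (h3 : s'.iarr 3 = s.iarr 3) (hra : ∀ x, 4 ≤ x → x < 10 → s'.rarr x = s.rarr x) : Env P s' where
  base := hE.base.of_eq (hr 3 (by norm_num) (by norm_num) (by norm_num)) (hi 1 (by norm_num))
    (hi 2 (by norm_num)) (hi 3 (by norm_num)) h3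
  i0 := (hi 0 (by norm_num)).trans hE.i0
  i4 := (hi 4 (by norm_num)).trans hE.i4
  r1 := (hr 1 (by norm_num) (by norm_num) (by norm_num)).trans hE.r1
  r4 := (hr 4 (by norm_num) (by norm_num) (by norm_num)).trans hE.r4
  r5 := (hr 5 (by norm_num) (by norm_num) (by norm_num)).trans hE.r5
  r6 := (hr 6 (by norm_num) (by norm_num) (by norm_num)).trans hE.r6
  r7 := (hr 7 (by norm_num) (by norm_num) (by norm_num)).trans hE.r7
  r8 := (hr 8 (by norm_num) (by norm_num) (by norm_num)).trans hE.r8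
  r9 := (hr 9 (by norm_num) (by norm_num) (by norm_num)).trans hE.r9
  r10 := (hr 10 (by norm_num) (by norm_num) (by norm_num)).trans hE.r10
  arr := hE.arr.of_eq h0 (hra 6 (by norm_num) (by norm_num)) (hra 7 (by norm_num) (by norm_num))
    (hra 8 (by norm_num) (by norm_num))
  ys := (hra 5 (by norm_num) (by norm_num)).trans hE.ys
  xc := (hra 9 (by norm_num) (by norm_num)).trans hE.xc
  tau := (hra 4 (by norm_num) (by norm_num)).trans hE.tau

theorem Env.frame {P : Inst} {s s' : State} {p : Prog} (hE : Env P s) (F : Frame p s s')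
    (hp : p.keeps = true) : Env P s' := by
  simp only [Prog.keeps, Bool.not_eq_true', Bool.or_eq_false_iff, and_assoc] at hp
  obtain ⟨w0, w1, w2, w3, w4, v1, v3, v4, v5, v6, v7, v8, v9, v10, x0, x3, y4, y5, y6, y7, y8, y9⟩ :=
    hp
  refine hE.of_eq (fun x hx => F.i x ?_) (fun x hx hx' hx2 => F.r x ?_) (F.ia 0 x0) (F.ia 3 x3)
    fun x hx hx' => F.ra x ?_
  · interval_cases x <;> assumption
  · interval_cases x <;> first | assumption | omega
  · interval_cases x <;> assumption

/-- The best results so far. -/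
structure Res (P : Inst) (s : State) : Prop where
  disc : s.rreg 21 = -1 ∨ ∃ κ a t l r, P.Strip κ a t ∧ l ≤ r ∧ r < 2 ^ P.h ∧ 0 < P.M κ a (t + 1) l ∧
    0 < P.M κ a (t + 1) r ∧ P.Sup κ a (t + 1) l r ∧ s.rreg 21 = P.disc κ a (t + 1) l r ∧
    s.rreg 22 = P.xc l ∧ s.rreg 23 = P.ys a ∧ s.rreg 24 = P.xc r ∧ s.rreg 25 = P.ys t ∧
    s.rreg 26 = P.tau κ
  lin : s.rreg 20 = -(3 * P.bound) ∧ s.ireg 21 = 0 ∧ s.ireg 22 = 0 ∨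
    ∃ κ a t l r, P.Strip κ a t ∧ s.ireg 20 = κ ∧ s.ireg 21 = a ∧ s.ireg 22 = t + 1 ∧ 0 < l ∧ l ≤ r ∧
      r < 2 ^ P.h ∧ P.Sup κ a (t + 1) l r ∧ s.rreg 20 ≤ P.disc κ a (t + 1) l r
  ge : -(3 * P.bound) ≤ s.rreg 20

theorem Res.of_eq {P : Inst} {s s' : State} (hR : Res P s) (hi : ∀ x, 20 ≤ x → x ≤ 22 →
    s'.ireg x = s.ireg x) (hr : ∀ x, 20 ≤ x → x ≤ 26 → s'.rreg x = s.rreg x) : Res P s' := by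
  obtain ⟨h₁, h₂, h₃⟩ := hR
  constructor
  · rwa [hr 21 (by norm_num) (by norm_num), hr 22 (by norm_num) (by norm_num),
      hr 23 (by norm_num) (by norm_num), hr 24 (by norm_num) (by norm_num),
      hr 25 (by norm_num) (by norm_num), hr 26 (by norm_num) (by norm_num)]
  · rwa [hr 20 (by norm_num) (by norm_num), hi 20 (by norm_num) (by norm_num),
      hi 21 (by norm_num) (by norm_num), hi 22 (by norm_num) (by norm_num)]
  · rwa [hr 20 (by norm_num) (by norm_num)]

/-- The results can only get better. -/
structure Le (s s' : State) : Prop where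
  lin : s.rreg 20 ≤ s'.rreg 20
  disc : s.rreg 21 ≤ s'.rreg 21

theorem Le.trans {s s' s'' : State} (h : Le s s') (h' : Le s' s'') : Le s s'' :=
  ⟨h.1.trans h'.1, h.2.trans h'.2⟩

theorem Le.of_eq {s s' : State} (h₁ : s'.rreg 20 = s.rreg 20) (h₂ : s'.rreg 21 = s.rreg 21) :
    Le s s' := ⟨h₁.ge, h₂.ge⟩

/-- The results dominate all supported regions in a strip, for one of the tangents. -/
def Done (P : Inst) (κ : ℕ) (r q : ℝ) (a t : ℕ) (s : State) : Prop :=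
  P.Strip κ a t → ∀ l r', 0 < l → l ≤ r' → r' < 2 ^ P.h → P.Sup κ a (t + 1) l r' →
    P.disc κ a (t + 1) l r' ≤ s.rreg 21 ∨
      tangent P.c r q (seg (P.B κ a (t + 1)) l (r' + 1)) (seg (P.M κ a (t + 1)) l (r' + 1)) ≤
        s.rreg 20

theorem Done.mono {P : Inst} {κ a t : ℕ} {r q : ℝ} {s s' : State} (h : Done P κ r q a t s)
    (hs : Le s s') : Done P κ r q a t s' := fun hS l r' h₁ h₂ h₃ h₄ =>
  (h hS l r' h₁ h₂ h₃ h₄).imp (fun h => h.trans hs.2) fun h => h.trans hs.1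

/-- The strip and the tangent that are treated. -/
structure Ctx (P : Inst) (κ : ℕ) (r q : ℝ) (a : ℕ) (s : State) : Prop where
  env : Env P s
  κ_lt : κ < P.cnt
  i10 : s.ireg 10 = κ
  i11 : s.ireg 11 = a
  r12 : s.rreg 12 = P.tau κ
  r17 : s.rreg 17 = tanM P.c r q
  r18 : s.rreg 18 = tanB P.c r q
  r19 : s.rreg 19 = tanC P.c q

theorem Ctx.frame {P : Inst} {κ a : ℕ} {r q : ℝ} {s s' : State} {p : Prog} (hX : Ctx P κ r q a s)
    (F : Frame p s s') (hp : p.keeps = true) (h10 : p.wi 10 = false) (h11 : p.wi 11 = false)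
    (h12 : p.wr 12 = false) (h17 : p.wr 17 = false) (h18 : p.wr 18 = false)
    (h19 : p.wr 19 = false) : Ctx P κ r q a s' where
  env := hX.env.frame F hp
  κ_lt := hX.κ_lt
  i10 := (F.i 10 h10).trans hX.i10
  i11 := (F.i 11 h11).trans hX.i11
  r12 := (F.r 12 h12).trans hX.r12
  r17 := (F.r 17 h17).trans hX.r17
  r18 := (F.r 18 h18).trans hX.r18
  r19 := (F.r 19 h19).trans hX.r19

/-- `I 43 := 1` if point `I 12` is the last one with its second coordinate, otherwise
`I 43 := 0`. -/
def lastTest : Prog :=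
  .iconst 43 1 ;; .iadd 44 12 2 ;; .cond (.ilt 44 0) (.rload 31 5 12 ;; .rload 32 5 44 ;;
    .cond (.rlt 31 32) .skip (.iconst 43 0)) .skip

theorem run_lastTest {P : Inst} {s : State} (hE : Env P s) :
    Run lastTest s fun s' t => (s'.ireg 43 = 1 ↔ P.Last (s.ireg 12)) ∧ t ≤ 8 := by
  simp only [lastTest, run_seq, run_iconst, run_iadd, run_rload, run_cond, run_skip, holds_ilt,
    holds_rlt, State.setI_ireg, State.setI_rreg, State.setI_rarr, State.setR_ireg, State.setR_rreg,
    State.setR_rarr, Nat.reduceEqDiff, reduceIte, hE.base.i2, hE.i0, hE.ys]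
  refine ⟨fun h => ⟨fun h' => ⟨?_, by norm_num⟩, fun h' => ⟨?_, by norm_num⟩⟩, fun h => ⟨?_, by
    norm_num⟩⟩
  · simp [Inst.Last, h']
  · simp [Inst.Last, h, not_lt.1 h']
  · simp [Inst.Last, h]

/-- Use the root of the tree. -/
def queryBest : Prog :=
  .rload 31 15 2 ;; .radd 31 31 19 ;;
  .cond (.rlt 20 31) (.radd 20 31 3 ;; .iadd 20 10 1 ;; .iadd 21 11 1 ;; .iadd 22 12 2) .skip

/-- Treat the current strip. -/
def queryProg : Prog :=
  .cond (.rle 27 6) (.cond (.rle 28 6) queryBest bruteProg) bruteProg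

/-- The parameters of a tangent are in the range of ratios. -/
structure InRange (P : Inst) (r q : ℝ) : Prop where
  r_ge : P.lo ≤ r
  r_le : r ≤ P.hi
  q_ge : P.lo ≤ q
  q_le : q ≤ P.hi

/-- The whole strip weighs at most `1 - thr`, so in it support is the same as feasibility, and the
root of the tree bounds all supported regions. A root that stems from the default cannot become the
record: with `NEG` equal to -6 times the bound, it is at most -6 + 1 + 1 = -4 times the bound after
the constant term is added, while the record starts at -3 times the bound. -/
theorem run_queryBest {P : Inst} {κ a t : ℕ} {r q : ℝ} {s : State} (hP : P.Valid)
    (hX : Ctx P κ r q a s) (hrq : InRange P r q) (ht : s.ireg 12 = t) (hS : P.Strip κ a t)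
    (hD : DS (s.rreg 5) (s.rreg 10) (s.rreg 17) (s.rreg 18) P.h (P.M κ a (t + 1))
      (P.B κ a (t + 1)) s)
    (hm : ∑ x ∈ P.A κ a (t + 1), P.mv x ≤ 1 - P.thr)
    (hb : ∑ x ∈ P.A κ a (t + 1), P.bv x ≤ 1 - P.thr) (hR : Res P s) :
    Run queryBest s fun s' t' => Res P s' ∧ Le s s' ∧ Done P κ r q a t s' ∧ t' ≤ 10 := by
  have htn : t + 1 ≤ P.n := hS.lt
  have hC := hP.cols (κ := κ) (a := a) htn
  have hr0 := hP.lo_pos.trans_le hrq.r_ge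
  have hq0 := hP.lo_pos.trans_le hrq.q_ge
  have hthr := hP.thr_pos
  have hA₁ := abs_tan_le hP.c_pos hP.lo_pos hrq.r_ge hrq.r_le hrq.q_ge hrq.q_le
  have hA₂ := abs_tanC_le hP.c_pos hP.lo_pos hP.lo_le hP.le_hi hrq.q_ge hrq.q_le
  have hA₃ := tanBound_pos hP.c_pos hP.lo_pos hP.lo_le hP.le_hi
  have hsup : ∀ l r', Feas P.thr (P.M κ a (t + 1)) (P.B κ a (t + 1)) l (r' + 1) →
      P.Sup κ a (t + 1) l r' := fun l r' hf =>
    ⟨hf.1, hf.2, (hP.seg_M_le htn _ _).trans hm, (hP.seg_B_le htn _ _).trans hb⟩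
  have hub : ∀ l r', 0 < l → l ≤ r' → r' < 2 ^ P.h → P.Sup κ a (t + 1) l r' →
      tangent P.c r q (seg (P.B κ a (t + 1)) l (r' + 1)) (seg (P.M κ a (t + 1)) l (r' + 1)) ≤
        s.rarr 15 1 + s.rreg 19 := fun l r' h₁ h₂ h₃ h₄ => by
    have := hD.query_ub (by rw [hX.env.r5]; exact hthr) h₁ h₂ h₃
      (by rw [hX.env.r5]; exact ⟨h₄.m_ge, h₄.b_ge⟩)
    rw [hX.r17, hX.r18] at this
    rw [tangent, hX.r19]
    linarith
  have hatt := hD.query_att (by rw [hX.env.r5]; exact hC)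
    ((hP.seg_M_le htn _ _).trans (hP.sum_A_m_le htn))
    ((hP.seg_B_le htn _ _).trans (hP.sum_A_b_le htn))
  rw [hX.env.r5, hX.r17, hX.r18, hX.env.r10] at hatt
  simp only [queryBest, run_seq, run_iadd, run_rload, run_radd, run_cond, run_skip,
    holds_rlt, State.setI_ireg, State.setI_rreg, State.setI_rarr, State.setR_ireg, State.setR_rreg,
    State.setR_rarr, Nat.reduceEqDiff, reduceIte, hX.env.base.i2]
  refine ⟨fun hlt => ⟨?_, ?_, ?_, by norm_num⟩, fun hlt => ⟨?_, ?_, ?_, by norm_num⟩⟩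
  · constructor
    · simpa using hR.disc
    · right
      rcases hatt with ⟨l, r', h₁, h₂, h₃, h₄, h₅⟩ | hsmall
      · refine ⟨κ, a, t, l, r', hS, ?_, ?_, ?_, h₁, h₂, h₃, hsup l r' h₄, ?_⟩
        · simp [hX.i10, hX.env.base.i1]
        · simp [hX.i11, hX.env.base.i1]
        · simp [ht]
        · obtain ⟨b₁, b₂, b₃, b₄⟩ := (hsup l r' h₄).bounds hP
          have := tangent_le (c := P.c) hP.c_pos hr0 hq0 b₁ b₂ b₃ b₄
          rw [tangent] at this
          simp only [State.setI_rreg, State.setR_rreg, Nat.reduceEqDiff, reduceIte,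
            hX.env.base.r3, hX.r19, h₅, Inst.disc]
          linarith
      · exfalso
        have := hR.ge
        rw [hX.r19] at hlt
        have h₆ := (abs_le.1 hA₂).2
        rw [Inst.bound] at this hsmall
        linarith
    · simp only [State.setI_rreg, State.setR_rreg, Nat.reduceEqDiff, reduceIte, hX.env.base.r3]
      linarith [hR.ge]
  · refine ⟨?_, ?_⟩
    · simp only [State.setI_rreg, State.setR_rreg, Nat.reduceEqDiff, reduceIte, hX.env.base.r3]
      linarith
    · simp
  · intro _ l r' h₁ h₂ h₃ h₄
    right
    simp only [State.setI_rreg, State.setR_rreg, Nat.reduceEqDiff, reduceIte, hX.env.base.r3,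
      add_zero]
    exact hub l r' h₁ h₂ h₃ h₄
  · refine hR.of_eq (fun _ _ _ => rfl) fun x hx hx' => ?_
    simp only [State.setR_rreg]
    rw [if_neg (by omega), if_neg (by omega)]
  · exact Le.of_eq (by simp) (by simp)
  · intro _ l r' h₁ h₂ h₃ h₄
    right
    simp only [State.setR_rreg, Nat.reduceEqDiff, reduceIte]
    exact (hub l r' h₁ h₂ h₃ h₄).trans (not_lt.1 hlt)

end RealRAM

/-- An interval of columns can be shrunk such that its first and last columns are nonempty. -/
theorem Inst.Sup.shrink {P : Inst} (hP : P.Valid) {κ a t l r : ℕ} (ht : t ≤ P.n)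
    (h : P.Sup κ a t l r) : ∃ l' r', l ≤ l' ∧ l' ≤ r' ∧ r' ≤ r ∧ 0 < P.M κ a t l' ∧
      0 < P.M κ a t r' ∧ seg (P.M κ a t) l' (r' + 1) = seg (P.M κ a t) l (r + 1) ∧
      seg (P.B κ a t) l' (r' + 1) = seg (P.B κ a t) l (r + 1) := by
  set S := inCols P.col (P.A κ a t) l (r + 1) with hS
  have hne : S.Nonempty := by
    rw [nonempty_iff_ne_empty]
    intro he
    have := (h.bounds hP).2.2.1
    rw [M, seg_colSum, ← hS, he, sum_empty] at this
    exact lt_irrefl _ this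
  obtain ⟨x, hx, hxmin⟩ := exists_min_image S P.col hne
  obtain ⟨y, hy, hymax⟩ := exists_max_image S P.col hne
  obtain ⟨hxA, hx₁, hx₂⟩ := mem_filter.1 hx
  obtain ⟨hyA, hy₁, hy₂⟩ := mem_filter.1 hy
  have hpos : ∀ z ∈ P.A κ a t, 0 < P.mv z := fun z hz =>
    hP.pts.m_pos z (mem_range.1 (A_subset ht hz))
  have hSS : inCols P.col (P.A κ a t) (P.col x) (P.col y + 1) = S := by
    ext z
    constructor
    · intro hz
      obtain ⟨h₁, h₂, h₃⟩ := mem_filter.1 hz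
      exact mem_filter.2 ⟨h₁, by omega, by omega⟩
    · intro hz
      exact mem_filter.2 ⟨(mem_filter.1 hz).1, hxmin z hz, by have := hymax z hz; omega⟩
  refine ⟨P.col x, P.col y, hx₁, hxmin y hy, by omega, (colSum_pos_iff hpos).2 ⟨x, hxA, rfl⟩,
    (colSum_pos_iff hpos).2 ⟨y, hyA, rfl⟩, ?_, ?_⟩
  · rw [M, seg_colSum, seg_colSum, hSS]
  · rw [B, seg_colSum, seg_colSum, hSS]

namespace RealRAM

/-- The exhaustive search visits only intervals whose end columns are nonempty, because the
coordinates of these columns are recorded for the output. `Inst.Sup.shrink` reduces every other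
supported interval to one of them. -/
theorem run_bruteStrip {P : Inst} {κ a t : ℕ} {s : State} (hP : P.Valid)
    (hE : Env P s) (ha : s.ireg 11 = a) (ht : s.ireg 12 = t) (hτ : s.rreg 12 = P.tau κ)
    (htn : t + 1 ≤ P.n ) (hS : P.Strip κ a t)
    (hM : ∀ c < 2 ^ P.h, s.rarr 10 c = P.M κ a (t + 1) c)
    (hB : ∀ c < 2 ^ P.h, s.rarr 11 c = P.B κ a (t + 1) c) (hR : Res P s) :
    Run bruteProg s fun s' t' => Res P s' ∧ Le s s' ∧
      (∀ l r', 0 < l → l ≤ r' → r' < 2 ^ P.h → P.Sup κ a (t + 1) l r' →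
        P.disc κ a (t + 1) l r' ≤ s'.rreg 21) ∧ t' ≤ 2 ^ P.h * (40 * 2 ^ P.h + 20) + 10 := by
  refine (run_bruteProg (h := P.h) (c := P.c) (thr := P.thr) (M := P.M κ a (t + 1))
    (B := P.B κ a (t + 1)) ⟨hE.base, hE.r4, hE.r1, hE.r5, hE.r6, hM, hB, rfl, rfl, rfl, rfl, rfl⟩
    hP.thr_pos).imp ?_
  rintro s' t' ⟨hOK, ht'⟩ F
  refine ⟨⟨?_, ?_, ?_⟩, ⟨(F.r 20 rfl).ge, hOK.mono⟩, fun l r' h₁ h₂ h₃ h₄ => ?_, ht'⟩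
  · rcases hOK.sound with h | ⟨l, r', h₁, h₂, h₃, h₄, h₅, h₆⟩
    · rw [h 21 (by norm_num) (by norm_num), h 22 (by norm_num) (by norm_num),
        h 23 (by norm_num) (by norm_num), h 24 (by norm_num) (by norm_num),
        h 25 (by norm_num) (by norm_num), h 26 (by norm_num) (by norm_num)]
      exact hR.disc
    · rw [ha, ht, hτ, hE.ys, hE.xc] at h₆
      exact .inr ⟨κ, a, t, l, r', hS, h₁, h₂, h₃, h₄, h₅, h₆⟩
  · rw [F.r 20 rfl, F.i 20 rfl, F.i 21 rfl, F.i 22 rfl]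
    exact hR.lin
  · rw [F.r 20 rfl]; exact hR.ge
  · obtain ⟨l', r'', a₁, a₂, a₃, a₄, a₅, a₆, a₇⟩ := h₄.shrink hP htn
    have := hOK.complete l' r'' trivial a₂ (by omega) a₄ a₅ (by rw [a₆, a₇]; exact h₄)
    rwa [a₆, a₇] at this

/-- The time for deleting a point. -/
def delTime (K h : ℕ) : ℕ := (K + 3) * (30 * (K + 3) + 40 * (h + 1) + 40) + 20

/-- The time for an exhaustive search. -/
def bruteTime (h : ℕ) : ℕ := 2 ^ h * (40 * 2 ^ h + 20) + 10

/-- The price of an exhaustive search occurs only for strips that are too heavy, hence only if `a +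
(n - 1 - t) ≤ K`. Keeping this condition in the time bound lets the sum over all strips count at
most `(K + 1) ^ 2` of them. -/
theorem run_queryProg {P : Inst} {κ a t : ℕ} {r q : ℝ} {s : State} (hP : P.Valid)
    (hX : Ctx P κ r q a s) (hrq : InRange P r q) (ht : s.ireg 12 = t) (hS : P.Strip κ a t)
    (hD : DS (s.rreg 5) (s.rreg 10) (s.rreg 17) (s.rreg 18) P.h (P.M κ a (t + 1))
      (P.B κ a (t + 1)) s)
    (hc : Cells P.h P.mv P.bv P.col (P.A κ a (t + 1)) s) (hR : Res P s) :
    Run queryProg s fun s' t' => Res P s' ∧ Le s s' ∧ Done P κ r q a t s' ∧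
      t' ≤ 12 + if a + (P.n - 1 - t) ≤ P.K then bruteTime P.h else 0 := by
  have hbr : ¬ (∑ x ∈ P.A κ a (t + 1), P.mv x ≤ 1 - P.thr ∧
      ∑ x ∈ P.A κ a (t + 1), P.bv x ≤ 1 - P.thr) → Run bruteProg s fun s' t' => Res P s' ∧ Le s s' ∧
      Done P κ r q a t s' ∧ t' ≤ if a + (P.n - 1 - t) ≤ P.K then bruteTime P.h else 0 := by
    intro hw
    rw [if_pos (hP.card_compl_le hS.le hS.lt hw)]
    refine (run_bruteStrip hP hX.env hX.i11 ht hX.r12 hS.lt hS hD.cellM hD.cellB hR).mono ?_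
    rintro s' t' ⟨h₁, h₂, h₃, h₄⟩
    exact ⟨h₁, h₂, fun _ l r' a₁ a₂ a₃ a₄ => .inl (h₃ l r' a₁ a₂ a₃ a₄), h₄⟩
  simp only [queryProg, run_cond, holds_rle, hc.m, hc.b, hX.env.r6]
  refine ⟨fun hm => ⟨fun hb => ?_, fun hb => ?_⟩, fun hm => ?_⟩
  · refine (run_queryBest hP hX hrq ht hS hD hm hb hR).mono ?_
    rintro s' t' ⟨h₁, h₂, h₃, h₄⟩
    exact ⟨h₁, h₂, h₃, by omega⟩
  · refine (hbr fun h => hb h.2).mono ?_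
    rintro s' t' ⟨h₁, h₂, h₃, h₄⟩
    exact ⟨h₁, h₂, h₃, by omega⟩
  · refine (hbr fun h => hm h.1).mono ?_
    rintro s' t' ⟨h₁, h₂, h₃, h₄⟩
    exact ⟨h₁, h₂, h₃, by omega⟩

/-- Treat the strip whose last point is `I 12`, and delete this point. -/
def topBody : Prog :=
  lastTest ;; .cond (.ieq 43 2) queryProg .skip ;;
  .rload 31 8 12 ;; .cond (.rle 12 31) deleteProg .skip

/-- The data structure for a strip. -/
structure Strips (P : Inst) (κ a t : ℕ) (s : State) : Prop where
  ds : DS (s.rreg 5) (s.rreg 10) (s.rreg 17) (s.rreg 18) P.h (P.M κ a t) (P.B κ a t) s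
  cells : Cells P.h P.mv P.bv P.col (P.A κ a t) s

theorem DS.of_eq {thr NEG am ab : ℝ} {h : ℕ} {M B : ℕ → ℝ} {s s' : State}
    (hD : DS thr NEG am ab h M B s) (hr : ∀ x, 10 ≤ x → x ≤ 15 → s'.rarr x = s.rarr x)
    (h4 : s'.iarr 4 = s.iarr 4) (h5 : s'.iarr 5 = s.iarr 5) : DS thr NEG am ab h M B s' := by
  have eT : s'.tree = s.tree := by
    funext u
    simp only [State.tree, hr 12 (by norm_num) (by norm_num), hr 13 (by norm_num) (by norm_num),
      hr 14 (by norm_num) (by norm_num), hr 15 (by norm_num) (by norm_num)]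
  obtain ⟨h₁, h₂, h₃, h₄, h₅, h₆⟩ := hD
  refine ⟨?_, ?_, ?_, ?_, ?_, ?_⟩
  · rwa [hr 10 (by norm_num) (by norm_num)]
  · rwa [hr 11 (by norm_num) (by norm_num)]
  · rwa [h4]
  · rwa [h5]
  · rwa [eT]
  · intro c hc
    obtain ⟨e, he, hS⟩ := h₆ c hc
    exact ⟨e, by rw [eT, he], hS⟩

theorem Strips.of_eq {P : Inst} {κ a t : ℕ} {s s' : State} (hT : Strips P κ a t s)
    (hr : ∀ x, 10 ≤ x → x ≤ 15 → s'.rarr x = s.rarr x)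
    (h4 : s'.iarr 4 = s.iarr 4) (h5 : s'.iarr 5 = s.iarr 5) (r5 : s'.rreg 5 = s.rreg 5)
    (r10 : s'.rreg 10 = s.rreg 10) (r17 : s'.rreg 17 = s.rreg 17) (r18 : s'.rreg 18 = s.rreg 18)
    (r27 : s'.rreg 27 = s.rreg 27) (r28 : s'.rreg 28 = s.rreg 28) : Strips P κ a t s' where
  ds := by rw [r5, r10, r17, r18]; exact hT.ds.of_eq hr h4 h5
  cells := ⟨by rw [hr 10 (by norm_num) (by norm_num)]; exact hT.cells.M,
    by rw [hr 11 (by norm_num) (by norm_num)]; exact hT.cells.B, r27.trans hT.cells.m,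
    r28.trans hT.cells.b⟩

theorem Strips.frame {P : Inst} {κ a t : ℕ} {s s' : State} {p : Prog} (hT : Strips P κ a t s)
    (F : Frame p s s') (h : (p.wra 10 || p.wra 11 || p.wra 12 || p.wra 13 || p.wra 14 || p.wra 15 ||
      p.wia 4 || p.wia 5 || p.wr 5 || p.wr 10 || p.wr 17 || p.wr 18 || p.wr 27 || p.wr 28) = false) :
    Strips P κ a t s' := by
  simp only [Bool.or_eq_false_iff, and_assoc] at h
  obtain ⟨a0, a1, a2, a3, a4, a5, b4, b5, c5, c10, c17, c18, c27, c28⟩ := h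
  refine hT.of_eq (fun x hx hx' => F.ra x ?_) (F.ia 4 b4) (F.ia 5 b5) (F.r 5 c5) (F.r 10 c10)
    (F.r 17 c17) (F.r 18 c18) (F.r 27 c27) (F.r 28 c28)
  interval_cases x <;> assumption

theorem Res.frame {P : Inst} {s s' : State} {p : Prog} (hR : Res P s) (F : Frame p s s')
    (h : (p.wi 20 || p.wi 21 || p.wi 22 || p.wr 20 || p.wr 21 || p.wr 22 || p.wr 23 || p.wr 24 ||
      p.wr 25 || p.wr 26) = false) : Res P s' := by
  simp only [Bool.or_eq_false_iff, and_assoc] at h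
  obtain ⟨a0, a1, a2, b0, b1, b2, b3, b4, b5, b6⟩ := h
  refine hR.of_eq (fun x hx hx' => F.i x ?_) fun x hx hx' => F.r x ?_ <;>
    interval_cases x <;> assumption

/-- A strip that separates points with equal second coordinates need not come from a rectangle, so
the query is skipped unless `t` is the last of its row. Points that are too old were never inserted
and are not deleted. -/
theorem run_topBody {P : Inst} {κ a t : ℕ} {r q : ℝ} {s : State} (hP : P.Valid)
    (hX : Ctx P κ r q a s) (hrq : InRange P r q) (ht : s.ireg 12 = t) (hat : a ≤ t) (htn : t < P.n)
    (hfirst : P.First a) (hT : Strips P κ a (t + 1) s) (hR : Res P s) :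
    Run topBody s fun s' t' => Strips P κ a t s' ∧ Res P s' ∧ Le s s' ∧ Done P κ r q a t s' ∧
      t' ≤ delTime P.K P.h + 30 + if a + (P.n - 1 - t) ≤ P.K then bruteTime P.h else 0 := by
  simp only [topBody, run_seq]
  refine (run_lastTest hX.env).imp ?_
  rintro s₁ t₁ ⟨h43, ht₁⟩ F₁
  have hX₁ : Ctx P κ r q a s₁ := hX.frame F₁ rfl rfl rfl rfl rfl rfl rfl
  have hT₁ := hT.frame F₁ rfl
  have hR₁ := hR.frame F₁ rfl
  have hL₁ : Le s s₁ := Le.of_eq (F₁.r 20 rfl) (F₁.r 21 rfl)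
  have e12 : s₁.ireg 12 = t := (F₁.i 12 rfl).trans ht
  have hq : Run (.cond (.ieq 43 2) queryProg .skip) s₁ fun s' t' => Res P s' ∧ Le s₁ s' ∧
      Done P κ r q a t s' ∧ t' ≤ 15 + if a + (P.n - 1 - t) ≤ P.K then bruteTime P.h else 0 := by
    simp only [run_cond, run_skip, holds_ieq, hX₁.env.base.i2, h43, ht]
    refine ⟨fun hl => ?_, fun hl => ⟨hR₁, Le.of_eq rfl rfl, fun hS => absurd hS.last hl, by omega⟩⟩
    refine (run_queryProg hP hX₁ hrq e12 ⟨hX.κ_lt, hat, htn, hfirst, hl⟩ hT₁.ds hT₁.cells hR₁).mono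
      ?_
    rintro s' t' ⟨h₁, h₂, h₃, h₄⟩
    exact ⟨h₁, h₂, h₃, by omega⟩
  refine hq.imp ?_
  rintro s₂ t₂ ⟨hR₂, hL₂, hd₂, ht₂⟩ F₂
  have hX₂ : Ctx P κ r q a s₂ := hX₁.frame F₂ rfl rfl rfl rfl rfl rfl rfl
  have hT₂ := hT₁.frame F₂ rfl
  have g12 : s₂.ireg 12 = t := (F₂.i 12 rfl).trans e12
  simp only [run_rload, run_cond, run_skip, holds_rle, State.setR_rreg, Nat.reduceEqDiff, reduceIte,
    g12, hX₂.env.arr.t t htn, hX₂.r12]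
  refine ⟨fun hτ => ?_, fun hτ => ⟨?_, ?_, ?_, ?_, ?_⟩⟩
  · have hA : P.A κ a (t + 1) = insert t (P.A κ a t) := by
      rw [Inst.A, alive_succ hat, if_pos hτ]; rfl
    have hnm : t ∉ P.A κ a t := notMem_alive
    have hmem : t ∈ P.A κ a (t + 1) := by rw [hA]; exact mem_insert_self _ _
    have herase : (P.A κ a (t + 1)).erase t = P.A κ a t := by
      rw [hA, erase_insert]; exact notMem_alive
    have hdel := run_deleteProg (s := s₂.setR 31 (P.ts t)) (n := P.n) (h := P.h) (K := P.K)
      (mv := P.mv) (bv := P.bv) (col := P.col) (A := P.A κ a (t + 1))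
      (by simpa [hX₂.env.r5] using hP.pts) (Inst.A_subset htn)
      (hX₂.env.base.of_eq (by simp) (by simp) (by simp) (by simp) (by simp))
      (by
        have := (hT₂.of_eq (s' := s₂.setR 31 (P.ts t)) (fun _ _ _ => rfl) rfl rfl (by simp)
          (by simp) (by simp) (by simp) (by simp) (by simp)).ds
        exact this)
      (by simpa [g12] using hmem) (by simpa [g12] using hX₂.env.arr.col t htn)
      (by simpa [g12] using hX₂.env.arr.m t htn) (by simpa [g12] using hX₂.env.arr.b t htn)
    simp only [State.setR_ireg, State.setR_rreg, Nat.reduceEqDiff, reduceIte, g12, herase] at hdel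
    refine hdel.imp ?_
    rintro s₃ t₃ ⟨hD₃, h27, h28, ht₃⟩ F₃
    have e : ∀ x, deleteProg.wr x = false → x ≠ 31 → s₃.rreg x = s₂.rreg x := fun x hx hx' => by
      rw [F₃.r x hx]; simp [hx']
    have hle : Le s₂ s₃ := Le.of_eq (e 20 rfl (by norm_num)) (e 21 rfl (by norm_num))
    refine ⟨⟨?_, ⟨hD₃.cellM, hD₃.cellB, ?_, ?_⟩⟩, ?_, (hL₁.trans hL₂).trans hle, hd₂.mono hle, ?_⟩
    · rw [e 5 rfl (by norm_num), e 10 rfl (by norm_num), e 17 rfl (by norm_num),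
        e 18 rfl (by norm_num)]
      exact hD₃
    · rw [h27, hT₂.cells.m, hA, sum_insert hnm]; ring
    · rw [h28, hT₂.cells.b, hA, sum_insert hnm]; ring
    · refine (hR₂.of_eq (s' := s₂.setR 31 (P.ts t)) (fun _ _ _ => rfl) fun x hx hx' => ?_).frame F₃
        rfl
      simp only [State.setR_rreg]; rw [if_neg (by omega)]
    · rw [delTime]; omega
  · have hA : P.A κ a (t + 1) = P.A κ a t := by
      rw [Inst.A, alive_succ hat, if_neg hτ]; rfl
    have := hT₂.of_eq (s' := s₂.setR 31 (P.ts t)) (fun _ _ _ => rfl) rfl rfl (by simp)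
      (by simp) (by simp) (by simp) (by simp) (by simp)
    refine ⟨?_, ?_⟩
    · have h := this.ds
      rw [Inst.M, Inst.B, hA] at h
      exact h
    · rw [← hA]; exact this.cells
  · refine hR₂.of_eq (fun _ _ _ => rfl) fun x hx hx' => ?_
    simp only [State.setR_rreg]; rw [if_neg (by omega)]
  · exact (hL₁.trans hL₂).trans (Le.of_eq (by simp) (by simp))
  · exact hd₂.mono (Le.of_eq (by simp) (by simp))
  · omega

/-- Treat the strips that start with point `I 11`. -/
def topProg : Prog := .iadd 12 13 1 ;; .loop (.ilt 11 12) (.isub 12 12 2 ;; topBody)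

theorem run_topProg {P : Inst} {κ a : ℕ} {r q : ℝ} {s : State} (hP : P.Valid)
    (hX : Ctx P κ r q a s) (hrq : InRange P r q) (hn : s.ireg 13 = P.n)
    (hfirst : P.First a) (hT : Strips P κ a P.n s) (hR : Res P s) :
    Run topProg s fun s' t' => (∀ v, 1 ≤ v → v < 2 ^ P.h → Cons s'.tree v) ∧ Res P s' ∧ Le s s' ∧
      (∀ t, Done P κ r q a t s') ∧
      t' ≤ P.n * (delTime P.K P.h + 40) + 10 + if a ≤ P.K then (P.K + 1) * bruteTime P.h else 0 := by
  simp only [topProg, run_seq, run_iadd, hn, hX.env.base.i1, add_zero]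
  refine run_loop P.n (fun j s' => s'.ireg 12 = P.n - j ∧ Strips P κ a (P.n - j) s' ∧ Res P s' ∧
    Le s s' ∧ ∀ t, P.n - j ≤ t → Done P κ r q a t s')
    (fun j => delTime P.K P.h + 31 + if a + j ≤ P.K then bruteTime P.h else 0) ?_ ?_ ?_
  · refine ⟨by simp, hT.of_eq (fun _ _ _ => rfl) rfl rfl rfl rfl rfl rfl rfl rfl,
      hR.of_eq (fun x hx hx' => ?_) fun _ _ _ => rfl, Le.of_eq rfl rfl, fun t ht hS => ?_⟩
    · simp only [State.setI_ireg]; rw [if_neg (by omega)]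
    · have := hS.lt; omega
  · rintro j s' ⟨h12, hT', hR', hL', hd'⟩ F hlt
    have e11 : s'.ireg 11 = a := by rw [F.i 11 rfl]; simpa using hX.i11
    simp only [holds_ilt, h12, e11] at hlt
    refine ⟨by omega, ?_⟩
    have hE' : Ctx P κ r q a s' := by
      have : Ctx P κ r q a (s.setI 12 P.n) := by
        refine ⟨hX.env.of_eq (fun x hx => ?_) (fun _ _ _ _ => rfl) rfl rfl fun _ _ _ => rfl, hX.κ_lt,
          by simpa using hX.i10, by simpa using hX.i11, hX.r12, hX.r17, hX.r18, hX.r19⟩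
        simp only [State.setI_ireg]; rw [if_neg (by omega)]
      exact this.frame F rfl rfl rfl rfl rfl rfl rfl
    simp only [run_seq, run_isub, h12, hE'.env.base.i2]
    have hsub : P.n - j - 1 = P.n - (j + 1) := by omega
    rw [hsub]
    set t := P.n - (j + 1) with htdef
    have htj : P.n - j = t + 1 := by omega
    have hX'' : Ctx P κ r q a (s'.setI 12 t) := by
      refine ⟨hE'.env.of_eq (fun x hx => ?_) (fun _ _ _ _ => rfl) rfl rfl fun _ _ _ => rfl, hX.κ_lt,
        by simpa using hE'.i10, by simpa using hE'.i11, hE'.r12, hE'.r17, hE'.r18, hE'.r19⟩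
      simp only [State.setI_ireg]; rw [if_neg (by omega)]
    refine (run_topBody (t := t) (a := a) (κ := κ) (s := s'.setI 12 t) hP hX'' hrq (by simp)
      (by omega) (by omega) hfirst
      (htj ▸ hT'.of_eq (fun _ _ _ => rfl) rfl rfl rfl rfl rfl rfl rfl rfl)
      (hR'.of_eq (fun x hx hx' => ?_) fun _ _ _ => rfl)).imp ?_
    · simp only [State.setI_ireg]; rw [if_neg (by omega)]
    · rintro s'' t' ⟨hT'', hR'', hL'', hd'', ht'⟩ F'
      have g12 : s''.ireg 12 = t := by rw [F'.i 12 rfl]; simp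
      have hL₂ : Le s' s'' := ⟨hL''.1, hL''.2⟩
      refine ⟨⟨g12, hT'', hR'', hL'.trans hL₂, fun x hx => ?_⟩, ?_⟩
      · rcases Nat.eq_or_lt_of_le hx with hx | hx
        · exact hx ▸ hd''
        · exact (hd' x (by omega)).mono hL₂
      · rw [show P.n - 1 - t = j by omega] at ht'
        omega
  · rintro j s' t hj ⟨h12, hT', hR', hL', hd'⟩ F hlt ht
    have e11 : s'.ireg 11 = a := by rw [F.i 11 rfl]; simpa using hX.i11
    simp only [holds_ilt, h12, e11, not_lt] at hlt
    refine ⟨hT'.ds.cons, hR', hL', fun x hS => ?_, ?_⟩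
    · have := hS.le
      exact hd' x (by omega) hS
    · rw [sum_add_distrib, sum_add_distrib, sum_ite, sum_const_zero, sum_const, sum_const, sum_const,
        card_range, smul_eq_mul, smul_eq_mul, smul_eq_mul] at ht
      -- For a fixed `a` the expensive strips have `j ≤ K - a`: at most `K + 1` of them, and none if
      -- `a > K`.
      have hcard : #{x ∈ range P.n | a + x ≤ P.K} * bruteTime P.h ≤
          if a ≤ P.K then (P.K + 1) * bruteTime P.h else 0 := by
        split_ifs with haK
        · refine Nat.mul_le_mul_right _ ?_
          refine (card_le_card (t := range (P.K + 1)) fun x hx => ?_).trans (card_range _).le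
          have := (mem_filter.1 hx).2
          exact mem_range.2 (by omega)
        · rw [card_eq_zero.2, zero_mul]
          exact filter_eq_empty_iff.2 fun x _ => by omega
      have : P.n * (delTime P.K P.h + 40) = P.n * (delTime P.K P.h + 31) + P.n * 1 + P.n * 8 := by
        ring
      omega

end RealRAM

theorem Inst.Sup.disc_nonneg {P : Inst} (hP : P.Valid) {κ a t l r : ℕ} (h : P.Sup κ a t l r) :
    0 ≤ P.disc κ a t l r := by
  have hb := h.bounds hP
  exact gammaDisc_nonneg hP.c_pos hb.1 hb.2.1 hb.2.2.1 hb.2.2.2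

/-! ### The loops over bottom points, tangents and starting times -/

namespace RealRAM

theorem Frame.iconst (s : State) (i v : ℕ) : Frame (.iconst i v) s (s.setI i v) :=
  (Exec.iconst s i v).frame

theorem Frame.iadd (s : State) (i j k : ℕ) :
    Frame (.iadd i j k) s (s.setI i (s.ireg j + s.ireg k)) := (Exec.iadd s i j k).frame

theorem Frame.radd (s : State) (i j k : ℕ) :
    Frame (.radd i j k) s (s.setR i (s.rreg j + s.rreg k)) := (Exec.radd s i j k).frame

theorem Frame.rmul (s : State) (i j k : ℕ) :
    Frame (.rmul i j k) s (s.setR i (s.rreg j * s.rreg k)) := (Exec.rmul s i j k).frame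

/-- `I 43 := 1` if point `I 11` is the first one with its second coordinate, otherwise
`I 43 := 0`. -/
def firstTest : Prog :=
  .iconst 43 1 ;; .cond (.ilt 1 11) (.isub 44 11 2 ;; .rload 31 5 44 ;; .rload 32 5 11 ;;
    .cond (.rlt 31 32) .skip (.iconst 43 0)) .skip

theorem run_firstTest {P : Inst} {s : State} (hE : Env P s) :
    Run firstTest s fun s' t => (s'.ireg 43 = 1 ↔ P.First (s.ireg 11)) ∧ t ≤ 8 := by
  simp only [firstTest, run_seq, run_iconst, run_isub, run_rload, run_cond, run_skip, holds_ilt,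
    holds_rlt, State.setI_ireg, State.setI_rreg, State.setI_rarr, State.setR_ireg, State.setR_rreg,
    State.setR_rarr, Nat.reduceEqDiff, reduceIte, hE.base.i1, hE.base.i2, hE.ys]
  refine ⟨fun h => ⟨fun h' => ⟨?_, by norm_num⟩, fun h' => ⟨?_, by norm_num⟩⟩, fun h => ⟨?_, by
    norm_num⟩⟩
  · simp [Inst.First, h']
  · simp [Inst.First, h, not_lt.1 h']
  · simp [Inst.First, h]

/-- The state during the search. -/
structure Sane (P : Inst) (s : State) : Prop where
  env : Env P s
  i13 : s.ireg 13 = P.n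
  cons : ∀ v, 1 ≤ v → v < 2 ^ P.h → Cons s.tree v
  res : Res P s

theorem Sane.frame {P : Inst} {s s' : State} {p : Prog} (hS : Sane P s) (F : Frame p s s')
    (hp : p.keeps = true) (h : (p.wi 13 || p.wra 12 || p.wra 13 || p.wra 14 || p.wra 15 ||
      p.wi 20 || p.wi 21 || p.wi 22 || p.wr 20 || p.wr 21 || p.wr 22 || p.wr 23 || p.wr 24 ||
      p.wr 25 || p.wr 26) = false) : Sane P s' := by
  simp only [Bool.or_eq_false_iff, and_assoc] at h
  obtain ⟨w13, a2, a3, a4, a5, b0, b1, b2, c0, c1, c2, c3, c4, c5, c6⟩ := h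
  refine ⟨hS.env.frame F hp, (F.i 13 w13).trans hS.i13, ?_, hS.res.frame F ?_⟩
  · have : s'.tree = s.tree := by
      funext u
      simp only [State.tree, F.ra 12 a2, F.ra 13 a3, F.ra 14 a4, F.ra 15 a5]
    rw [this]; exact hS.cons
  · simp [b0, b1, b2, c0, c1, c2, c3, c4, c5, c6]

theorem Le.frame {s s' : State} {p : Prog} (F : Frame p s s')
    (h : (p.wr 20 || p.wr 21) = false) : Le s s' := by
  rw [Bool.or_eq_false_iff] at h
  exact Le.of_eq (F.r 20 h.1) (F.r 21 h.2)

/-- Treat the strips that start with point `I 11`, if this point is suitable. -/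
def bottomBody : Prog := firstTest ;; .cond (.ieq 43 2) (buildProg ;; topProg) .skip

/-- The time for the strips that start with a given point. -/
def bodyTime (P : Inst) : ℕ :=
  2 ^ P.h * (30 * (P.K + 3) + 40 * (P.h + 1) + 50) + 20 * P.n + P.n * (delTime P.K P.h + 40) + 70

/-- The tree left behind by the previous bottom point is reused: building needs it to be consistent,
not to be correct. If `a` is not the first point of its row, no strip starts with it and nothing has
to be done. -/
theorem run_bottomBody {P : Inst} {κ a : ℕ} {r q : ℝ} {s : State} (hP : P.Valid)
    (hX : Ctx P κ r q a s) (hrq : InRange P r q) (hS : Sane P s) :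
    Run bottomBody s fun s' t' => Sane P s' ∧ Le s s' ∧ (∀ t, Done P κ r q a t s') ∧
      t' ≤ bodyTime P + if a ≤ P.K then (P.K + 1) * bruteTime P.h else 0 := by
  simp only [bottomBody, run_seq]
  refine (run_firstTest hX.env).imp ?_
  rintro s₁ t₁ ⟨h43, ht₁⟩ F₁
  have hX₁ : Ctx P κ r q a s₁ := hX.frame F₁ rfl rfl rfl rfl rfl rfl rfl
  have hS₁ := hS.frame F₁ rfl rfl
  have hL₁ : Le s s₁ := Le.frame F₁ rfl
  simp only [run_cond, run_seq, run_skip, holds_ieq, hX₁.env.base.i2, h43, hX.i11]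
  refine ⟨fun hf => ?_, fun hf => ⟨hS₁, hL₁, fun t hT => absurd hT.first hf, by
    rw [bodyTime]; omega⟩⟩
  have hb := run_buildProg (s := s₁) (n := P.n) (h := P.h) (K := P.K) (mv := P.mv) (bv := P.bv)
    (ts := P.ts) (col := P.col) (by rw [hX₁.env.r5]; exact hP.pts) hX₁.env.arr hX₁.env.base
    hS₁.i13.le hS₁.cons
  rw [hX₁.i11, hX₁.r12, hS₁.i13] at hb
  refine hb.imp ?_
  rintro s₂ t₂ ⟨hC, hD, ht₂⟩ F₂
  have hX₂ : Ctx P κ r q a s₂ := hX₁.frame F₂ rfl rfl rfl rfl rfl rfl rfl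
  have hL₂ : Le s₁ s₂ := Le.frame F₂ rfl
  have i13 : s₂.ireg 13 = P.n := (F₂.i 13 rfl).trans hS₁.i13
  have hT : Strips P κ a P.n s₂ := ⟨by
    rw [F₂.r 5 rfl, F₂.r 10 rfl, F₂.r 17 rfl, F₂.r 18 rfl]; exact hD, hC⟩
  refine (run_topProg hP hX₂ hrq i13 hf hT (hS₁.res.frame F₂ rfl)).imp ?_
  rintro s₃ t₃ ⟨hc₃, hR₃, hL₃, hd₃, ht₃⟩ F₃
  refine ⟨⟨hX₂.env.frame F₃ rfl, (F₃.i 13 rfl).trans i13, hc₃, hR₃⟩, (hL₁.trans hL₂).trans hL₃, hd₃,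
    ?_⟩
  rw [bodyTime]
  omega

/-- Treat all strips, for one tangent. -/
def bottomProg : Prog := .iconst 11 0 ;; .loop (.ilt 11 0) (bottomBody ;; .iadd 11 11 2)

/-- The time for one tangent. -/
def bottomTime (P : Inst) : ℕ :=
  P.n * (bodyTime P + 2) + (P.K + 1) * ((P.K + 1) * bruteTime P.h) + 2

theorem sum_ite_le {n K T : ℕ} : (∑ i ∈ range n, if i ≤ K then T else 0) ≤ (K + 1) * T := by
  rw [sum_ite, sum_const_zero, sum_const, smul_eq_mul, add_zero]
  refine Nat.mul_le_mul_right _ ((card_le_card fun x hx => ?_).trans (card_range (K + 1)).le)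
  have := (mem_filter.1 hx).2
  exact mem_range.2 (by omega)

theorem run_bottomProg {P : Inst} {κ : ℕ} {r q : ℝ} {s : State} (hP : P.Valid)
    (hX : Ctx P κ r q (s.ireg 11) s) (hrq : InRange P r q) (hS : Sane P s) :
    Run bottomProg s fun s' t' => Sane P s' ∧ Le s s' ∧ (∀ a t, Done P κ r q a t s') ∧
      t' ≤ bottomTime P := by
  simp only [bottomProg, run_seq, run_iconst]
  have F₀ := Frame.iconst s 11 0
  refine run_loop P.n (fun j s' => s'.ireg 11 = j ∧ Ctx P κ r q j s' ∧ Sane P s' ∧ Le s s' ∧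
      ∀ a < j, ∀ t, Done P κ r q a t s')
    (fun j => bodyTime P + 1 + if j ≤ P.K then (P.K + 1) * bruteTime P.h else 0) ?_ ?_ ?_
  · refine ⟨by simp, ?_, hS.frame F₀ rfl rfl, Le.frame F₀ rfl, fun a ha => absurd ha a.not_lt_zero⟩
    exact ⟨hX.env.frame F₀ rfl, hX.κ_lt, (F₀.i 10 rfl).trans hX.i10, by simp, hX.r12, hX.r17, hX.r18,
      hX.r19⟩
  · rintro j s' ⟨h11, hX', hS', hL', hd'⟩ F hlt
    simp only [holds_ilt, h11, hX'.env.i0] at hlt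
    refine ⟨hlt, ?_⟩
    simp only [run_seq, run_iadd]
    refine (run_bottomBody hP hX' hrq hS').imp ?_
    rintro s₁ t₁ ⟨hS₁, hL₁, hd₁, ht₁⟩ F₁
    have F₂ := Frame.iadd s₁ 11 11 2
    have hL₂ : Le s₁ (s₁.setI 11 (s₁.ireg 11 + s₁.ireg 2)) := Le.frame F₂ rfl
    have hX₁ : Ctx P κ r q j s₁ := hX'.frame F₁ rfl rfl rfl rfl rfl rfl rfl
    have e : (s₁.setI 11 (s₁.ireg 11 + s₁.ireg 2)).ireg 11 = j + 1 := by
      simp [hX₁.i11, hX₁.env.base.i2]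
    refine ⟨⟨e, ⟨hX₁.env.frame F₂ rfl, hX.κ_lt, (F₂.i 10 rfl).trans hX₁.i10, e, hX₁.r12, hX₁.r17,
      hX₁.r18, hX₁.r19⟩, hS₁.frame F₂ rfl rfl, (hL'.trans hL₁).trans hL₂, fun a ha t => ?_⟩,
      by omega⟩
    rcases Nat.lt_succ_iff_lt_or_eq.1 ha with h | rfl
    · exact (hd' a h t).mono (hL₁.trans hL₂)
    · exact (hd₁ t).mono hL₂
  · rintro j s' t hj ⟨h11, hX', hS', hL', hd'⟩ F hlt ht
    simp only [holds_ilt, h11, hX'.env.i0] at hlt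
    refine ⟨hS', hL', fun a t hT => ?_, ?_⟩
    · have := hT.le
      have := hT.lt
      exact hd' a (by omega) t hT
    · rw [sum_add_distrib, sum_add_distrib, sum_const, sum_const, card_range, smul_eq_mul,
        smul_eq_mul] at ht
      have := sum_ite_le (n := P.n) (K := P.K) (T := (P.K + 1) * bruteTime P.h)
      have e : P.n * (bodyTime P + 2) = P.n * (bodyTime P + 1) + P.n * 1 := by ring
      rw [bottomTime]
      omega

/-- Compute the coefficients of the tangent. -/
def coefProg : Prog :=
  .rlog 16 15 ;; .rsub 17 15 13 ;; .rmul 17 1 17 ;; .rsub 18 14 16 ;; .rmul 18 1 18 ;;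
  .radd 19 4 16 ;; .rsub 19 19 15 ;; .rmul 19 1 19

theorem run_coefProg {P : Inst} {r q : ℝ} {s : State} (hE : Env P s) (h13 : s.rreg 13 = r)
    (h14 : s.rreg 14 = Real.log r) (h15 : s.rreg 15 = q) (hq : 0 < q) :
    Run coefProg s fun s' t => s'.rreg 17 = tanM P.c r q ∧ s'.rreg 18 = tanB P.c r q ∧
      s'.rreg 19 = tanC P.c q ∧ t = 8 := by
  simp [coefProg, hE.r1, hE.r4, h13, h14, h15, hq, tanM, tanB, tanC]

/-- Treat all tangents with a given first parameter. -/
def secondProg : Prog :=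
  .radd 15 7 3 ;; .loop (.rle 15 8) (coefProg ;; bottomProg ;; .rmul 15 15 9)

/-- The grid of ratios. -/
noncomputable def _root_.Inst.ratio (P : Inst) (j : ℕ) : ℝ := P.lo * P.g ^ j

theorem _root_.Inst.Valid.ratio_mono {P : Inst} (hP : P.Valid) {i j : ℕ} (h : i ≤ j) :
    P.ratio i ≤ P.ratio j :=
  mul_le_mul_of_nonneg_left (pow_le_pow_right₀ hP.g_gt.le h) hP.lo_pos.le

/-- Turns the tests on real numbers that control the loops over the ratios into the iteration bound
`J`. -/
theorem _root_.Inst.Valid.lt_of_ratio_le {P : Inst} (hP : P.Valid) {i : ℕ} (h : P.ratio i ≤ P.hi) :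
    i < P.J := by
  by_contra hlt
  exact absurd (hP.grid.trans_le (hP.ratio_mono (not_lt.1 hlt))) (not_lt.2 h)

theorem _root_.Inst.Valid.lo_le_ratio {P : Inst} (hP : P.Valid) (i : ℕ) : P.lo ≤ P.ratio i := by
  simpa [Inst.ratio] using hP.ratio_mono (Nat.zero_le i)

/-- The time for all tangents with a given first parameter. -/
def secondTime (P : Inst) : ℕ := P.J * (bottomTime P + 10) + 2

theorem run_secondProg {P : Inst} {κ i : ℕ} {s : State} (hP : P.Valid) (hS : Sane P s)
    (hκ : κ < P.cnt) (h10 : s.ireg 10 = κ) (h12 : s.rreg 12 = P.tau κ) (hi : P.ratio i ≤ P.hi)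
    (h13 : s.rreg 13 = P.ratio i) (h14 : s.rreg 14 = Real.log (P.ratio i)) :
    Run secondProg s fun s' t' => Sane P s' ∧ Le s s' ∧
      (∀ j, P.ratio j ≤ P.hi → ∀ a t, Done P κ (P.ratio i) (P.ratio j) a t s') ∧
      t' ≤ secondTime P := by
  simp only [secondProg, run_seq, run_radd]
  have F₀ := Frame.radd s 15 7 3
  refine run_loop P.J (fun j s' => s'.rreg 15 = P.ratio j ∧ Sane P s' ∧ Le s s' ∧
      ∀ k < j, ∀ a t, Done P κ (P.ratio i) (P.ratio k) a t s')
    (fun j => bottomTime P + 9) ?_ ?_ ?_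
  · exact ⟨by simp [hS.env.r7, hS.env.base.r3, Inst.ratio], hS.frame F₀ rfl rfl, Le.frame F₀ rfl,
      fun a ha => absurd ha a.not_lt_zero⟩
  · rintro j s' ⟨h15, hS', hL', hd'⟩ F hle
    simp only [holds_rle, h15, hS'.env.r8] at hle
    refine ⟨hP.lt_of_ratio_le hle, ?_⟩
    simp only [run_seq]
    have e13 : s'.rreg 13 = P.ratio i := by rw [F.r 13 rfl, F₀.r 13 rfl, h13]
    have e14 : s'.rreg 14 = Real.log (P.ratio i) := by rw [F.r 14 rfl, F₀.r 14 rfl, h14]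
    refine (run_coefProg hS'.env e13 e14 h15 (hP.lo_pos.trans_le (hP.lo_le_ratio j))).imp ?_
    rintro s₁ t₁ ⟨h17, h18, h19, ht₁⟩ F₁
    have hS₁ := hS'.frame F₁ rfl rfl
    have hX : Ctx P κ (P.ratio i) (P.ratio j) (s₁.ireg 11) s₁ := ⟨hS₁.env, hκ, by
      rw [F₁.i 10 rfl, F.i 10 rfl, F₀.i 10 rfl, h10], rfl, by
      rw [F₁.r 12 rfl, F.r 12 rfl, F₀.r 12 rfl, h12], h17, h18, h19⟩
    refine (run_bottomProg hP hX ⟨hP.lo_le_ratio i, hi, hP.lo_le_ratio j, hle⟩ hS₁).imp ?_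
    rintro s₂ t₂ ⟨hS₂, hL₂, hd₂, ht₂⟩ F₂
    have F₃ := Frame.rmul s₂ 15 15 9
    have hL₁ : Le s' s₁ := Le.frame F₁ rfl
    have hL₃ : Le s₂ (s₂.setR 15 (s₂.rreg 15 * s₂.rreg 9)) := Le.frame F₃ rfl
    rw [run_rmul]
    refine ⟨⟨?_, hS₂.frame F₃ rfl rfl, ((hL'.trans hL₁).trans hL₂).trans hL₃, fun k hk a t => ?_⟩, by
      omega⟩
    · simp [F₂.r 15 rfl, F₁.r 15 rfl, h15, hS₂.env.r9, Inst.ratio, pow_succ, mul_assoc]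
    · rcases Nat.lt_succ_iff_lt_or_eq.1 hk with h | rfl
      · exact (hd' k h a t).mono ((hL₁.trans hL₂).trans hL₃)
      · exact (hd₂ a t).mono hL₃
  · rintro j s' t hj ⟨h15, hS', hL', hd'⟩ F hle ht
    simp only [holds_rle, h15, hS'.env.r8] at hle
    -- The loop stops at the first grid value above `hi`; by monotonicity every grid value up to
    -- `hi` has been treated.
    refine ⟨hS', hL', fun k hk => hd' k ?_, ?_⟩
    · by_contra h
      exact hle ((hP.ratio_mono (not_lt.1 h)).trans hk)
    · simp only [sum_const, card_range, smul_eq_mul, add_assoc, Nat.reduceAdd] at ht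
      rw [secondTime]
      omega

/-- Treat all tangents. -/
def firstProg : Prog :=
  .radd 13 7 3 ;; .loop (.rle 13 8) (.rlog 14 13 ;; secondProg ;; .rmul 13 13 9)

/-- The time for all tangents. -/
def firstTime (P : Inst) : ℕ := P.J * (secondTime P + 3) + 2

theorem run_firstProg {P : Inst} {κ : ℕ} {s : State} (hP : P.Valid) (hS : Sane P s)
    (hκ : κ < P.cnt) (h10 : s.ireg 10 = κ) (h12 : s.rreg 12 = P.tau κ) :
    Run firstProg s fun s' t' => Sane P s' ∧ Le s s' ∧
      (∀ i, P.ratio i ≤ P.hi → ∀ j, P.ratio j ≤ P.hi → ∀ a t,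
        Done P κ (P.ratio i) (P.ratio j) a t s') ∧ t' ≤ firstTime P := by
  simp only [firstProg, run_seq, run_radd]
  have F₀ := Frame.radd s 13 7 3
  refine run_loop P.J (fun i s' => s'.rreg 13 = P.ratio i ∧ Sane P s' ∧ Le s s' ∧
      ∀ k < i, ∀ j, P.ratio j ≤ P.hi → ∀ a t, Done P κ (P.ratio k) (P.ratio j) a t s')
    (fun j => secondTime P + 2) ?_ ?_ ?_
  · exact ⟨by simp [hS.env.r7, hS.env.base.r3, Inst.ratio], hS.frame F₀ rfl rfl, Le.frame F₀ rfl,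
      fun a ha => absurd ha a.not_lt_zero⟩
  · rintro i s' ⟨h13, hS', hL', hd'⟩ F hle
    simp only [holds_rle, h13, hS'.env.r8] at hle
    refine ⟨hP.lt_of_ratio_le hle, ?_⟩
    simp only [run_seq, run_rlog, run_rmul]
    have e10 : s'.ireg 10 = κ := by rw [F.i 10 rfl, F₀.i 10 rfl, h10]
    have e12 : s'.rreg 12 = P.tau κ := by rw [F.r 12 rfl, F₀.r 12 rfl, h12]
    refine ⟨by rw [h13]; exact hP.lo_pos.trans_le (hP.lo_le_ratio i), ?_⟩
    have F₁ : Frame (.rlog 14 13) s' (s'.setR 14 (Real.log (s'.rreg 13))) :=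
      (Exec.rlog s' 14 13 (by rw [h13]; exact hP.lo_pos.trans_le (hP.lo_le_ratio i))).frame
    refine (run_secondProg hP (hS'.frame F₁ rfl rfl) hκ e10 (by simpa using e12) hle
      (by simpa using h13) (by simp [h13])).imp ?_
    rintro s₂ t₂ ⟨hS₂, hL₂, hd₂, ht₂⟩ F₂
    have F₃ := Frame.rmul s₂ 13 13 9
    have hL₁ : Le s' s₂ := (Le.frame F₁ rfl).trans hL₂
    have hL₃ : Le s₂ (s₂.setR 13 (s₂.rreg 13 * s₂.rreg 9)) := Le.frame F₃ rfl
    refine ⟨⟨?_, hS₂.frame F₃ rfl rfl, (hL'.trans hL₁).trans hL₃, fun k hk j hj a t => ?_⟩, by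
      omega⟩
    · simp [F₂.r 13 rfl, h13, hS₂.env.r9, Inst.ratio, pow_succ, mul_assoc]
    · rcases Nat.lt_succ_iff_lt_or_eq.1 hk with h | rfl
      · exact (hd' k h j hj a t).mono (hL₁.trans hL₃)
      · exact (hd₂ j hj a t).mono hL₃
  · rintro i s' t hj ⟨h13, hS', hL', hd'⟩ F hle ht
    simp only [holds_rle, h13, hS'.env.r8] at hle
    refine ⟨hS', hL', fun k hk => hd' k ?_, ?_⟩
    · by_contra h
      exact hle ((hP.ratio_mono (not_lt.1 h)).trans hk)
    · simp only [sum_const, card_range, smul_eq_mul, add_assoc, Nat.reduceAdd] at ht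
      rw [firstTime]
      omega

/-- Treat all starting times. -/
def timesProg : Prog :=
  .iconst 10 0 ;; .loop (.ilt 10 4) (.rload 12 4 10 ;; firstProg ;; .iadd 10 10 2)

/-- The results dominate all supported regions. -/
def AllDone (P : Inst) (s : State) : Prop :=
  ∀ κ < P.cnt, ∀ i, P.ratio i ≤ P.hi → ∀ j, P.ratio j ≤ P.hi → ∀ a t,
    Done P κ (P.ratio i) (P.ratio j) a t s

theorem run_timesProg {P : Inst} {s : State} (hP : P.Valid) (hS : Sane P s) :
    Run timesProg s fun s' t' => Sane P s' ∧ AllDone P s' ∧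
      t' ≤ P.cnt * (firstTime P + 3) + 2 := by
  simp only [timesProg, run_seq, run_iconst]
  have F₀ := Frame.iconst s 10 0
  refine run_loop P.cnt (fun κ s' => s'.ireg 10 = κ ∧ Sane P s' ∧
      ∀ k < κ, ∀ i, P.ratio i ≤ P.hi → ∀ j, P.ratio j ≤ P.hi → ∀ a t,
        Done P k (P.ratio i) (P.ratio j) a t s')
    (fun j => firstTime P + 2) ?_ ?_ ?_
  · exact ⟨by simp, hS.frame F₀ rfl rfl, fun a ha => absurd ha a.not_lt_zero⟩
  · rintro κ s' ⟨h10, hS', hd'⟩ F hlt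
    simp only [holds_ilt, h10, hS'.env.i4] at hlt
    refine ⟨hlt, ?_⟩
    simp only [run_seq, run_rload, run_iadd]
    have F₁ := (Exec.rload s' 12 4 10).frame
    refine (run_firstProg hP (hS'.frame F₁ rfl rfl) hlt h10 (by simp [hS'.env.tau, h10])).imp ?_
    rintro s₂ t₂ ⟨hS₂, hL₂, hd₂, ht₂⟩ F₂
    have F₃ := Frame.iadd s₂ 10 10 2
    have hL₁ : Le s' s₂ := (Le.frame F₁ rfl).trans hL₂
    have hL₃ : Le s₂ (s₂.setI 10 (s₂.ireg 10 + s₂.ireg 2)) := Le.frame F₃ rfl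
    refine ⟨⟨?_, hS₂.frame F₃ rfl rfl, fun k hk i hi j hj a t => ?_⟩, by omega⟩
    · simp [F₂.i 10 rfl, h10, hS₂.env.base.i2]
    · rcases Nat.lt_succ_iff_lt_or_eq.1 hk with h | rfl
      · exact (hd' k h i hi j hj a t).mono (hL₁.trans hL₃)
      · exact (hd₂ i hi j hj a t).mono hL₃
  · rintro κ s' t hj ⟨h10, hS', hd'⟩ F hlt ht
    simp only [holds_ilt, h10, hS'.env.i4] at hlt
    refine ⟨hS', fun k hk => hd' k (by omega), ?_⟩
    simp only [sum_const, card_range, smul_eq_mul, add_assoc, Nat.reduceAdd] at ht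
    omega

/-- Search the best strip exhaustively. -/
def winnerProg : Prog :=
  .rload 12 4 20 ;; .iadd 11 21 1 ;; .iadd 13 22 1 ;; .isub 12 22 2 ;; colSumProg ;; bruteProg

/-- The record guarantees only that some region in the recorded strip has a discrepancy of at least
the linear value; the machine does not know that region. The exhaustive search of the strip finds
one that is at least as good. -/
theorem run_winnerProg {P : Inst} {s : State} (hP : P.Valid) (hS : Sane P s) :
    Run winnerProg s fun s' t' => Res P s' ∧ s.rreg 21 ≤ s'.rreg 21 ∧
      (-(3 * P.bound) < s.rreg 20 → s.rreg 20 ≤ s'.rreg 21 ∧ 0 ≤ s'.rreg 21) ∧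
      t' ≤ bruteTime P.h + 10 * 2 ^ P.h + 20 * P.n + 24 := by
  have hE := hS.env
  simp only [winnerProg, run_seq, run_rload, run_iadd, run_isub, State.setI_ireg, State.setR_ireg,
    Nat.reduceEqDiff, reduceIte, hE.base.i1, hE.base.i2, add_zero, hE.tau]
  set s₀ := (((s.setR 12 (P.tau (s.ireg 20))).setI 11 (s.ireg 21)).setI 13 (s.ireg 22)).setI 12
    (s.ireg 22 - 1) with hs₀
  have i11 : s₀.ireg 11 = s.ireg 21 := by simp [hs₀]
  have i12 : s₀.ireg 12 = s.ireg 22 - 1 := by simp [hs₀]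
  have i13 : s₀.ireg 13 = s.ireg 22 := by simp [hs₀]
  have r12 : s₀.rreg 12 = P.tau (s.ireg 20) := by simp [hs₀]
  have eI : ∀ x, x ≠ 11 → x ≠ 12 → x ≠ 13 → s₀.ireg x = s.ireg x := fun x h₁ h₂ h₃ => by
    simp [hs₀, h₁, h₂, h₃]
  have eR : ∀ x, x ≠ 12 → s₀.rreg x = s.rreg x := fun x h => by simp [hs₀, h]
  have hE₀ : Env P s₀ := hE.of_eq (fun x hx => eI x (by omega) (by omega) (by omega))
    (fun x _ _ _ => eR x (by omega)) rfl rfl fun _ _ _ => rfl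
  have hR₀ : Res P s₀ := hS.res.of_eq (fun x _ _ => eI x (by omega) (by omega) (by omega))
    fun x _ _ => eR x (by omega)
  have h22 : s.ireg 22 ≤ P.n := by
    rcases hS.res.lin with h | ⟨κ, a, t, l, r, hT, -, -, h, -⟩
    · omega
    · have := hT.lt; omega
  refine (run_colSumProg (s := s₀) hP.pts hE₀.arr hE₀.base (by rw [i13]; exact h22)).imp ?_
  rintro s₁ t₁ ⟨hC, ht₁⟩ F₁
  rw [i11, i13, r12] at hC
  have hE₁ : Env P s₁ := hE₀.frame F₁ rfl
  have hR₁ : Res P s₁ := hR₀.frame F₁ rfl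
  have j11 : s₁.ireg 11 = s.ireg 21 := (F₁.i 11 rfl).trans i11
  have j12 : s₁.ireg 12 = s.ireg 22 - 1 := (F₁.i 12 rfl).trans i12
  have q12 : s₁.rreg 12 = P.tau (s.ireg 20) := (F₁.r 12 rfl).trans r12
  have e21 : s₁.rreg 21 = s.rreg 21 := (F₁.r 21 rfl).trans (eR 21 (by norm_num))
  rcases hS.res.lin with ⟨h20, h21, h22⟩ | ⟨κ, a, t, l, r, hT, hκ, ha, ht, hl, hlr, hr, hs, hle⟩
  -- Without a record the registers describe the empty strip. All column sums are zero there, so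
  -- nothing is supported and the results stay as they were.
  · rw [h21, h22] at hC
    have hz : ∀ f : ℕ → ℝ, colSum f P.col (alive P.ts (P.tau (s.ireg 20)) 0 0) = fun _ => 0 :=
      fun f => by funext c; simp [colSum, alive]
    refine (run_bruteProg (h := P.h) (c := P.c) (thr := P.thr) (M := fun _ => 0) (B := fun _ => 0)
      ⟨hE₁.base, hE₁.r4, hE₁.r1, hE₁.r5, hE₁.r6, fun x hx => by rw [hC.M x hx, hz],
        fun x hx => by rw [hC.B x hx, hz], rfl, rfl, rfl, rfl, rfl⟩ hP.thr_pos).imp ?_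
    rintro s₂ t₂ ⟨hOK, ht₂⟩ F₂
    rcases hOK.sound with h | ⟨l, r, -, -, -, -, hsup, -⟩
    · refine ⟨hR₁.of_eq (fun x h₁ h₂ => ?_) fun x h₁ h₂ => ?_, ?_, fun h => ?_, ?_⟩
      · interval_cases x <;> exact F₂.i _ rfl
      · rcases Nat.eq_or_lt_of_le h₁ with rfl | h₁
        · exact F₂.r 20 rfl
        · exact h x h₁ h₂
      · rw [h 21 (by norm_num) (by norm_num), e21]
      · exact absurd h20 h.ne'
      · rw [bruteTime]; omega
    · have := hsup.m_ge
      rw [seg, sum_const_zero] at this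
      exact absurd hP.thr_pos (not_lt.2 this)
  · rw [hκ, ha, ht] at hC
    refine (run_bruteStrip (t := t) hP hE₁ (j11.trans ha) (by omega) (q12.trans (by rw [hκ])) hT.lt
      hT hC.M hC.B hR₁).mono ?_
    rintro s₂ t₂ ⟨hR₂, hL₂, hd₂, ht₂⟩
    have := hd₂ l r hl hlr hr hs
    exact ⟨hR₂, e21 ▸ hL₂.disc, fun _ => ⟨hle.trans this, (hs.disc_nonneg hP).trans this⟩, by
      rw [bruteTime]; omega⟩

/-- Search the best strip exhaustively, and output the result. -/
def finalProg : Prog :=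
  winnerProg ;;
  -- Register 3 provides the zero for copying, so it is overwritten last.
  .radd 4 25 3 ;; .radd 5 26 3 ;; .radd 0 21 3 ;; .radd 1 22 3 ;; .radd 2 23 3 ;; .radd 3 24 3

/-- A sufficiently supported region in the output registers. -/
structure Found (P : Inst) (κ a t l r : ℕ) (s : State) : Prop where
  strip : P.Strip κ a t
  le : l ≤ r
  lt : r < 2 ^ P.h
  left : 0 < P.M κ a (t + 1) l
  right : 0 < P.M κ a (t + 1) r
  sup : P.Sup κ a (t + 1) l r
  r0 : s.rreg 0 = P.disc κ a (t + 1) l r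
  r1 : s.rreg 1 = P.xc l
  r2 : s.rreg 2 = P.ys a
  r3 : s.rreg 3 = P.xc r
  r4 : s.rreg 4 = P.ys t
  r5 : s.rreg 5 = P.tau κ

theorem run_finalProg {P : Inst} {s : State} (hP : P.Valid) (hS : Sane P s) :
    Run finalProg s fun s' t' => (s'.rreg 0 = -1 ∨ ∃ κ a t l r, Found P κ a t l r s') ∧
      s.rreg 21 ≤ s'.rreg 0 ∧ (-(3 * P.bound) < s.rreg 20 → s.rreg 20 ≤ s'.rreg 0 ∧ 0 ≤ s'.rreg 0) ∧
      t' ≤ bruteTime P.h + 10 * 2 ^ P.h + 20 * P.n + 30 := by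
  rw [finalProg, run_seq]
  refine (run_winnerProg hP hS).imp ?_
  rintro s₁ t₁ ⟨hR, h₁, h₂, ht⟩ F
  have r3 : s₁.rreg 3 = 0 := (F.r 3 rfl).trans hS.env.base.r3
  simp only [run_seq, run_radd, State.setR_rreg, Nat.reduceEqDiff, reduceIte, r3, add_zero]
  refine ⟨?_, h₁, h₂, by omega⟩
  rcases hR.disc with h | ⟨κ, a, t, l, r, a₁, a₂, a₃, a₄, a₅, a₆, a₇, a₈, a₉, b₁, b₂, b₃⟩
  · exact .inl h
  · exact .inr ⟨κ, a, t, l, r, a₁, a₂, a₃, a₄, a₅, a₆, by simpa using a₇, by simpa using a₈,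
      by simpa using a₉, by simpa using b₁, by simpa using b₂, by simpa using b₃⟩

/-- Search for a region of almost maximal discrepancy. -/
def searchProg : Prog := timesProg ;; finalProg

/-- The time for the search. -/
def searchTime (P : Inst) : ℕ :=
  P.cnt * (firstTime P + 3) + bruteTime P.h + 10 * 2 ^ P.h + 20 * P.n + 32

/-- For a supported region, take the grid values just below its two ratios. Either an exhaustive
search has already covered the region, or the linear record is at least its tangent value, which is
within `c * (g - 1) ^ 2 ≤ ε` of its discrepancy. In the latter case `neg_lt_tangent` shows that the
record is genuine, and the final search of its strip yields at least the record. -/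
theorem run_searchProg {P : Inst} {s : State} (hP : P.Valid) (hS : Sane P s) {ε : ℝ}
    (hε : 0 ≤ ε) (hg : ∀ ρ, P.lo ≤ ρ → ρ ≤ P.hi → ∃ j, P.ratio j ≤ ρ ∧ ρ ≤ P.ratio (j + 1))
    (hgε : P.c * (P.g - 1) ^ 2 ≤ ε)
    (hratio : ∀ κ a t l r, t < P.n → P.Sup κ a (t + 1) l r →
      (P.lo ≤ seg (P.B κ a (t + 1)) l (r + 1) / seg (P.M κ a (t + 1)) l (r + 1) ∧
        seg (P.B κ a (t + 1)) l (r + 1) / seg (P.M κ a (t + 1)) l (r + 1) ≤ P.hi) ∧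
      P.lo ≤ (1 - seg (P.B κ a (t + 1)) l (r + 1)) / (1 - seg (P.M κ a (t + 1)) l (r + 1)) ∧
        (1 - seg (P.B κ a (t + 1)) l (r + 1)) / (1 - seg (P.M κ a (t + 1)) l (r + 1)) ≤ P.hi) :
    Run searchProg s fun s' t' => t' ≤ searchTime P ∧
      ((∃ κ a t l r, P.Strip κ a t ∧ 0 < l ∧ l ≤ r ∧ r < 2 ^ P.h ∧ P.Sup κ a (t + 1) l r) →
        ∃ κ a t l r, Found P κ a t l r s') ∧
      ∀ κ a t l r, P.Strip κ a t → 0 < l → l ≤ r → r < 2 ^ P.h → P.Sup κ a (t + 1) l r →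
        P.disc κ a (t + 1) l r ≤ s'.rreg 0 + ε := by
  rw [searchProg, run_seq]
  refine (run_timesProg hP hS).mono ?_
  rintro s₁ t₁ ⟨hS₁, hd, ht₁⟩
  refine (run_finalProg hP hS₁).mono ?_
  rintro s₂ t₂ ⟨hf, h₁, h₂, ht₂⟩
  -- The second claim rules out the initial value -1, which would mean that no region was found.
  have key : ∀ κ a t l r, P.Strip κ a t → 0 < l → l ≤ r → r < 2 ^ P.h → P.Sup κ a (t + 1) l r →
      P.disc κ a (t + 1) l r ≤ s₂.rreg 0 + ε ∧ -1 < s₂.rreg 0 := by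
    intro κ a t l r hT hl hlr hr hs
    obtain ⟨⟨c₁, c₂⟩, c₃, c₄⟩ := hratio κ a t l r hT.lt hs
    obtain ⟨i, i₁, i₂⟩ := hg _ c₁ c₂
    obtain ⟨j, j₁, j₂⟩ := hg _ c₃ c₄
    have hb := hs.bounds hP
    have hi := i₁.trans c₂
    have hj := j₁.trans c₄
    have hpos : ∀ k, 0 < P.ratio k := fun k => hP.lo_pos.trans_le (hP.lo_le_ratio k)
    have hsucc : ∀ k, P.ratio (k + 1) = P.ratio k * (1 + (P.g - 1)) := fun k => by
      rw [Inst.ratio, Inst.ratio, pow_succ]; ring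
    rcases hd κ hT.κ_lt i hi j hj a t hT l r hl hlr hr hs with h | h
    · have := hs.disc_nonneg hP
      exact ⟨by linarith, by linarith⟩
    · have h₃ := neg_lt_tangent hP.c_pos hP.lo_pos hP.lo_le hP.le_hi (hP.lo_le_ratio i) hi
        (hP.lo_le_ratio j) hj hb.1 hb.2.1 hb.2.2.1 hb.2.2.2
      have h₄ := h₂ (h₃.trans_le h)
      have h₅ := le_tangent hP.c_pos (hpos i) (hpos j) hb.1 hb.2.1 hb.2.2.1 hb.2.2.2 i₁
        (i₂.trans_eq (hsucc i)) j₁ (j₂.trans_eq (hsucc j))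
      exact ⟨by rw [Inst.disc]; linarith [h₄.1], by linarith [h₄.2]⟩
  refine ⟨by rw [searchTime]; omega, ?_, fun κ a t l r a₁ a₂ a₃ a₄ a₅ =>
    (key κ a t l r a₁ a₂ a₃ a₄ a₅).1⟩
  rintro ⟨κ, a, t, l, r, a₁, a₂, a₃, a₄, a₅⟩
  exact hf.resolve_left (key κ a t l r a₁ a₂ a₃ a₄ a₅).2.ne'

end RealRAM

/-! ### Preprocessing -/

/-- The rank of point `i` in the order by second coordinate. -/
noncomputable def yPos (n : ℕ) (y : ℕ → ℝ) (i : ℕ) : ℕ :=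
  #{j ∈ range n | y j < y i ∨ y j = y i ∧ j < i}

/-- The column of point `i`. -/
noncomputable def xCol (n : ℕ) (x : ℕ → ℝ) (i : ℕ) : ℕ := #{j ∈ range n | x j < x i} + 1

theorem card_filter_range_succ (p : ℕ → Prop) [DecidablePred p] (j : ℕ) :
    #{i ∈ range (j + 1) | p i} = #{i ∈ range j | p i} + if p j then 1 else 0 := by
  rw [range_add_one, filter_insert]
  split_ifs
  · rw [card_insert_of_notMem (by simp)]
  · rfl

theorem yPos_lt {n : ℕ} {y : ℕ → ℝ} {i : ℕ} (hi : i < n) : yPos n y i < n := by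
  refine (card_lt_card ?_).trans_eq (card_range n)
  refine ⟨filter_subset _ _, fun h => ?_⟩
  simpa using (mem_filter.1 (h (mem_range.2 hi))).2

theorem yPos_lt_yPos {n : ℕ} {y : ℕ → ℝ} {i j : ℕ} (hi : i < n)
    (h : y i < y j ∨ y i = y j ∧ i < j) : yPos n y i < yPos n y j := by
  refine card_lt_card ⟨fun k hk => ?_, fun h' => ?_⟩
  · obtain ⟨hk, h'⟩ := mem_filter.1 hk
    refine mem_filter.2 ⟨hk, ?_⟩
    rcases h with h | ⟨h, hij⟩
    · rcases h' with h' | ⟨h', -⟩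
      · exact .inl (h'.trans h)
      · exact .inl (h' ▸ h)
    · rcases h' with h' | ⟨h', hki⟩
      · exact .inl (h ▸ h')
      · exact .inr ⟨h'.trans h, hki.trans hij⟩
  · simpa using (mem_filter.1 (h' (mem_filter.2 ⟨mem_range.2 hi, h⟩))).2

/-- Ties are broken by the index, so the rank is a permutation of the points. Columns, by contrast,
merge the points with equal first coordinates. -/
theorem yPos_inj {n : ℕ} {y : ℕ → ℝ} {i j : ℕ} (hi : i < n) (hj : j < n)
    (h : yPos n y i = yPos n y j) : i = j := by
  by_contra hij
  rcases lt_trichotomy (y i) (y j) with h' | h' | h'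
  · exact (yPos_lt_yPos hi (.inl h')).ne h
  · rcases lt_or_gt_of_ne hij with h'' | h''
    · exact (yPos_lt_yPos hi (.inr ⟨h', h''⟩)).ne h
    · exact (yPos_lt_yPos hj (.inr ⟨h'.symm, h''⟩)).ne' h
  · exact (yPos_lt_yPos hj (.inl h')).ne' h

theorem xCol_le {n : ℕ} {x : ℕ → ℝ} {i : ℕ} (hi : i < n) : xCol n x i ≤ n := by
  refine Nat.succ_le_of_lt ((card_lt_card ?_).trans_eq (card_range n))
  refine ⟨filter_subset _ _, fun h => ?_⟩
  simpa using (mem_filter.1 (h (mem_range.2 hi))).2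

theorem xCol_lt_xCol {n : ℕ} {x : ℕ → ℝ} {i j : ℕ} (hi : i < n) (h : x i < x j) :
    xCol n x i < xCol n x j := by
  refine Nat.succ_lt_succ (card_lt_card ⟨fun k hk => ?_, fun h' => ?_⟩)
  · obtain ⟨hk, h'⟩ := mem_filter.1 hk
    exact mem_filter.2 ⟨hk, h'.trans h⟩
  · simpa using (mem_filter.1 (h' (mem_filter.2 ⟨mem_range.2 hi, h⟩))).2

theorem xCol_le_xCol {n : ℕ} {x : ℕ → ℝ} {i j : ℕ} (hi : i < n) (hj : j < n) :
    xCol n x i ≤ xCol n x j ↔ x i ≤ x j := by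
  refine ⟨fun h => ?_, fun h => ?_⟩
  · by_contra hlt
    exact absurd (xCol_lt_xCol hj (not_le.1 hlt)) (not_lt.2 h)
  · rcases h.lt_or_eq with h | h
    · exact (xCol_lt_xCol hi h).le
    · rw [xCol, xCol, h]

theorem xCol_inj {n : ℕ} {x : ℕ → ℝ} {i j : ℕ} (hi : i < n) (hj : j < n)
    (h : xCol n x i = xCol n x j) : x i = x j :=
  le_antisymm ((xCol_le_xCol hi hj).1 h.le) ((xCol_le_xCol hj hi).1 h.ge)

namespace RealRAM

/-- Rank point `I 30`. -/
def rankProg : Prog :=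
  .rload 31 0 30 ;; .rload 32 1 30 ;; .iconst 31 0 ;; .iconst 32 0 ;; .iconst 33 1 ;;
  .loop (.ilt 31 0) (.rload 33 0 31 ;; .rload 34 1 31 ;;
    .cond (.rlt 33 31) (.iadd 33 33 2) .skip ;;
    .cond (.rlt 34 32) (.iadd 32 32 2)
      (.cond (.rle 34 32) (.cond (.ilt 31 30) (.iadd 32 32 2) .skip) .skip) ;;
    .iadd 31 31 2)

/-- Ranks are found by counting, in time O(n) per point. The total O(n^2) is within the budget, so a
faster sorting method is not needed. -/
theorem run_rankProg {s : State} {n i : ℕ} (h0 : s.ireg 0 = n) (h2 : s.ireg 2 = 1)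
    (hi : s.ireg 30 = i) :
    Run rankProg s fun s' t => s'.ireg 32 = yPos n (s.rarr 1) i ∧
      s'.ireg 33 = xCol n (s.rarr 0) i ∧ s'.rreg 31 = s.rarr 0 i ∧ s'.rreg 32 = s.rarr 1 i ∧
      t ≤ 10 * n + 10 := by
  simp only [rankProg, run_seq, run_rload, run_iconst, State.setR_ireg, State.setR_rarr, hi]
  refine run_loop n (fun j s' => s'.ireg 31 = j ∧ j ≤ n ∧ s'.rreg 31 = s.rarr 0 i ∧
    s'.rreg 32 = s.rarr 1 i ∧
    s'.ireg 32 = #{k ∈ range j | s.rarr 1 k < s.rarr 1 i ∨ s.rarr 1 k = s.rarr 1 i ∧ k < i} ∧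
    s'.ireg 33 = #{k ∈ range j | s.rarr 0 k < s.rarr 0 i} + 1) (fun _ => 9) ?_ ?_ ?_
  · simp
  · rintro j s' ⟨h31, hj, r31, r32, h32, h33⟩ F hlt
    have e0 : s'.ireg 0 = n := by rw [F.i 0 rfl]; simpa using h0
    have e2 : s'.ireg 2 = 1 := by rw [F.i 2 rfl]; simpa using h2
    have e30 : s'.ireg 30 = i := by rw [F.i 30 rfl]; simpa using hi
    have a0 : s'.rarr 0 = s.rarr 0 := by rw [F.ra 0 rfl]; simp
    have a1 : s'.rarr 1 = s.rarr 1 := by rw [F.ra 1 rfl]; simp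
    simp only [holds_ilt, h31, e0] at hlt
    refine ⟨hlt, ?_⟩
    rw [card_filter_range_succ, card_filter_range_succ]
    simp only [run_seq, run_rload, run_cond, run_iadd, run_skip, holds_rlt, holds_rle, holds_ilt,
      State.setR_ireg, State.setR_rreg, State.setR_rarr, State.setI_ireg, State.setI_rreg,
      Nat.reduceEqDiff, reduceIte, h31, a0, a1, r31, r32, e30, e2, h32, h33]
    have hle : ∀ {u v : ℝ}, ¬ u < v → (u ≤ v ↔ u = v) := fun h =>
      ⟨fun h' => le_antisymm h' (not_lt.1 h), fun h' => h'.le⟩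
    refine ⟨fun hx => ⟨fun hy => ?_, fun hy => ⟨fun hy' => ⟨fun hk => ?_, fun hk => ?_⟩, fun hy' => ?_⟩⟩,
      fun hx => ⟨fun hy => ?_, fun hy => ⟨fun hy' => ⟨fun hk => ?_, fun hk => ?_⟩, fun hy' => ?_⟩⟩⟩ <;>
    first
    | (simp only [hle hy] at hy'; simp [hx, hy, hy']; omega)
    | (simp [hx, hy]; omega)
  · rintro j s' t hj ⟨h31, hj', r31, r32, h32, h33⟩ F hlt ht
    have e0 : s'.ireg 0 = n := by rw [F.i 0 rfl]; simpa using h0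
    simp only [holds_ilt, h31, e0, not_lt] at hlt
    obtain rfl : j = n := by omega
    simp only [sum_const, card_range, smul_eq_mul] at ht
    exact ⟨h32, h33, r31, r32, by omega⟩

end RealRAM

/-- The columns of the input. -/
structure Raw where
  /-- number of points -/
  n : ℕ
  /-- first coordinates -/
  x : ℕ → ℝ
  /-- second coordinates -/
  y : ℕ → ℝ
  /-- time stamps -/
  t : ℕ → ℝ
  /-- measurements -/
  m : ℕ → ℝ
  /-- baseline weights -/
  b : ℕ → ℝ

namespace Raw

variable (W : Raw)

/-- The position of a point in the order by second coordinate. -/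
noncomputable def pos (i : ℕ) : ℕ := yPos W.n W.y i

/-- The column of a point. -/
noncomputable def col (i : ℕ) : ℕ := xCol W.n W.x i

/-- The normalized measurement. -/
noncomputable def mN (i : ℕ) : ℝ := W.m i / ∑ j ∈ range W.n, W.m j

/-- The normalized baseline weight. -/
noncomputable def bN (i : ℕ) : ℝ := W.b i / ∑ j ∈ range W.n, W.b j

/-- The weights are positive. -/
structure Pos : Prop where
  n_pos : 0 < W.n
  m_pos : ∀ i < W.n, 0 < W.m i
  b_pos : ∀ i < W.n, 0 < W.b i

variable {W}

theorem Pos.sum_m (hW : W.Pos) : 0 < ∑ j ∈ range W.n, W.m j :=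
  sum_pos (fun i hi => hW.m_pos i (mem_range.1 hi)) ⟨0, mem_range.2 hW.n_pos⟩

theorem Pos.sum_b (hW : W.Pos) : 0 < ∑ j ∈ range W.n, W.b j :=
  sum_pos (fun i hi => hW.b_pos i (mem_range.1 hi)) ⟨0, mem_range.2 hW.n_pos⟩

theorem Pos.mN_pos (hW : W.Pos) {i : ℕ} (hi : i < W.n) : 0 < W.mN i :=
  div_pos (hW.m_pos i hi) hW.sum_m

theorem Pos.bN_pos (hW : W.Pos) {i : ℕ} (hi : i < W.n) : 0 < W.bN i :=
  div_pos (hW.b_pos i hi) hW.sum_b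

end Raw

/-! ### Normalising and sorting the input -/

namespace RealRAM

/-- The machine holds the raw input. -/
structure Holds (W : Raw) (s : State) : Prop where
  i0 : s.ireg 0 = W.n
  i2 : s.ireg 2 = 1
  r3 : s.rreg 3 = 0
  x : ∀ i < W.n, s.rarr 0 i = W.x i
  y : ∀ i < W.n, s.rarr 1 i = W.y i
  m : ∀ i < W.n, s.rarr 3 i * s.rarr 2 i = W.m i
  b : ∀ i < W.n, s.rarr 3 i = W.b i
  t : ∀ i < W.n, s.rarr 4 i = W.t i

theorem Holds.frame {W : Raw} {s s' : State} {p : Prog} (hH : Holds W s) (F : Frame p s s')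
    (h : (p.wi 0 || p.wi 2 || p.wr 3 || p.wra 0 || p.wra 1 || p.wra 2 || p.wra 3 || p.wra 4)
      = false) : Holds W s' := by
  simp only [Bool.or_eq_false_iff, and_assoc] at h
  obtain ⟨a0, a2, a3, b0, b1, b2, b3, b4⟩ := h
  exact ⟨(F.i 0 a0).trans hH.i0, (F.i 2 a2).trans hH.i2, (F.r 3 a3).trans hH.r3, F.ra 0 b0 ▸ hH.x,
    F.ra 1 b1 ▸ hH.y, by rw [F.ra 2 b2, F.ra 3 b3]; exact hH.m, F.ra 3 b3 ▸ hH.b, F.ra 4 b4 ▸ hH.t⟩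

/-- The total weights. -/
def totalsProg : Prog :=
  .rconst 35 0 ;; .rconst 36 0 ;; .iconst 30 0 ;;
  .loop (.ilt 30 0) (.rload 33 3 30 ;; .rload 34 2 30 ;; .rmul 34 33 34 ;; .radd 35 35 34 ;;
    .radd 36 36 33 ;; .iadd 30 30 2)

theorem run_totalsProg {W : Raw} {s : State} (hH : Holds W s) :
    Run totalsProg s fun s' t => s'.rreg 35 = ∑ j ∈ range W.n, W.m j ∧
      s'.rreg 36 = ∑ j ∈ range W.n, W.b j ∧ t ≤ 7 * W.n + 4 := by
  simp only [totalsProg, run_seq, run_rconst, run_iconst, Rat.cast_zero]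
  refine run_loop W.n (fun j s' => s'.ireg 30 = j ∧ s'.rreg 35 = ∑ i ∈ range j, W.m i ∧
    s'.rreg 36 = ∑ i ∈ range j, W.b i) (fun _ => 6) ?_ ?_ ?_
  · simp
  · rintro j s' ⟨h30, h35, h36⟩ F hlt
    have e0 : s'.ireg 0 = W.n := by rw [F.i 0 rfl]; simpa using hH.i0
    have e2 : s'.ireg 2 = 1 := by rw [F.i 2 rfl]; simpa using hH.i2
    have a2 : s'.rarr 2 = s.rarr 2 := by rw [F.ra 2 rfl]; simp
    have a3 : s'.rarr 3 = s.rarr 3 := by rw [F.ra 3 rfl]; simp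
    simp only [holds_ilt, h30, e0] at hlt
    refine ⟨hlt, ?_⟩
    have := hH.m j hlt
    have := hH.b j hlt
    simp_all [sum_range_succ]
  · rintro j s' t hj ⟨h30, h35, h36⟩ F hlt ht
    have e0 : s'.ireg 0 = W.n := by rw [F.i 0 rfl]; simpa using hH.i0
    simp only [holds_ilt, h30, e0, not_lt] at hlt
    obtain rfl : j = W.n := by omega
    simp only [sum_const, card_range, smul_eq_mul] at ht
    exact ⟨h35, h36, by omega⟩

/-- Enter point `I 30` into the sorted arrays. -/
def storeProg : Prog :=
  .istore 0 32 33 ;; .rstore 5 32 32 ;; .rstore 9 33 31 ;; .rload 33 4 30 ;; .rstore 8 32 33 ;;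
  .rload 33 3 30 ;; .rload 34 2 30 ;; .rmul 34 33 34 ;; .rdiv 34 34 35 ;; .rdiv 33 33 36 ;;
  .rstore 6 32 34 ;; .rstore 7 32 33 ;; .rdiv 37 33 34 ;;
  .cond (.rlt 37 7) (.radd 7 37 3) .skip ;; .cond (.rlt 8 37) (.radd 8 37 3) .skip

/-- The first `j` points have been entered into the sorted arrays. -/
structure Sorted (W : Raw) (j : ℕ) (s : State) : Prop where
  col : ∀ i < j, s.iarr 0 (W.pos i) = W.col i
  y : ∀ i < j, s.rarr 5 (W.pos i) = W.y i
  m : ∀ i < j, s.rarr 6 (W.pos i) = W.mN i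
  b : ∀ i < j, s.rarr 7 (W.pos i) = W.bN i
  t : ∀ i < j, s.rarr 8 (W.pos i) = W.t i
  x : ∀ i < j, s.rarr 9 (W.col i) = W.x i
  lo : ∀ i < j, s.rreg 7 ≤ W.bN i / W.mN i
  hi : ∀ i < j, W.bN i / W.mN i ≤ s.rreg 8
  lo_eq : s.rreg 7 = 1 ∨ ∃ i < j, s.rreg 7 = W.bN i / W.mN i
  hi_eq : s.rreg 8 = 1 ∨ ∃ i < j, s.rreg 8 = W.bN i / W.mN i
  lo_le : s.rreg 7 ≤ 1
  le_hi : 1 ≤ s.rreg 8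

theorem Sorted.of_eq {W : Raw} {j : ℕ} {s s' : State} (h : Sorted W j s)
    (h0 : s'.iarr 0 = s.iarr 0) (hra : ∀ x, 5 ≤ x → x ≤ 9 → s'.rarr x = s.rarr x)
    (h7 : s'.rreg 7 = s.rreg 7) (h8 : s'.rreg 8 = s.rreg 8) : Sorted W j s' := by
  obtain ⟨a₁, a₂, a₃, a₄, a₅, a₆, a₇, a₈, a₉, b₁, b₂, b₃⟩ := h
  constructor
  · rwa [h0]
  · rwa [hra 5 (by norm_num) (by norm_num)]
  · rwa [hra 6 (by norm_num) (by norm_num)]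
  · rwa [hra 7 (by norm_num) (by norm_num)]
  · rwa [hra 8 (by norm_num) (by norm_num)]
  · rwa [hra 9 (by norm_num) (by norm_num)]
  all_goals simpa only [h7, h8]

theorem Sorted.frame {W : Raw} {j : ℕ} {s s' : State} {p : Prog} (h : Sorted W j s)
    (F : Frame p s s') (hp : (p.wia 0 || p.wra 5 || p.wra 6 || p.wra 7 || p.wra 8 || p.wra 9 ||
      p.wr 7 || p.wr 8) = false) : Sorted W j s' := by
  simp only [Bool.or_eq_false_iff, and_assoc] at hp
  obtain ⟨a0, a5, a6, a7, a8, a9, b7, b8⟩ := hp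
  refine h.of_eq (F.ia 0 a0) (fun x hx hx' => F.ra x ?_) (F.r 7 b7) (F.r 8 b8)
  interval_cases x <;> assumption

theorem update_pos {W : Raw} {α : Type*} {f : ℕ → α} {g : ℕ → α} {j : ℕ} (hj : j < W.n)
    (h : ∀ i < j, f (W.pos i) = g i) :
    ∀ i < j + 1, Function.update f (W.pos j) (g j) (W.pos i) = g i := fun i hi => by
  rcases Nat.lt_succ_iff_lt_or_eq.1 hi with h' | rfl
  · rw [Function.update_of_ne, h i h']
    exact fun e => h'.ne (yPos_inj (by omega) hj e)
  · rw [Function.update_self]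

/-- The entry of a column may be written several times, but always with the same coordinate. -/
theorem update_col {W : Raw} {f : ℕ → ℝ} {j : ℕ} (hj : j < W.n)
    (h : ∀ i < j, f (W.col i) = W.x i) :
    ∀ i < j + 1, Function.update f (W.col j) (W.x j) (W.col i) = W.x i := fun i hi => by
  by_cases hc : W.col i = W.col j
  · rw [hc, Function.update_self]
    exact (xCol_inj (by omega) hj hc).symm
  · rw [Function.update_of_ne hc]
    refine h i (lt_of_le_of_ne (by omega) ?_)
    rintro rfl
    exact hc rfl

/-- Registers 7 and 8 keep the minimum and the maximum of the ratios of the normalised weights. They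
start at 1, which gives `lo ≤ 1 ≤ hi`, as required for the bounds on the tangents. -/
theorem run_storeProg {W : Raw} (hW : W.Pos) {s : State} {j : ℕ} (hH : Holds W s)
    (h30 : s.ireg 30 = j) (hj : j < W.n) (h32 : s.ireg 32 = W.pos j) (h33 : s.ireg 33 = W.col j)
    (r31 : s.rreg 31 = W.x j) (r32 : s.rreg 32 = W.y j)
    (r35 : s.rreg 35 = ∑ j ∈ range W.n, W.m j) (r36 : s.rreg 36 = ∑ j ∈ range W.n, W.b j)
    (hS : Sorted W j s) :
    Run storeProg s fun s' t => Sorted W (j + 1) s' ∧ t ≤ 20 := by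
  have hm : W.b j * s.rarr 2 j = W.m j := by rw [← hH.b j hj]; exact hH.m j hj
  simp only [storeProg, run_seq, run_istore, run_rstore, run_rload, run_rmul, run_rdiv, run_radd,
    run_cond, run_skip, holds_rlt, State.setR_ireg, State.setR_rreg, State.setR_rarr,
    State.setIArr_ireg, State.setIArr_rreg, State.setIArr_rarr, State.setRArr_ireg,
    State.setRArr_rreg, State.setRArr_rarr, Nat.reduceEqDiff, reduceIte, h30, h32, h33, r31, r32,
    r35, r36, hH.b j hj, hm, hH.t j hj, hH.r3, add_zero]
  have em : W.m j / ∑ j ∈ range W.n, W.m j = W.mN j := rfl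
  have eb : W.b j / ∑ j ∈ range W.n, W.b j = W.bN j := rfl
  rw [em, eb]
  have key : ∀ s' : State, s'.iarr 0 = Function.update (s.iarr 0) (W.pos j) (W.col j) →
      s'.rarr 5 = Function.update (s.rarr 5) (W.pos j) (W.y j) →
      s'.rarr 6 = Function.update (s.rarr 6) (W.pos j) (W.mN j) →
      s'.rarr 7 = Function.update (s.rarr 7) (W.pos j) (W.bN j) →
      s'.rarr 8 = Function.update (s.rarr 8) (W.pos j) (W.t j) →
      s'.rarr 9 = Function.update (s.rarr 9) (W.col j) (W.x j) →
      s'.rreg 7 = min (s.rreg 7) (W.bN j / W.mN j) →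
      s'.rreg 8 = max (s.rreg 8) (W.bN j / W.mN j) → Sorted W (j + 1) s' := by
    intro s' a₀ a₅ a₆ a₇ a₈ a₉ b₇ b₈
    constructor
    · rw [a₀]; exact update_pos hj hS.col
    · rw [a₅]; exact update_pos hj hS.y
    · rw [a₆]; exact update_pos hj hS.m
    · rw [a₇]; exact update_pos hj hS.b
    · rw [a₈]; exact update_pos hj hS.t
    · rw [a₉]; exact update_col hj hS.x
    · rw [b₇]
      intro i hi
      rcases Nat.lt_succ_iff_lt_or_eq.1 hi with h | rfl
      · exact (min_le_left _ _).trans (hS.lo i h)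
      · exact min_le_right _ _
    · rw [b₈]
      intro i hi
      rcases Nat.lt_succ_iff_lt_or_eq.1 hi with h | rfl
      · exact (hS.hi i h).trans (le_max_left _ _)
      · exact le_max_right _ _
    · rw [b₇]
      rcases min_choice (s.rreg 7) (W.bN j / W.mN j) with h | h <;> rw [h]
      · exact hS.lo_eq.imp_right fun ⟨i, hi, e⟩ => ⟨i, by omega, e⟩
      · exact .inr ⟨j, by omega, rfl⟩
    · rw [b₈]
      rcases max_choice (s.rreg 8) (W.bN j / W.mN j) with h | h <;> rw [h]
      · exact hS.hi_eq.imp_right fun ⟨i, hi, e⟩ => ⟨i, by omega, e⟩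
      · exact .inr ⟨j, by omega, rfl⟩
    · rw [b₇]; exact (min_le_left _ _).trans hS.lo_le
    · rw [b₈]; exact hS.le_hi.trans (le_max_left _ _)
  refine ⟨hW.sum_m.ne', hW.sum_b.ne', (hW.mN_pos hj).ne', fun h₇ => ⟨fun h₈ => ⟨key _ ?_ ?_ ?_ ?_ ?_
    ?_ ?_ ?_, ?_⟩, fun h₈ => ⟨key _ ?_ ?_ ?_ ?_ ?_ ?_ ?_ ?_, ?_⟩⟩, fun h₇ => ⟨fun h₈ => ⟨key _ ?_ ?_
    ?_ ?_ ?_ ?_ ?_ ?_, ?_⟩, fun h₈ => ⟨key _ ?_ ?_ ?_ ?_ ?_ ?_ ?_ ?_, ?_⟩⟩⟩ <;>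
  first
  | norm_num; done
  | simp; done
  | (simp; exact h₇.le)
  | (simp; exact not_lt.1 h₇)
  | (simp; exact h₈.le)
  | (simp; exact not_lt.1 h₈)

/-- Sort the points. -/
def sortProg : Prog := .iconst 30 0 ;; .loop (.ilt 30 0) (rankProg ;; storeProg ;; .iadd 30 30 2)

theorem yPos_congr {n : ℕ} {y y' : ℕ → ℝ} {i : ℕ} (hi : i < n) (h : ∀ j < n, y j = y' j) :
    yPos n y i = yPos n y' i := by
  rw [yPos, yPos]
  congr 1
  refine filter_congr fun j hj => ?_
  rw [h j (mem_range.1 hj), h i hi]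

theorem xCol_congr {n : ℕ} {x x' : ℕ → ℝ} {i : ℕ} (hi : i < n) (h : ∀ j < n, x j = x' j) :
    xCol n x i = xCol n x' i := by
  rw [xCol, xCol]
  congr 2
  refine filter_congr fun j hj => ?_
  rw [h j (mem_range.1 hj), h i hi]

theorem run_sortProg {W : Raw} (hW : W.Pos) {s : State} (hH : Holds W s)
    (r7 : s.rreg 7 = 1) (r8 : s.rreg 8 = 1)
    (r35 : s.rreg 35 = ∑ j ∈ range W.n, W.m j) (r36 : s.rreg 36 = ∑ j ∈ range W.n, W.b j) :
    Run sortProg s fun s' t => Sorted W W.n s' ∧ t ≤ W.n * (10 * W.n + 40) + 10 := by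
  simp only [sortProg, run_seq, run_iconst]
  refine run_loop W.n (fun j s' => s'.ireg 30 = j ∧ j ≤ W.n ∧ Sorted W j s')
    (fun _ => 10 * W.n + 31) ?_ ?_ ?_
  · refine ⟨by simp, by simp, ?_⟩
    constructor <;> simp [r7, r8]
  · rintro j s' ⟨h30, hj, hS⟩ F hlt
    have hH' : Holds W s' := (hH.frame (Frame.iconst s 30 0) rfl).frame F rfl
    simp only [holds_ilt, h30, hH'.i0] at hlt
    refine ⟨hlt, ?_⟩
    simp only [run_seq, run_iadd]
    refine (run_rankProg hH'.i0 hH'.i2 h30).imp ?_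
    rintro s₁ t₁ ⟨h32, h33, r31, r32, ht₁⟩ F₁
    rw [yPos_congr hlt hH'.y] at h32
    rw [xCol_congr hlt hH'.x] at h33
    refine (run_storeProg (s := s₁) hW (hH'.frame F₁ rfl) ((F₁.i 30 rfl).trans h30) hlt h32 h33
      (r31.trans (hH'.x j hlt)) (r32.trans (hH'.y j hlt)) ?_ ?_ (hS.frame F₁ rfl)).imp ?_
    · rw [F₁.r 35 rfl, F.r 35 rfl]; simpa using r35
    · rw [F₁.r 36 rfl, F.r 36 rfl]; simpa using r36
    · rintro s₂ t₂ ⟨hS₂, ht₂⟩ F₂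
      have e30 : s₂.ireg 30 = j := by rw [F₂.i 30 rfl, F₁.i 30 rfl, h30]
      have e2 : s₂.ireg 2 = 1 := by rw [F₂.i 2 rfl, F₁.i 2 rfl, hH'.i2]
      exact ⟨⟨by simp [e30, e2], hlt, hS₂.frame (Frame.iadd s₂ 30 30 2) rfl⟩, by omega⟩
  · rintro j s' t hj ⟨h30, -, hS⟩ F hlt ht
    have hH' : Holds W s' := (hH.frame (Frame.iconst s 30 0) rfl).frame F rfl
    simp only [holds_ilt, h30, hH'.i0, not_lt] at hlt
    obtain rfl : j = W.n := by omega
    simp only [sum_const, card_range, smul_eq_mul] at ht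
    refine ⟨hS, ?_⟩
    have : W.n * (10 * W.n + 40) = W.n * (10 * W.n + 31 + 1) + 8 * W.n := by ring
    omega

end RealRAM

/-! ### The tree size, the grid quotient and the other constants -/

namespace RealRAM

/-- Find a power of two that exceeds the number of points. -/
def sizeProg : Prog := .iconst 3 1 ;; .iadd 34 0 2 ;; .loop (.ilt 3 34) (.iadd 3 3 3)

/-- Only a power that is at most `n` gets doubled, so the result is at most `2 * n`. The target `n +
1` makes room for the columns 1 to `n` next to the empty column 0. -/
theorem run_sizeProg {s : State} {n : ℕ} (h0 : s.ireg 0 = n) (h2 : s.ireg 2 = 1) (hn : 0 < n) :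
    Run sizeProg s fun s' t => (∃ h, s'.ireg 3 = 2 ^ h ∧ n + 1 ≤ 2 ^ h ∧ 2 ^ h ≤ 2 * n) ∧
      t ≤ 2 * n + 10 := by
  simp only [sizeProg, run_seq, run_iconst, run_iadd, State.setI_ireg, Nat.reduceEqDiff, reduceIte,
    h0, h2]
  refine run_loop (n + 1) (fun j s' => s'.ireg 3 = 2 ^ j ∧ 2 ^ j ≤ 2 * n) (fun _ => 1) ?_ ?_ ?_
  · simp; omega
  · rintro j s' ⟨h3, hj⟩ F hlt
    have e34 : s'.ireg 34 = n + 1 := by rw [F.i 34 rfl]; simp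
    simp only [holds_ilt, h3, e34] at hlt
    have : j < 2 ^ j := Nat.lt_two_pow_self
    refine ⟨by omega, ?_⟩
    rw [run_iadd]
    refine ⟨⟨by simp [h3, pow_succ, mul_two], by rw [pow_succ]; omega⟩, le_rfl⟩
  · rintro j s' t hj ⟨h3, hj⟩ F hlt ht
    have e34 : s'.ireg 34 = n + 1 := by rw [F.i 34 rfl]; simp
    simp only [holds_ilt, h3, e34, not_lt] at hlt
    simp only [sum_const, card_range, smul_eq_mul] at ht
    exact ⟨⟨j, h3, hlt, hj⟩, by omega⟩

/-- Tabulate the parents of the nodes of the search tree. -/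
def parentProg : Prog :=
  .iconst 30 0 ;; .iconst 31 0 ;; .loop (.ilt 30 3) (.istore 3 31 30 ;; .iadd 31 31 2 ;;
    .istore 3 31 30 ;; .iadd 31 31 2 ;; .iadd 30 30 2)

theorem run_parentProg {s : State} {N : ℕ} (h3 : s.ireg 3 = N) (h2 : s.ireg 2 = 1) :
    Run parentProg s fun s' t => (∀ u < 2 * N, s'.iarr 3 u = u / 2) ∧ t ≤ 6 * N + 3 := by
  simp only [parentProg, run_seq, run_iconst]
  refine run_loop N (fun j s' => s'.ireg 30 = j ∧ s'.ireg 31 = 2 * j ∧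
    ∀ u < 2 * j, s'.iarr 3 u = u / 2) (fun _ => 5) ?_ ?_ ?_
  · simp
  · rintro j s' ⟨h30, h31, hp⟩ F hlt
    have e3 : s'.ireg 3 = N := by rw [F.i 3 rfl]; simpa using h3
    have e2 : s'.ireg 2 = 1 := by rw [F.i 2 rfl]; simpa using h2
    simp only [holds_ilt, h30, e3] at hlt
    refine ⟨hlt, ?_⟩
    simp only [run_seq, run_istore, run_iadd, State.setI_ireg, State.setIArr_ireg,
      State.setI_iarr, State.setIArr_iarr, Nat.reduceEqDiff, reduceIte, h30, h31, e2]
    refine ⟨⟨trivial, by ring, fun u hu => ?_⟩, by norm_num⟩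
    rw [Function.update_apply, Function.update_apply]
    split_ifs
    · omega
    · omega
    · exact hp u (by omega)
  · rintro j s' t hj ⟨h30, h31, hp⟩ F hlt ht
    have e3 : s'.ireg 3 = N := by rw [F.i 3 rfl]; simpa using h3
    simp only [holds_ilt, h30, e3, not_lt] at hlt
    simp only [sum_const, card_range, smul_eq_mul] at ht
    exact ⟨fun u hu => hp u (by omega), by omega⟩

/-- Find the quotient of the grid of ratios. -/
def gridProg : Prog :=
  .rconst 30 1 ;; .radd 31 0 3 ;;
  .loop (.rlt 31 1) (.radd 30 30 4 ;; .rmul 31 30 30 ;; .rmul 31 31 0) ;;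
  .rdiv 9 4 30 ;; .radd 9 9 4

/-- Without roots or rounding, the least positive integer `k + 1` with `(k + 1) ^ 2 * ε ≥ c` is
found by counting. With `δ = 1 / (k + 1)` the error `c * δ ^ 2` is at most `ε`, and the bound on `k
^ 2 * ε` keeps the grid small. While the loop runs, `j ≤ (j + 1) ^ 2 < c / ε`, so it ends within
O(c/ε) steps. -/
theorem run_gridProg {s : State} {ε c : ℝ} (h0 : s.rreg 0 = ε) (h1 : s.rreg 1 = c)
    (h3 : s.rreg 3 = 0) (h4 : s.rreg 4 = 1) (hε : 0 < ε) :
    Run gridProg s fun s' t => (∃ k : ℕ, s'.rreg 9 = 1 / (k + 1) + 1 ∧ c ≤ (k + 1) ^ 2 * ε ∧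
      k ^ 2 * ε ≤ max 0 c) ∧ t ≤ 4 * ⌈c / ε⌉₊ + 5 := by
  simp only [gridProg, run_seq, run_rconst, run_radd, State.setR_rreg, Nat.reduceEqDiff, reduceIte,
    h0, h3, add_zero, Rat.cast_one]
  refine run_loop ⌈c / ε⌉₊ (fun j s' => s'.rreg 30 = j + 1 ∧ s'.rreg 31 = ((j : ℝ) + 1) ^ 2 * ε ∧
    (j : ℝ) ^ 2 * ε ≤ max 0 c) (fun _ => 3) ?_ ?_ ?_
  · simp
  · rintro j s' ⟨h30, h31, hj⟩ F hlt
    have e1 : s'.rreg 1 = c := by rw [F.r 1 rfl]; simpa using h1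
    have e0 : s'.rreg 0 = ε := by rw [F.r 0 rfl]; simpa using h0
    have e4 : s'.rreg 4 = 1 := by rw [F.r 4 rfl]; simpa using h4
    simp only [holds_rlt, h31, e1] at hlt
    refine ⟨?_, ?_⟩
    · rw [Nat.lt_ceil, lt_div_iff₀ hε]
      refine lt_of_le_of_lt ?_ hlt
      refine mul_le_mul_of_nonneg_right ?_ hε.le
      have : (0 : ℝ) ≤ j := j.cast_nonneg
      nlinarith
    · simp only [run_seq, run_radd, run_rmul, State.setR_rreg, Nat.reduceEqDiff, reduceIte, h30, e4,
        e0]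
      refine ⟨⟨by push_cast; ring, by push_cast; ring, ?_⟩, by norm_num⟩
      push_cast
      exact hlt.le.trans (le_max_right _ _)
  · rintro j s' t hj ⟨h30, h31, hj'⟩ F hlt ht
    have e1 : s'.rreg 1 = c := by rw [F.r 1 rfl]; simpa using h1
    have e4 : s'.rreg 4 = 1 := by rw [F.r 4 rfl]; simpa using h4
    simp only [holds_rlt, h31, e1, not_lt] at hlt
    simp only [sum_const, card_range, smul_eq_mul] at ht
    simp only [run_rdiv, State.setR_rreg, Nat.reduceEqDiff, reduceIte, h30, e4]
    exact ⟨by positivity, ⟨j, rfl, hlt, hj'⟩, by omega⟩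

/-- Compute the remaining constants. -/
def constProg : Prog :=
  .rofi 30 0 ;; .rdiv 5 2 30 ;; .rsub 6 4 5 ;; .rlog 31 7 ;; .rlog 32 8 ;; .rsub 31 32 31 ;;
  .radd 31 4 31 ;; .radd 31 31 8 ;; .rmul 31 1 31 ;; .rconst 33 (-3) ;; .rmul 20 33 31 ;;
  .radd 10 20 20 ;; .rconst 21 (-1) ;; .iadd 13 0 1

theorem run_constProg {s : State} {n : ℕ} (i0 : s.ireg 0 = n) (i1 : s.ireg 1 = 0) (hn : 0 < n)
    (h4 : s.rreg 4 = 1) (h7 : 0 < s.rreg 7) (h8 : 0 < s.rreg 8) :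
    Run constProg s fun s' t => s'.rreg 5 = s.rreg 2 / n ∧ s'.rreg 6 = 1 - s.rreg 2 / n ∧
      s'.rreg 20 = -(3 * tanBound (s.rreg 1) (s.rreg 7) (s.rreg 8)) ∧
      s'.rreg 10 = -(6 * tanBound (s.rreg 1) (s.rreg 7) (s.rreg 8)) ∧
      s'.rreg 21 = -1 ∧ s'.ireg 13 = n ∧ t = 14 := by
  simp only [constProg, run_seq, run_rofi, run_rdiv, run_rsub, run_rlog, run_radd, run_rmul,
    run_rconst, run_iadd, State.setR_ireg, State.setR_rreg, State.setI_rreg, State.setI_ireg,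
    Nat.reduceEqDiff, reduceIte, i0, i1, h4, h7, h8, tanBound]
  refine ⟨by positivity, trivial, trivial, trivial, trivial, ?_, ?_, by norm_num, by simp, trivial⟩
  · push_cast; ring
  · push_cast; ring

/-- The preprocessing. -/
def preProg : Prog :=
  .iconst 2 1 ;; .rconst 4 1 ;; .rconst 7 1 ;; .rconst 8 1 ;; totalsProg ;; sortProg ;; sizeProg ;;
  parentProg ;; gridProg ;; constProg

/-- The initial state. -/
structure Start (W : Raw) (ε c C : ℝ) (s : State) : Prop where
  i0 : s.ireg 0 = W.n
  i : ∀ x, x ≠ 0 → s.ireg x = 0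
  r0 : s.rreg 0 = ε
  r1 : s.rreg 1 = c
  r2 : s.rreg 2 = C
  r3 : s.rreg 3 = 0
  ra : ∀ x, 10 ≤ x → s.rarr x = fun _ => 0
  x : ∀ i < W.n, s.rarr 0 i = W.x i
  y : ∀ i < W.n, s.rarr 1 i = W.y i
  m : ∀ i < W.n, s.rarr 3 i * s.rarr 2 i = W.m i
  b : ∀ i < W.n, s.rarr 3 i = W.b i
  t : ∀ i < W.n, s.rarr 4 i = W.t i

/-- The state after the preprocessing. -/
structure Prepared (W : Raw) (ε c C : ℝ) (h k : ℕ) (s : State) : Prop where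
  base : Base h s
  size_ge : W.n + 1 ≤ 2 ^ h
  size_le : 2 ^ h ≤ 2 * W.n
  sorted : Sorted W W.n s
  r1 : s.rreg 1 = c
  r4 : s.rreg 4 = 1
  r5 : s.rreg 5 = C / W.n
  r6 : s.rreg 6 = 1 - C / W.n
  r9 : s.rreg 9 = 1 / (k + 1) + 1
  grid_ge : c ≤ (k + 1) ^ 2 * ε
  grid_le : k ^ 2 * ε ≤ max 0 c
  r10 : s.rreg 10 = -(6 * tanBound c (s.rreg 7) (s.rreg 8))
  r20 : s.rreg 20 = -(3 * tanBound c (s.rreg 7) (s.rreg 8))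
  r21 : s.rreg 21 = -1
  i0 : s.ireg 0 = W.n
  i13 : s.ireg 13 = W.n
  i21 : s.ireg 21 = 0
  i22 : s.ireg 22 = 0
  ra : ∀ x, 12 ≤ x → s.rarr x = fun _ => 0
  t : ∀ i < W.n, s.rarr 4 i = W.t i

/-- The time for the preprocessing. -/
noncomputable def preTime (W : Raw) (ε c : ℝ) : ℕ :=
  W.n * (10 * W.n + 70) + 4 * ⌈c / ε⌉₊ + 60

theorem run_preProg {W : Raw} (hW : W.Pos) {ε c C : ℝ} {s : State} (hε : 0 < ε)
    (hs : Start W ε c C s) :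
    Run preProg s fun s' t => (∃ h k, Prepared W ε c C h k s') ∧ t ≤ preTime W ε c := by
  -- The intermediate postcondition lists only what the program establishes. What it leaves
  -- unchanged is recovered afterwards from the frame of the whole program.
  refine Run.imp (P := fun s' t => (∃ h k : ℕ, s'.ireg 3 = 2 ^ h ∧ W.n + 1 ≤ 2 ^ h ∧
    2 ^ h ≤ 2 * W.n ∧ (∀ u < 2 * 2 ^ h, s'.iarr 3 u = u / 2) ∧ Sorted W W.n s' ∧ s'.ireg 2 = 1 ∧
    s'.rreg 4 = 1 ∧ s'.rreg 9 = 1 / (k + 1) + 1 ∧ c ≤ (k + 1) ^ 2 * ε ∧ k ^ 2 * ε ≤ max 0 c ∧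
    s'.rreg 5 = C / W.n ∧ s'.rreg 6 = 1 - C / W.n ∧
    s'.rreg 20 = -(3 * tanBound c (s'.rreg 7) (s'.rreg 8)) ∧
    s'.rreg 10 = -(6 * tanBound c (s'.rreg 7) (s'.rreg 8)) ∧
    s'.rreg 21 = -1 ∧ s'.ireg 13 = W.n) ∧ t ≤ preTime W ε c) ?_ ?_
  · simp only [preProg, run_seq, run_iconst, run_rconst, Rat.cast_one]
    set s₀ := (((s.setI 2 1).setR 4 1).setR 7 1).setR 8 1 with hs₀
    have eI : ∀ x, x ≠ 2 → s₀.ireg x = s.ireg x := fun x hx => by simp [hs₀, hx]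
    have eR : ∀ x, x ≠ 4 → x ≠ 7 → x ≠ 8 → s₀.rreg x = s.rreg x := fun x h₁ h₂ h₃ => by
      simp [hs₀, h₁, h₂, h₃]
    have hH : Holds W s₀ := ⟨(eI 0 (by norm_num)).trans hs.i0, by simp [hs₀],
      (eR 3 (by norm_num) (by norm_num) (by norm_num)).trans hs.r3, hs.x, hs.y, hs.m, hs.b, hs.t⟩
    refine (run_totalsProg hH).imp ?_
    rintro s₁ t₁ ⟨r35, r36, ht₁⟩ F₁
    have hH₁ := hH.frame F₁ rfl
    refine (run_sortProg hW hH₁ (by rw [F₁.r 7 rfl]; simp [hs₀]) (by rw [F₁.r 8 rfl]; simp [hs₀])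
      r35 r36).imp ?_
    rintro s₂ t₂ ⟨hS, ht₂⟩ F₂
    have hH₂ := hH₁.frame F₂ rfl
    refine (run_sizeProg hH₂.i0 hH₂.i2 hW.n_pos).imp ?_
    rintro s₃ t₃ ⟨⟨h, h3, hh, hh'⟩, ht₃⟩ F₃
    have hH₃ := hH₂.frame F₃ rfl
    refine (run_parentProg h3 hH₃.i2).imp ?_
    rintro s₄ t₄ ⟨hp, ht₄⟩ F₄
    have hH₄ := hH₃.frame F₄ rfl
    have e4 : s₄.rreg 4 = 1 := by
      rw [F₄.r 4 rfl, F₃.r 4 rfl, F₂.r 4 rfl, F₁.r 4 rfl]; simp [hs₀]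
    have e0 : s₄.rreg 0 = ε := by
      rw [F₄.r 0 rfl, F₃.r 0 rfl, F₂.r 0 rfl, F₁.r 0 rfl, eR 0 (by norm_num) (by norm_num)
        (by norm_num), hs.r0]
    have e1 : s₄.rreg 1 = c := by
      rw [F₄.r 1 rfl, F₃.r 1 rfl, F₂.r 1 rfl, F₁.r 1 rfl, eR 1 (by norm_num) (by norm_num)
        (by norm_num), hs.r1]
    have e2 : s₄.rreg 2 = C := by
      rw [F₄.r 2 rfl, F₃.r 2 rfl, F₂.r 2 rfl, F₁.r 2 rfl, eR 2 (by norm_num) (by norm_num)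
        (by norm_num), hs.r2]
    have i1 : s₄.ireg 1 = 0 := by
      rw [F₄.i 1 rfl, F₃.i 1 rfl, F₂.i 1 rfl, F₁.i 1 rfl, eI 1 (by norm_num), hs.i 1 (by norm_num)]
    have i3 : s₄.ireg 3 = 2 ^ h := (F₄.i 3 rfl).trans h3
    have hS₄ := (hS.frame F₃ rfl).frame F₄ rfl
    refine (run_gridProg e0 e1 hH₄.r3 e4 hε).imp ?_
    rintro s₅ t₅ ⟨⟨k, r9, hk, hk'⟩, ht₅⟩ F₅
    have hS₅ := hS₄.frame F₅ rfl
    have h7 : 0 < s₅.rreg 7 := by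
      rcases hS₅.lo_eq with h | ⟨i, hi, h⟩ <;> rw [h]
      · exact one_pos
      · exact div_pos (hW.bN_pos hi) (hW.mN_pos hi)
    refine (run_constProg (s := s₅) (n := W.n) ((F₅.i 0 rfl).trans hH₄.i0) ((F₅.i 1 rfl).trans i1)
      hW.n_pos ((F₅.r 4 rfl).trans e4) h7 (one_pos.trans_le hS₅.le_hi)).imp ?_
    rintro s₆ t₆ ⟨h5, h6, h20, h10, h21, h13, ht₆⟩ F₆
    rw [F₅.r 2 rfl, e2] at h5 h6
    rw [F₅.r 1 rfl, e1] at h10 h20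
    refine ⟨⟨h, k, ?_, hh, hh', ?_, hS₅.frame F₆ rfl, ?_, ?_, ?_, hk, hk', h5, h6, ?_, ?_, h21, h13⟩,
      ?_⟩
    · rw [F₆.i 3 rfl, F₅.i 3 rfl, i3]
    · rw [F₆.ia 3 rfl, F₅.ia 3 rfl]; exact hp
    · rw [F₆.i 2 rfl, F₅.i 2 rfl, hH₄.i2]
    · rw [F₆.r 4 rfl, F₅.r 4 rfl, e4]
    · rw [F₆.r 9 rfl, r9]
    · rw [F₆.r 7 rfl, F₆.r 8 rfl, h20]
    · rw [F₆.r 7 rfl, F₆.r 8 rfl, h10]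
    · have : W.n * (10 * W.n + 70) = W.n * (10 * W.n + 40) + 30 * W.n := by ring
      rw [preTime]
      omega
  · rintro s' t ⟨⟨h, k, a₁, a₂, a₃, a₄, a₅, a₆, a₇, a₈, a₉, b₁, b₂, b₃, b₄, b₅, b₆, b₇⟩, ht⟩ F
    refine ⟨⟨h, k, ⟨⟨(F.r 3 rfl).trans hs.r3, (F.i 1 rfl).trans (hs.i 1 (by norm_num)), a₆, a₁,
      fun u _ hu => a₄ u (by rwa [pow_succ, mul_comm] at hu)⟩, a₂, a₃, a₅, (F.r 1 rfl).trans hs.r1,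
      a₇, b₂, b₃, a₈, a₉, b₁, b₅, b₄, b₆, (F.i 0 rfl).trans hs.i0, b₇,
      (F.i 21 rfl).trans (hs.i 21 (by norm_num)), (F.i 22 rfl).trans (hs.i 22 (by norm_num)),
      fun x hx => ?_, by rw [F.ra 4 rfl]; exact hs.t⟩⟩, ht⟩
    rw [F.ra x ?_, hs.ra x (by omega)]
    simp only [Prog.wra, preProg, totalsProg, sortProg, rankProg, storeProg, sizeProg, parentProg,
      gridProg, constProg, Bool.or_false, Bool.false_or, Bool.or_eq_false_iff, beq_eq_false_iff_ne]
    omega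

end RealRAM

/-- All weights lie between `lo` and `hi`. -/
structure Raw.Bounds (W : Raw) (lo hi : ℝ) : Prop where
  n_pos : 0 < W.n
  lo_pos : 0 < lo
  m_ge : ∀ i < W.n, lo ≤ W.m i
  m_le : ∀ i < W.n, W.m i ≤ hi
  b_ge : ∀ i < W.n, lo ≤ W.b i
  b_le : ∀ i < W.n, W.b i ≤ hi

/-! ### Bounds on the normalised weights and their ratios -/

namespace Raw

variable {W : Raw} {lo hi : ℝ}

theorem Bounds.pos (hW : W.Bounds lo hi) : W.Pos :=
  ⟨hW.n_pos, fun i h => hW.lo_pos.trans_le (hW.m_ge i h), fun i h => hW.lo_pos.trans_le (hW.b_ge i h)⟩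

theorem Bounds.lo_le_hi (hW : W.Bounds lo hi) : lo ≤ hi :=
  (hW.m_ge 0 hW.n_pos).trans (hW.m_le 0 hW.n_pos)

theorem Bounds.hi_pos (hW : W.Bounds lo hi) : 0 < hi := hW.lo_pos.trans_le hW.lo_le_hi

theorem sum_bounds {f : ℕ → ℝ} (h₁ : ∀ i < W.n, lo ≤ f i)
    (h₂ : ∀ i < W.n, f i ≤ hi) :
    W.n * lo ≤ ∑ i ∈ range W.n, f i ∧ ∑ i ∈ range W.n, f i ≤ W.n * hi := by
  constructor
  · simpa using sum_le_sum (s := range W.n) (f := fun _ => lo) fun i hi => h₁ i (mem_range.1 hi)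
  · simpa using sum_le_sum (s := range W.n) (g := fun _ => hi) fun i hi => h₂ i (mem_range.1 hi)

theorem Bounds.normalized_ge (hW : W.Bounds lo hi) {f : ℕ → ℝ} (h₁ : ∀ i < W.n, lo ≤ f i)
    (h₂ : ∀ i < W.n, f i ≤ hi) {i : ℕ} (h : i < W.n) :
    lo / (W.n * hi) ≤ f i / ∑ i ∈ range W.n, f i := by
  have hn : (0 : ℝ) < W.n := Nat.cast_pos.2 hW.n_pos
  have hs := sum_bounds h₁ h₂
  exact div_le_div₀ (hW.lo_pos.le.trans (h₁ i h)) (h₁ i h)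
    ((mul_pos hn hW.lo_pos).trans_le hs.1) hs.2

theorem Bounds.normalized_le (hW : W.Bounds lo hi) {f : ℕ → ℝ} (h₁ : ∀ i < W.n, lo ≤ f i)
    (h₂ : ∀ i < W.n, f i ≤ hi) {i : ℕ} (h : i < W.n) :
    f i / ∑ i ∈ range W.n, f i ≤ hi / (W.n * lo) := by
  have hn : (0 : ℝ) < W.n := Nat.cast_pos.2 hW.n_pos
  have hs := sum_bounds h₁ h₂
  exact div_le_div₀ hW.hi_pos.le (h₂ i h) (mul_pos hn hW.lo_pos) hs.1

theorem Bounds.ratio_le (hW : W.Bounds lo hi) {i : ℕ} (h : i < W.n) :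
    W.bN i / W.mN i ≤ (hi / lo) ^ 2 := by
  have hn : (0 : ℝ) < W.n := Nat.cast_pos.2 hW.n_pos
  have := hW.lo_pos
  have := hW.hi_pos
  refine (div_le_div₀ (by positivity) (hW.normalized_le hW.b_ge hW.b_le h) (by positivity)
    (hW.normalized_ge hW.m_ge hW.m_le h)).trans_eq ?_
  field_simp

theorem Bounds.ratio_ge (hW : W.Bounds lo hi) {i : ℕ} (h : i < W.n) :
    ((hi / lo) ^ 2)⁻¹ ≤ W.bN i / W.mN i := by
  have hn : (0 : ℝ) < W.n := Nat.cast_pos.2 hW.n_pos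
  have := hW.lo_pos
  have := hW.hi_pos
  refine le_trans (le_of_eq ?_) (div_le_div₀ (hW.pos.bN_pos h).le
    (hW.normalized_ge hW.b_ge hW.b_le h) (hW.pos.mN_pos h) (hW.normalized_le hW.m_ge hW.m_le h))
  field_simp

theorem pos_lt {i : ℕ} (h : i < W.n) : W.pos i < W.n := yPos_lt h

theorem pos_inj {i j : ℕ} (hi : i < W.n) (hj : j < W.n) (h : W.pos i = W.pos j) : i = j :=
  yPos_inj hi hj h

theorem exists_pos {a : ℕ} (ha : a < W.n) : ∃ i < W.n, W.pos i = a := by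
  obtain ⟨i, hi, h⟩ := surj_on_of_inj_on_of_card_le (s := range W.n) (t := range W.n)
    (fun i _ => W.pos i) (fun i hi => mem_range.2 (pos_lt (mem_range.1 hi)))
    (fun i j hi hj h => pos_inj (mem_range.1 hi) (mem_range.1 hj) h) le_rfl a (mem_range.2 ha)
  exact ⟨i, mem_range.1 hi, h.symm⟩

theorem y_le_of_pos_le {i j : ℕ} (hj : j < W.n) (h : W.pos i ≤ W.pos j) :
    W.y i ≤ W.y j := by
  by_contra hlt
  exact absurd (yPos_lt_yPos hj (.inl (not_le.1 hlt))) (not_lt.2 h)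

theorem sum_pos_eq {f g : ℕ → ℝ} {S : Finset ℕ} (hS : S ⊆ range W.n)
    (h : ∀ i < W.n, f (W.pos i) = g i) : ∑ a ∈ S.image W.pos, f a = ∑ i ∈ S, g i := by
  rw [sum_image fun i hi j hj h => pos_inj (mem_range.1 (hS hi)) (mem_range.1 (hS hj)) h]
  exact sum_congr rfl fun i hi => h i (mem_range.1 (hS hi))

theorem image_pos : (range W.n).image W.pos = range W.n := by
  ext a
  rw [mem_image]
  constructor
  · rintro ⟨i, hi, rfl⟩
    exact mem_range.2 (pos_lt (mem_range.1 hi))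
  · intro ha
    obtain ⟨i, hi, rfl⟩ := exists_pos (mem_range.1 ha)
    exact ⟨i, mem_range.2 hi, rfl⟩

end Raw

/-! ### The preprocessed input has the required properties -/

namespace RealRAM

/-- The preprocessed input that is stored in the machine. -/
noncomputable def State.inst (s : State) (n h K cnt J : ℕ) : Inst where
  n := n
  h := h
  K := K
  cnt := cnt
  J := J
  mv := s.rarr 6
  bv := s.rarr 7
  ts := s.rarr 8
  ys := s.rarr 5
  col := s.iarr 0
  xc := s.rarr 9
  tau := s.rarr 4
  thr := s.rreg 5
  c := s.rreg 1
  lo := s.rreg 7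
  hi := s.rreg 8
  g := s.rreg 9

/-- A bound for the size of the grid. -/
noncomputable def gridSize (lo hi : ℝ) (k : ℕ) : ℕ := (k + 1) * ⌈(hi / lo) ^ 4⌉₊

/-- A bound for the number of points in a region with too little weight. -/
noncomputable def fewBound (C lo hi : ℝ) : ℕ := ⌊C * hi / lo⌋₊

section

variable {W : Raw} {ε c C lo hi : ℝ} {h k cnt : ℕ} {s : State}

/-- Each normalised weight is at least `lo / (n * hi)`, so a set of weight less than `C / n` has at
most `C * hi / lo` points, a number that does not depend on `n`. -/
theorem Prepared.card_le (hW : W.Bounds lo hi) {f g : ℕ → ℝ} (h₁ : ∀ i < W.n, lo ≤ f i)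
    (h₂ : ∀ i < W.n, f i ≤ hi) (hg : ∀ i < W.n, g (W.pos i) = f i / ∑ i ∈ range W.n, f i)
    {S : Finset ℕ} (hS : S ⊆ range W.n) (hlt : ∑ a ∈ S, g a < C / W.n) :
    #S ≤ fewBound C lo hi := by
  have hn : (0 : ℝ) < W.n := Nat.cast_pos.2 hW.n_pos
  have hlo := hW.lo_pos
  have hhi := hW.hi_pos
  have : #S • (lo / (W.n * hi)) ≤ ∑ a ∈ S, g a := card_nsmul_le_sum _ _ _ fun a ha => by
    obtain ⟨i, hi, rfl⟩ := Raw.exists_pos (mem_range.1 (hS ha))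
    rw [hg i hi]
    exact hW.normalized_ge h₁ h₂ hi
  refine Nat.le_floor ?_
  rw [nsmul_eq_mul] at this
  have := this.trans hlt.le
  rw [mul_div_assoc', div_le_div_iff₀ (by positivity) hn] at this
  rw [le_div_iff₀ hlo]
  refine le_of_mul_le_mul_right ?_ hn
  linarith

theorem Prepared.lo_pos (hW : W.Bounds lo hi) (hP : Prepared W ε c C h k s) :
    ((hi / lo) ^ 2)⁻¹ ≤ s.rreg 7 ∧ 0 < s.rreg 7 := by
  have h₁ := hW.lo_pos
  have h₂ := hW.hi_pos
  have key : ((hi / lo) ^ 2)⁻¹ ≤ s.rreg 7 := by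
    rcases hP.sorted.lo_eq with h | ⟨i, hi, h⟩ <;> rw [h]
    · refine inv_le_one_of_one_le₀ (one_le_pow₀ ?_)
      rw [one_le_div h₁]
      exact hW.lo_le_hi
    · exact hW.ratio_ge hi
  exact ⟨key, lt_of_lt_of_le (by positivity) key⟩

theorem Prepared.hi_le (hW : W.Bounds lo hi) (hP : Prepared W ε c C h k s) :
    s.rreg 8 ≤ (hi / lo) ^ 2 := by
  rcases hP.sorted.hi_eq with h | ⟨i, hi, h⟩ <;> rw [h]
  · refine one_le_pow₀ ?_
    rw [one_le_div hW.lo_pos]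
    exact hW.lo_le_hi
  · exact hW.ratio_le hi

theorem Prepared.valid (hW : W.Bounds lo hi) (hc : 0 < c) (hC : 0 < C)
    (hP : Prepared W ε c C h k s) :
    (s.inst W.n h (fewBound C lo hi) cnt (gridSize lo hi k)).Valid := by
  have hn : (0 : ℝ) < W.n := Nat.cast_pos.2 hW.n_pos
  have hk : (0 : ℝ) < k + 1 := by positivity
  have hS := hP.sorted
  constructor
  · constructor
    · intro a ha
      obtain ⟨i, hi, rfl⟩ := Raw.exists_pos ha
      exact (hW.pos.mN_pos hi).trans_eq (hS.m i hi).symm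
    · intro a ha
      obtain ⟨i, hi, rfl⟩ := Raw.exists_pos ha
      exact (hW.pos.bN_pos hi).trans_eq (hS.b i hi).symm
    · intro a ha
      obtain ⟨i, hi, rfl⟩ := Raw.exists_pos ha
      exact (Nat.succ_pos _).trans_eq (hS.col i hi).symm
    · intro a ha
      obtain ⟨i, hi, rfl⟩ := Raw.exists_pos ha
      exact (hS.col i hi).trans_lt ((Nat.lt_succ_of_le (xCol_le hi)).trans_le hP.size_ge)
    · intro S hSub hlt
      have hlt : ∑ a ∈ S, s.rarr 6 a < C / W.n ∨ ∑ a ∈ S, s.rarr 7 a < C / W.n := hP.r5 ▸ hlt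
      rcases hlt with h | h
      · exact Prepared.card_le hW hW.m_ge hW.m_le hS.m hSub h
      · exact Prepared.card_le hW hW.b_ge hW.b_le hS.b hSub h
  · exact (div_pos hC hn).trans_eq hP.r5.symm
  · exact hc.trans_eq hP.r1.symm
  · exact (hP.lo_pos hW).2
  · exact hS.lo_le
  · exact hS.le_hi
  · refine lt_of_lt_of_eq ?_ hP.r9.symm
    have : 0 < 1 / ((k : ℝ) + 1) := by positivity
    linarith
  · refine Eq.trans ?_ (div_self hW.pos.sum_m.ne')
    rw [sum_div]
    have := Raw.sum_pos_eq subset_rfl hS.m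
    rwa [Raw.image_pos] at this
  · refine Eq.trans ?_ (div_self hW.pos.sum_b.ne')
    rw [sum_div]
    have := Raw.sum_pos_eq subset_rfl hS.b
    rwa [Raw.image_pos] at this
  · have h₁ := hP.lo_pos hW
    have h₂ := hP.hi_le hW
    have hlo := hW.lo_pos
    have hhi := hW.hi_pos
    change s.rreg 8 < s.rreg 7 * s.rreg 9 ^ gridSize lo hi k
    -- By Bernoulli, `g ^ J ≥ 1 + J / (k + 1)`. The factor `⌈(hi / lo) ^ 4⌉₊` in `J` makes this
    -- larger than `(hi / lo) ^ 4`, the quotient of the extreme possible ratios `(hi / lo) ^ 2` and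
    -- its inverse.
    have hB := one_add_mul_le_pow (a := 1 / ((k : ℝ) + 1)) (le_trans (b := 0) (by norm_num)
      (by positivity)) (gridSize lo hi k)
    rw [add_comm 1 (1 / _), ← hP.r9] at hB
    have hQ := Nat.le_ceil ((hi / lo) ^ 4)
    have hJ : (gridSize lo hi k : ℝ) * (1 / ((k : ℝ) + 1)) = ⌈(hi / lo) ^ 4⌉₊ := by
      rw [gridSize]; push_cast; field_simp
    rw [hJ] at hB
    calc s.rreg 8 ≤ (hi / lo) ^ 2 := h₂
      _ = ((hi / lo) ^ 2)⁻¹ * (hi / lo) ^ 4 := by field_simp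
      _ < ((hi / lo) ^ 2)⁻¹ * s.rreg 9 ^ gridSize lo hi k := by
        refine mul_lt_mul_of_pos_left (by linarith) (by positivity)
      _ ≤ s.rreg 7 * s.rreg 9 ^ gridSize lo hi k :=
        mul_le_mul_of_nonneg_right h₁.1 (le_trans (by positivity) hB)

theorem Prepared.sane (hP : Prepared W ε c C h k s) (hcnt : s.ireg 4 = cnt) {K J : ℕ} :
    Sane (s.inst W.n h K cnt J) s where
  env := ⟨hP.base, hP.i0, hcnt, rfl, hP.r4, rfl, hP.r6.trans (by rw [← hP.r5]; rfl), rfl, rfl, rfl,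
    hP.r10.trans (by rw [← hP.r1]; rfl), ⟨fun _ _ => rfl, fun _ _ => rfl, fun _ _ => rfl,
      fun _ _ => rfl⟩, rfl, rfl, rfl⟩
  i13 := hP.i13
  -- All tree arrays are zero at first, and combining two zero nodes gives a zero node: the tree is
  -- consistent without any initialisation.
  cons v _ _ := by
    simp [Cons, State.tree, Node.op, hP.ra 12, hP.ra 13, hP.ra 14, hP.ra 15]
  res := by
    have h20 : s.rreg 20 = -(3 * (s.inst W.n h K cnt J).bound) :=
      hP.r20.trans (by rw [← hP.r1]; rfl)
    exact ⟨.inl hP.r21, .inl ⟨h20, hP.i21, hP.i22⟩, h20.ge⟩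

theorem Prepared.grid (hW : W.Bounds lo hi) (hP : Prepared W ε c C h k s) {n K cnt J : ℕ} {ρ : ℝ}
    (h₁ : s.rreg 7 ≤ ρ) : ∃ j, (s.inst n h K cnt J).ratio j ≤ ρ ∧
      ρ ≤ (s.inst n h K cnt J).ratio (j + 1) := by
  have hlo := (hP.lo_pos hW).2
  have hg : 1 < s.rreg 9 := by
    rw [hP.r9]
    have : 0 < 1 / ((k : ℝ) + 1) := by positivity
    linarith
  obtain ⟨j, h₂, h₃⟩ := exists_nat_pow_near ((one_le_div hlo).2 h₁) hg
  refine ⟨j, ?_, ?_⟩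
  · change s.rreg 7 * s.rreg 9 ^ j ≤ ρ
    rw [mul_comm]
    exact (le_div_iff₀ hlo).1 h₂
  · change ρ ≤ s.rreg 7 * s.rreg 9 ^ (j + 1)
    rw [mul_comm]
    exact ((div_lt_iff₀ hlo).1 h₃).le

theorem Prepared.error_le (hP : Prepared W ε c C h k s) :
    s.rreg 1 * (s.rreg 9 - 1) ^ 2 ≤ ε := by
  have hk : (0 : ℝ) < k + 1 := by positivity
  rw [hP.r9, hP.r1, add_sub_cancel_right, div_pow, one_pow, mul_one_div, div_le_iff₀ (by positivity)]
  linarith [hP.grid_ge]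

/-- The mediant inequality: a quotient of sums lies between the extreme quotients of the summands.
-/
theorem Prepared.sum_ratio (hW : W.Bounds lo hi) (hP : Prepared W ε c C h k s) {S : Finset ℕ}
    (hS : S ⊆ range W.n) : s.rreg 7 * ∑ a ∈ S, s.rarr 6 a ≤ ∑ a ∈ S, s.rarr 7 a ∧
      ∑ a ∈ S, s.rarr 7 a ≤ s.rreg 8 * ∑ a ∈ S, s.rarr 6 a := by
  rw [mul_sum, mul_sum]
  refine ⟨sum_le_sum fun a ha => ?_, sum_le_sum fun a ha => ?_⟩ <;>
    obtain ⟨i, hi, rfl⟩ := Raw.exists_pos (mem_range.1 (hS ha)) <;>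
    rw [hP.sorted.m i hi, hP.sorted.b i hi]
  · rw [← le_div_iff₀ (hW.pos.mN_pos hi)]
    exact hP.sorted.lo i hi
  · rw [← div_le_iff₀ (hW.pos.mN_pos hi)]
    exact hP.sorted.hi i hi

/-- The totals are 1, so `1 - b` and `1 - m` are the weights of the complement. The mediant
inequality for the complement bounds the second ratio by the same interval. -/
theorem Prepared.ratio (hW : W.Bounds lo hi) (hc : 0 < c) (hC : 0 < C)
    (hP : Prepared W ε c C h k s) {P : Inst}
    (hPs : P = s.inst W.n h (fewBound C lo hi) cnt (gridSize lo hi k)) {κ a t l r : ℕ} (ht : t < P.n)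
    (hs : P.Sup κ a (t + 1) l r) :
    (P.lo ≤ seg (P.B κ a (t + 1)) l (r + 1) / seg (P.M κ a (t + 1)) l (r + 1) ∧
      seg (P.B κ a (t + 1)) l (r + 1) / seg (P.M κ a (t + 1)) l (r + 1) ≤ P.hi) ∧
    P.lo ≤ (1 - seg (P.B κ a (t + 1)) l (r + 1)) / (1 - seg (P.M κ a (t + 1)) l (r + 1)) ∧
      (1 - seg (P.B κ a (t + 1)) l (r + 1)) / (1 - seg (P.M κ a (t + 1)) l (r + 1)) ≤ P.hi := by
  have hV : P.Valid := hPs ▸ hP.valid hW hc hC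
  obtain ⟨-, -, h₁, h₂⟩ := hs.bounds hV
  have h₂ := sub_pos.2 h₂
  rw [le_div_iff₀ h₁, div_le_iff₀ h₁, le_div_iff₀ h₂, div_le_iff₀ h₂]
  have hS : inCols P.col (P.A κ a (t + 1)) l (r + 1) ⊆ range P.n :=
    (filter_subset _ _).trans (Inst.A_subset ht)
  have e₁ := sum_sdiff_eq_sub (f := P.mv) hS
  have e₂ := sum_sdiff_eq_sub (f := P.bv) hS
  rw [hV.sum_m] at e₁
  rw [hV.sum_b] at e₂
  rw [Inst.M, Inst.B, seg_colSum, seg_colSum, ← e₁, ← e₂]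
  subst hPs
  exact ⟨hP.sum_ratio hW hS, hP.sum_ratio hW sdiff_subset⟩

end

end RealRAM

/-! ### Windows and strips -/

/-- The points in a rectangle that have a time stamp of at least `τ`. -/
noncomputable def Raw.win (W : Raw) (u v : ℝ × ℝ) (τ : ℝ) : Finset ℕ :=
  {i ∈ range W.n | (u.1 ≤ W.x i ∧ W.x i ≤ v.1) ∧ (u.2 ≤ W.y i ∧ W.y i ≤ v.2) ∧ τ ≤ W.t i}

/-- The points in a strip that are recent enough and lie in given columns. -/
noncomputable def Inst.region (P : Inst) (κ a t l r : ℕ) : Finset ℕ :=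
  inCols P.col (P.A κ a (t + 1)) l (r + 1)

theorem Inst.region_subset {P : Inst} {κ a t l r : ℕ} (ht : t < P.n) :
    P.region κ a t l r ⊆ range P.n := (filter_subset _ _).trans (Inst.A_subset ht)

namespace RealRAM

section

variable {W : Raw} {ε c C : ℝ} {h k K J cnt : ℕ} {s : State} {P : Inst}

theorem Prepared.mem_region (hP : Prepared W ε c C h k s) (hPs : P = s.inst W.n h K cnt J)
    {κ a t l r i : ℕ} (hi : i < W.n) : W.pos i ∈ P.region κ a t l r ↔
      (l ≤ W.col i ∧ W.col i ≤ r) ∧ (a ≤ W.pos i ∧ W.pos i ≤ t) ∧ P.tau κ ≤ W.t i := by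
  have h₁ : P.col (W.pos i) = W.col i := hPs ▸ hP.sorted.col i hi
  have h₂ : P.ts (W.pos i) = W.t i := hPs ▸ hP.sorted.t i hi
  simp only [Inst.region, inCols, Inst.A, alive, mem_filter, mem_Ico, h₁, h₂, Nat.lt_succ_iff]
  tauto

theorem Prepared.region_eq (hP : Prepared W ε c C h k s) (hPs : P = s.inst W.n h K cnt J)
    {κ a t l r : ℕ} {u v : ℝ × ℝ} {τ : ℝ} (ht : t < W.n)
    (hx : ∀ i < W.n, (l ≤ W.col i ∧ W.col i ≤ r) ↔ u.1 ≤ W.x i ∧ W.x i ≤ v.1)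
    (hy : ∀ i < W.n, (a ≤ W.pos i ∧ W.pos i ≤ t) ↔ u.2 ≤ W.y i ∧ W.y i ≤ v.2)
    (hτ : ∀ i < W.n, P.tau κ ≤ W.t i ↔ τ ≤ W.t i) :
    P.region κ a t l r = (W.win u v τ).image W.pos := by
  have hn : P.n = W.n := hPs ▸ rfl
  ext p
  rw [mem_image]
  constructor
  · intro hp
    obtain ⟨i, hi, rfl⟩ := Raw.exists_pos (mem_range.1 (hn ▸ Inst.region_subset (hn ▸ ht) hp))
    have := (hP.mem_region hPs hi).1 hp
    rw [hx i hi, hy i hi, hτ i hi] at this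
    exact ⟨i, mem_filter.2 ⟨mem_range.2 hi, this⟩, rfl⟩
  · rintro ⟨i, hi, rfl⟩
    obtain ⟨hi, h⟩ := mem_filter.1 hi
    have hi := mem_range.1 hi
    rw [hP.mem_region hPs hi, hx i hi, hy i hi, hτ i hi]
    exact h

/-- The end columns are nonempty, so their coordinates are those of input points. `First` and `Last`
ensure that the indices from `a` to `t` include every point whose second coordinate lies between the
two output values, ties included. -/
theorem Prepared.region_of_found (hP : Prepared W ε c C h k s)
    (hPs : P = s.inst W.n h K cnt J) (hV : P.Valid) {κ a t l r : ℕ} {s' : State}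
    (hF : Found P κ a t l r s') : P.region κ a t l r =
      (W.win (s'.rreg 1, s'.rreg 2) (s'.rreg 3, s'.rreg 4) (s'.rreg 5)).image W.pos := by
  have hn : P.n = W.n := hPs ▸ rfl
  have htn : t + 1 ≤ P.n := hF.strip.lt
  have hA := Inst.A_subset (κ := κ) (a := a) htn
  have hcol : ∀ i < W.n, P.col (W.pos i) = W.col i := hPs ▸ hP.sorted.col
  have hxc : ∀ i < W.n, P.xc (W.col i) = W.x i := hPs ▸ hP.sorted.x
  have hys : ∀ i < W.n, P.ys (W.pos i) = W.y i := hPs ▸ hP.sorted.y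
  have hcell : ∀ q, 0 < P.M κ a (t + 1) q → ∃ i < W.n, q = W.col i := fun q hq => by
    obtain ⟨p, hp, rfl⟩ := (colSum_pos_iff fun p hp => hV.pts.m_pos p (mem_range.1 (hA hp))).1 hq
    obtain ⟨i, hi, rfl⟩ := Raw.exists_pos (hn ▸ mem_range.1 (hA hp))
    exact ⟨i, hi, hcol i hi⟩
  have hat := hF.strip.le
  obtain ⟨i, hi, rfl⟩ := hcell l hF.left
  obtain ⟨j, hj, rfl⟩ := hcell r hF.right
  obtain ⟨p, hp, hpa⟩ := Raw.exists_pos (W := W) (a := a) (by omega)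
  obtain ⟨q, hq, hqt⟩ := Raw.exists_pos (W := W) (a := t) (by omega)
  refine hP.region_eq hPs (by omega) (fun e he => ?_) (fun e he => ?_) fun e he => ?_
  · rw [hF.r1, hF.r3, hxc i hi, hxc j hj]
    exact and_congr (xCol_le_xCol hi he) (xCol_le_xCol he hj)
  · rw [hF.r2, hF.r4, ← hpa, ← hqt, hys p hp, hys q hq]
    refine and_congr ⟨fun h => Raw.y_le_of_pos_le he h, fun h => ?_⟩
      ⟨fun h => Raw.y_le_of_pos_le hq h, fun h => ?_⟩
    · by_contra hlt
      have hfirst := hF.strip.first (by omega)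
      obtain ⟨f, hf, hfa⟩ := Raw.exists_pos (W := W) (a := a - 1) (by omega)
      rw [← hfa, ← hpa, hys f hf, hys p hp] at hfirst
      exact absurd (hfirst.trans_le (h.trans (Raw.y_le_of_pos_le hf (by omega)))) (lt_irrefl _)
    · by_contra hlt
      have := Raw.pos_lt (W := W) he
      have hlast := hF.strip.last (by omega)
      obtain ⟨f, hf, hft⟩ := Raw.exists_pos (W := W) (a := t + 1) (by omega)
      rw [← hft, ← hqt, hys f hf, hys q hq] at hlast
      exact absurd (((Raw.y_le_of_pos_le he (by omega)).trans h).trans_lt hlast) (lt_irrefl _)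
  · rw [hF.r5]

/-- Each of the five constraints that define a window is tightened on its own, to the nearest point
that satisfies it. This point need not lie in the window, because only the set of points that
satisfy the constraint matters. The window is nonempty, so such a point exists for each constraint
and the indices come in the right order. -/
theorem Prepared.exists_strip (hP : Prepared W ε c C h k s)
    (hPs : P = s.inst W.n h K cnt J) (hcov : ∀ i < W.n, ∃ κ < cnt, s.rarr 4 κ = W.t i)
    {u v : ℝ × ℝ} {τ : ℝ} (hne : (W.win u v τ).Nonempty) :
    ∃ κ a t l r, P.Strip κ a t ∧ 0 < l ∧ l ≤ r ∧ r < 2 ^ P.h ∧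
      P.region κ a t l r = (W.win u v τ).image W.pos := by
  have hn : P.n = W.n := hPs ▸ rfl
  have hys : ∀ i < W.n, P.ys (W.pos i) = W.y i := hPs ▸ hP.sorted.y
  obtain ⟨e, he⟩ := hne
  obtain ⟨he, ⟨e₁, e₂⟩, ⟨e₃, e₄⟩, e₅⟩ := mem_filter.1 he
  have he' := mem_range.1 he
  obtain ⟨i, hi, himin⟩ := exists_min_image {i ∈ range W.n | u.1 ≤ W.x i} W.col
    ⟨e, mem_filter.2 ⟨he, e₁⟩⟩
  obtain ⟨j, hj, hjmax⟩ := exists_max_image {i ∈ range W.n | W.x i ≤ v.1} W.col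
    ⟨e, mem_filter.2 ⟨he, e₂⟩⟩
  obtain ⟨p, hp, hpmin⟩ := exists_min_image {i ∈ range W.n | u.2 ≤ W.y i} W.pos
    ⟨e, mem_filter.2 ⟨he, e₃⟩⟩
  obtain ⟨q, hq, hqmax⟩ := exists_max_image {i ∈ range W.n | W.y i ≤ v.2} W.pos
    ⟨e, mem_filter.2 ⟨he, e₄⟩⟩
  obtain ⟨o, ho, homin⟩ := exists_min_image {i ∈ range W.n | τ ≤ W.t i} W.t
    ⟨e, mem_filter.2 ⟨he, e₅⟩⟩
  simp only [mem_filter, mem_range, and_imp] at hi himin hj hjmax hp hpmin hq hqmax ho homin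
  obtain ⟨κ, hκ, hκo⟩ := hcov o ho.1
  have hτ : P.tau κ = W.t o := hPs ▸ hκo
  refine ⟨κ, W.pos p, W.pos q, W.col i, W.col j, ⟨hPs ▸ hκ,
    (hpmin e he' e₃).trans (hqmax e he' e₄), hn ▸ Raw.pos_lt hq.1, fun h0 => ?_, fun h1 => ?_⟩,
    Nat.succ_pos _, (himin e he' e₁).trans (hjmax e he' e₂), ?_, hP.region_eq hPs (Raw.pos_lt hq.1)
      (fun f hf => ?_) (fun f hf => ?_) fun f hf => ?_⟩
  · have := Raw.pos_lt (W := W) hp.1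
    obtain ⟨f, hf, hfp⟩ := Raw.exists_pos (W := W) (a := W.pos p - 1) (by omega)
    rw [← hfp, hys f hf, hys p hp.1]
    by_contra hlt
    have := hpmin f hf (hp.2.trans (not_lt.1 hlt))
    omega
  · obtain ⟨f, hf, hfp⟩ := Raw.exists_pos (W := W) (a := W.pos q + 1) (by omega)
    rw [← hfp, hys f hf, hys q hq.1]
    by_contra hlt
    have := hqmax f hf ((not_lt.1 hlt).trans hq.2)
    omega
  · have h₁ : W.col j ≤ W.n := xCol_le hj.1
    have h₂ := hP.size_ge
    have h₃ : P.h = h := hPs ▸ rfl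
    rw [h₃]
    omega
  · exact and_congr ⟨fun h => hi.2.trans ((xCol_le_xCol hi.1 hf).1 h), himin f hf⟩
      ⟨fun h => ((xCol_le_xCol hf hj.1).1 h).trans hj.2, hjmax f hf⟩
  · exact and_congr ⟨fun h => hp.2.trans (Raw.y_le_of_pos_le hf h), hpmin f hf⟩
      ⟨fun h => (Raw.y_le_of_pos_le hq.1 h).trans hq.2, hqmax f hf⟩
  · rw [hτ]
    exact ⟨fun h => ho.2.trans h, homin f hf⟩

theorem Prepared.seg_eq (hP : Prepared W ε c C h k s) (hPs : P = s.inst W.n h K cnt J)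
    {κ a t l r : ℕ} {u v : ℝ × ℝ} {τ : ℝ}
    (hr : P.region κ a t l r = (W.win u v τ).image W.pos) :
    seg (P.M κ a (t + 1)) l (r + 1) = ∑ i ∈ W.win u v τ, W.mN i ∧
      seg (P.B κ a (t + 1)) l (r + 1) = ∑ i ∈ W.win u v τ, W.bN i := by
  have hm : ∀ i < W.n, P.mv (W.pos i) = W.mN i := hPs ▸ hP.sorted.m
  have hb : ∀ i < W.n, P.bv (W.pos i) = W.bN i := hPs ▸ hP.sorted.b
  rw [Inst.M, Inst.B, seg_colSum, seg_colSum]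
  rw [Inst.region] at hr
  rw [hr]
  exact ⟨Raw.sum_pos_eq (filter_subset _ _) hm, Raw.sum_pos_eq (filter_subset _ _) hb⟩

end

/-! ### The complete program -/

/-- The algorithm, up to the choice of the starting times. -/
def mainProg (p : Prog) : Prog := preProg ;; p ;; searchProg

/-- The window is sufficiently supported. -/
def _root_.Raw.Sup (W : Raw) (C : ℝ) (u v : ℝ × ℝ) (τ : ℝ) : Prop :=
  Supp (C / W.n) (∑ i ∈ W.win u v τ, W.mN i) (∑ i ∈ W.win u v τ, W.bN i)

/-- The discrepancy of a window. -/
noncomputable def _root_.Raw.disc (W : Raw) (c : ℝ) (u v : ℝ × ℝ) (τ : ℝ) : ℝ :=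
  gammaDisc c (∑ i ∈ W.win u v τ, W.bN i) (∑ i ∈ W.win u v τ, W.mN i)

/-- The final state holds a solution. -/
def _root_.Raw.Solved (W : Raw) (ε c C : ℝ) (s : State) : Prop :=
  W.Sup C (s.rreg 1, s.rreg 2) (s.rreg 3, s.rreg 4) (s.rreg 5) ∧
    s.rreg 0 = W.disc c (s.rreg 1, s.rreg 2) (s.rreg 3, s.rreg 4) (s.rreg 5) ∧
    ∀ u v τ, W.Sup C u v τ → W.disc c u v τ ≤ s.rreg 0 + ε

/-- The instruction `p` is the only difference between the two algorithms: it sets the number of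
starting times. The starting times are the first `cnt` entries of the input array of time stamps,
which is never overwritten, and `hcov` says that every stamp is among them. -/
theorem run_mainProg {W : Raw} {ε c C lo hi : ℝ} {p : Prog} {s : State} {cnt : ℕ}
    (hW : W.Bounds lo hi) (hε : 0 < ε) (hc : 0 < c) (hC : 0 < C) (hs : Start W ε c C s)
    (hp : ∀ s' : State, s'.ireg 0 = W.n → s'.ireg 1 = 0 →
      Run p s' fun s'' t => s'' = s'.setI 4 cnt ∧ t = 1)
    (hcov : ∀ i < W.n, ∃ κ < cnt, s.rarr 4 κ = W.t i) :
    Run (mainProg p) s fun s' t => (∃ h k : ℕ, 2 ^ h ≤ 2 * W.n ∧ (k : ℝ) ^ 2 * ε ≤ c ∧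
      t ≤ preTime W ε c + 1 + searchTime
        (s'.inst W.n h (fewBound C lo hi) cnt (gridSize lo hi k))) ∧
      ((∃ u v τ, W.Sup C u v τ) → W.Solved ε c C s') := by
  rw [mainProg, run_seq]
  refine (run_preProg hW.pos hε hs).imp ?_
  rintro s₁ t₁ ⟨⟨h, k, hP⟩, ht₁⟩ F₁
  rw [run_seq]
  refine (hp s₁ hP.i0 hP.base.i1).mono ?_
  rintro s₂ t₂ ⟨rfl, rfl⟩
  have hP₂ : Prepared W ε c C h k (s₁.setI 4 cnt) :=
    ⟨⟨hP.base.r3, hP.base.i1, hP.base.i2, hP.base.i3, hP.base.par⟩, hP.size_ge, hP.size_le,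
      hP.sorted.of_eq rfl (fun _ _ _ => rfl) rfl rfl, hP.r1, hP.r4, hP.r5, hP.r6, hP.r9, hP.grid_ge,
      hP.grid_le, hP.r10, hP.r20, hP.r21, hP.i0, hP.i13, hP.i21, hP.i22, hP.ra, hP.t⟩
  obtain ⟨P, hPs⟩ : ∃ P, P = (s₁.setI 4 cnt).inst W.n h (fewBound C lo hi) cnt
    (gridSize lo hi k) := ⟨_, rfl⟩
  have hV : P.Valid := hPs ▸ hP₂.valid hW hc hC
  have hthr : P.thr = C / W.n := hPs ▸ hP.r5
  have hPc : P.c = c := hPs ▸ hP.r1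
  have hcov' : ∀ i < W.n, ∃ κ < cnt, (s₁.setI 4 cnt).rarr 4 κ = W.t i := by
    rw [State.setI_rarr, F₁.ra 4 rfl]; exact hcov
  refine (run_searchProg (P := P) hV (hPs ▸ hP₂.sane (by simp)) hε.le
    (fun ρ h₁ _ => hPs ▸ hP₂.grid hW (by rw [hPs] at h₁; exact h₁))
    (hPs ▸ hP₂.error_le) (fun κ a t l r ht hsup => hP₂.ratio hW hc hC hPs ht hsup)).mono ?_
  rintro s₃ t₃ ⟨ht₃, hf, hd⟩
  have hwin : ∀ u v τ, W.Sup C u v τ → ∃ κ a t l r, P.Strip κ a t ∧ 0 < l ∧ l ≤ r ∧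
      r < 2 ^ P.h ∧ P.Sup κ a (t + 1) l r ∧ P.disc κ a (t + 1) l r = W.disc c u v τ := by
    intro u v τ hsup
    have hne : (W.win u v τ).Nonempty := by
      rw [nonempty_iff_ne_empty]
      intro he
      have := hsup.m_ge
      rw [he, sum_empty, ← hthr] at this
      exact absurd hV.thr_pos (not_lt.2 this)
    obtain ⟨κ, a, t, l, r, h₁, h₂, h₃, h₄, h₅⟩ := hP₂.exists_strip hPs hcov' hne
    obtain ⟨em, eb⟩ := hP₂.seg_eq hPs h₅
    refine ⟨κ, a, t, l, r, h₁, h₂, h₃, h₄, ?_, ?_⟩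
    · rw [Inst.Sup, em, eb, hthr]; exact hsup
    · rw [Inst.disc, em, eb, hPc]; rfl
  refine ⟨⟨h, k, hP.size_le, hP.grid_le.trans_eq (max_eq_right hc.le), ?_⟩, ?_⟩
  · have : searchTime P = searchTime (s₃.inst W.n h (fewBound C lo hi) cnt (gridSize lo hi k)) := by
      rw [hPs]; rfl
    omega
  · rintro ⟨u, v, τ, hsup⟩
    obtain ⟨κ, a, t, l, r, h₁, h₂, h₃, h₄, h₅, -⟩ := hwin u v τ hsup
    obtain ⟨κ, a, t, l, r, hF⟩ := hf ⟨κ, a, t, l, r, h₁, h₂, h₃, h₄, h₅⟩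
    have hreg := hP₂.region_of_found hPs hV hF
    obtain ⟨em, eb⟩ := hP₂.seg_eq hPs hreg
    refine ⟨?_, ?_, fun u v τ hsup => ?_⟩
    · have := hF.sup
      rw [Inst.Sup, em, eb, hthr] at this
      exact this
    · rw [hF.r0, Inst.disc, em, eb, hPc]; rfl
    · obtain ⟨κ, a, t, l, r, h₁, h₂, h₃, h₄, h₅, h₆⟩ := hwin u v τ hsup
      rw [← h₆]
      exact hd κ a t l r h₁ h₂ h₃ h₄ h₅

end RealRAM

namespace RealRAM

/-! ### The running time -/

/-- The factor in the time for deleting a point. -/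
def delFactor (K : ℕ) : ℕ := (K + 3) * (30 * (K + 3) + 80) + 20

theorem delTime_le (K h : ℕ) : delTime K h ≤ delFactor K * (h + 1) := by
  have h₁ : 30 * (K + 3) + 40 * (h + 1) + 40 ≤ (30 * (K + 3) + 80) * (h + 1) := by
    have := Nat.le_mul_of_pos_right (30 * (K + 3)) h.succ_pos
    simp only [Nat.succ_eq_add_one] at this
    linarith
  have h₂ := Nat.mul_le_mul_left (K + 3) h₁
  rw [delTime, delFactor]
  linarith

theorem bruteTime_le {n h : ℕ} (hn : 1 ≤ n) (hh : 2 ^ h ≤ 2 * n) : bruteTime h ≤ 210 * n ^ 2 := by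
  have h₁ : bruteTime h ≤ 2 * n * (40 * (2 * n) + 20) + 10 := by
    rw [bruteTime]; gcongr
  nlinarith

/-- The factor in the time for the strips that start with a given point. -/
def bodyFactor (K : ℕ) : ℕ := 2 * (30 * (K + 3) + 90) + 130 + delFactor K

theorem bodyTime_le {P : Inst} (hn : 1 ≤ P.n) (hh : 2 ^ P.h ≤ 2 * P.n) :
    bodyTime P ≤ bodyFactor P.K * (P.n * (P.h + 1)) := by
  have h₁ : 30 * (P.K + 3) + 40 * (P.h + 1) + 50 ≤ (30 * (P.K + 3) + 90) * (P.h + 1) := by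
    have := Nat.le_mul_of_pos_right (30 * (P.K + 3)) P.h.succ_pos
    simp only [Nat.succ_eq_add_one] at this
    linarith
  have h₂ := Nat.mul_le_mul hh h₁
  have h₃ := Nat.mul_le_mul_left P.n (delTime_le P.K P.h)
  have h₄ : P.n ≤ P.n * (P.h + 1) := Nat.le_mul_of_pos_right _ P.h.succ_pos
  rw [bodyTime, bodyFactor]
  linarith

/-- The factor in the time for one tangent. -/
def bottomFactor (K : ℕ) : ℕ := bodyFactor K + 210 * (K + 1) ^ 2 + 4

theorem bottomTime_le {P : Inst} (hn : 1 ≤ P.n) (hh : 2 ^ P.h ≤ 2 * P.n) :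
    bottomTime P ≤ bottomFactor P.K * (P.n ^ 2 * (P.h + 1)) := by
  have h₁ := Nat.mul_le_mul_left P.n (bodyTime_le hn hh)
  have h₂ := Nat.mul_le_mul_left ((P.K + 1) ^ 2) (bruteTime_le hn hh)
  have h₃ : P.n ^ 2 ≤ P.n ^ 2 * (P.h + 1) := Nat.le_mul_of_pos_right _ P.h.succ_pos
  have h₄ : P.n ≤ P.n ^ 2 := Nat.le_self_pow (by norm_num) _
  have h₅ := Nat.mul_le_mul_left ((P.K + 1) ^ 2) h₃
  rw [bottomTime, bottomFactor]
  linarith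

/-- All lower-order terms are absorbed into the main term, whose factors are at least 1. The
constant is 17 from the two loops over the ratios, 3 from the loop over the starting times, and 210
+ 20 + 20 + 32 from the final exhaustive search and its preparation. -/
theorem searchTime_le {P : Inst} (hn : 1 ≤ P.n) (hh : 2 ^ P.h ≤ 2 * P.n) (hJ : 1 ≤ P.J)
    (hcnt : 1 ≤ P.cnt) : searchTime P ≤
      (bottomFactor P.K + 302) * (P.cnt * P.J ^ 2 * (P.n ^ 2 * (P.h + 1))) := by
  set Z := P.n ^ 2 * (P.h + 1) with hZ
  have hn2 : P.n ≤ P.n ^ 2 := Nat.le_self_pow (by norm_num) _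
  have h₃ : P.n ^ 2 ≤ Z := Nat.le_mul_of_pos_right _ P.h.succ_pos
  have hJ2 : P.J ≤ P.J ^ 2 := Nat.le_self_pow (by norm_num) _
  have hJZ : P.J ≤ P.J * Z := Nat.le_mul_of_pos_right _ (by omega)
  have hJZ2 : P.J * Z ≤ P.J ^ 2 * Z := Nat.mul_le_mul_right _ hJ2
  have hs : secondTime P ≤ (bottomFactor P.K + 12) * (P.J * Z) := by
    have := Nat.mul_le_mul_left P.J (bottomTime_le hn hh)
    rw [← hZ] at this
    rw [secondTime]
    linarith
  have hf : firstTime P ≤ (bottomFactor P.K + 17) * (P.J ^ 2 * Z) := by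
    have := Nat.mul_le_mul_left P.J hs
    rw [firstTime]
    linarith
  have h₄ := Nat.mul_le_mul_left P.cnt hf
  have h₅ : P.cnt ≤ P.cnt * (P.J ^ 2 * Z) := Nat.le_mul_of_pos_right _ (by omega)
  have h₆ : P.J ^ 2 * Z ≤ P.cnt * (P.J ^ 2 * Z) := Nat.le_mul_of_pos_left _ hcnt
  have h₇ : Z ≤ P.J ^ 2 * Z := Nat.le_mul_of_pos_left _ (by omega)
  have h₈ := bruteTime_le hn hh
  rw [searchTime]
  linarith

/-- From `2 ^ h ≤ 2 * n` one gets `(h + 1) * log 2 ≤ 3 * log n`. The other factor `log n / log 2` is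
at least 1 and is given away. -/
theorem log_factor_le {n h : ℕ} (hn : 2 ≤ n) (hh : 2 ^ h ≤ 2 * n) :
    ((h : ℝ) + 1) ≤ 3 / Real.log 2 ^ 2 * Real.log n ^ 2 := by
  have h2 : 0 < Real.log 2 := Real.log_pos (by norm_num)
  have hln : Real.log 2 ≤ Real.log n := Real.log_le_log (by norm_num) (by exact_mod_cast hn)
  have h₁ : (2 : ℝ) ^ h ≤ 2 * n := by exact_mod_cast hh
  have h₂ := Real.log_le_log (by positivity) h₁
  rw [Real.log_pow, Real.log_mul (by norm_num) (by positivity)] at h₂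
  rw [div_mul_eq_mul_div, le_div_iff₀ (by positivity)]
  have h₃ : ((h : ℝ) + 1) * Real.log 2 ≤ 3 * Real.log n := by linarith
  have h₄ := mul_le_mul h₃ hln h2.le (by linarith)
  nlinarith

/-- Used with `G = J ^ 2`, `X = max 1 (1 / ε)`, `Y = cnt * n ^ 2`, `L = h + 1` and `q = ⌈c / ε⌉₊`;
the summand `4 * q` is the cost of finding the grid quotient. -/
theorem total_le {t F R G X Y L M c q : ℝ} (hX : 1 ≤ X) (hY : 1 ≤ Y) (hF : 0 ≤ F) (hc : 0 ≤ c)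
    (hL : 1 ≤ L) (hLM : L ≤ M) (hR : 0 ≤ R) (hG : G ≤ R * X) (hq : q ≤ (c + 1) * X)
    (h : t ≤ F * (G * (Y * L)) + 4 * q) : t ≤ (F * R + 4 * (c + 1)) * X * Y * M := by
  have hYL : 1 ≤ Y * L := one_le_mul_of_one_le_of_one_le hY hL
  have h₁ : q ≤ (c + 1) * X * (Y * L) := hq.trans (le_mul_of_one_le_right (by positivity) hYL)
  have h₂ : G * (Y * L) ≤ R * X * (Y * L) := mul_le_mul_of_nonneg_right hG (by positivity)
  calc t ≤ F * (R * X * (Y * L)) + 4 * ((c + 1) * X * (Y * L)) := by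
        linarith [mul_le_mul_of_nonneg_left h₂ hF]
    _ = (F * R + 4 * (c + 1)) * X * Y * L := by ring
    _ ≤ (F * R + 4 * (c + 1)) * X * Y * M := mul_le_mul_of_nonneg_left hLM (by positivity)

theorem time_le {W : Raw} {ε c C lo hi : ℝ} {h k cnt t : ℕ} {s : State} (hn : 2 ≤ W.n)
    (hh : 2 ^ h ≤ 2 * W.n) (hε : 0 < ε) (hc : 0 < c) (hlo : 0 < lo) (hhi : 0 < hi) (hcnt : 1 ≤ cnt)
    (hk : (k : ℝ) ^ 2 * ε ≤ c) (ht : t ≤ preTime W ε c + 1 + searchTime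
      (s.inst W.n h (fewBound C lo hi) cnt (gridSize lo hi k))) :
    (t : ℝ) ≤ ((bottomFactor (fewBound C lo hi) + 443) * (⌈(hi / lo) ^ 4⌉₊ ^ 2 * (2 * (c + 1))) +
      4 * (c + 1)) * max 1 (1 / ε) * (cnt * (W.n : ℝ) ^ 2) *
      (3 / Real.log 2 ^ 2 * Real.log W.n ^ 2) := by
  set K := fewBound C lo hi
  set J := gridSize lo hi k with hJdef
  have hJ : 1 ≤ J := Nat.mul_pos k.succ_pos (Nat.ceil_pos.2 (by positivity))
  have h₁ : searchTime (s.inst W.n h K cnt J) ≤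
      (bottomFactor K + 302) * (cnt * J ^ 2 * (W.n ^ 2 * (h + 1))) :=
    searchTime_le (P := s.inst W.n h K cnt J) (by change 1 ≤ W.n; omega) hh hJ hcnt
  have h₂ : preTime W ε c + 1 ≤ 141 * (cnt * J ^ 2 * (W.n ^ 2 * (h + 1))) + 4 * ⌈c / ε⌉₊ := by
    have : 1 ≤ cnt * J ^ 2 := Nat.mul_pos hcnt (pow_pos hJ 2)
    have h₃ : W.n ^ 2 ≤ W.n ^ 2 * (h + 1) := Nat.le_mul_of_pos_right _ h.succ_pos
    have h₄ : W.n ^ 2 * (h + 1) ≤ cnt * J ^ 2 * (W.n ^ 2 * (h + 1)) := Nat.le_mul_of_pos_left _ this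
    rw [preTime]
    nlinarith
  -- 443 = 302 + 141, where 141 = 10 + 70 + 60 + 1 comes from the preprocessing.
  have h₃ : t ≤ (bottomFactor K + 443) * (cnt * J ^ 2 * (W.n ^ 2 * (h + 1))) + 4 * ⌈c / ε⌉₊ := by
    linarith
  have h₄ : (t : ℝ) ≤ (bottomFactor K + 443) * (cnt * J ^ 2 * (W.n ^ 2 * (h + 1))) +
      4 * ⌈c / ε⌉₊ := by exact_mod_cast h₃
  have hJ' : J = (k + 1) * ⌈(hi / lo) ^ 4⌉₊ := rfl
  clear_value J K
  set X := max 1 (1 / ε) with hX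
  have hX1 : 1 ≤ X := le_max_left _ _
  have hXε : 1 / ε ≤ X := le_max_right _ _
  have hcX : c / ε ≤ c * X := by
    rw [div_eq_mul_one_div]; exact mul_le_mul_of_nonneg_left hXε hc.le
  have hJ2 : (J : ℝ) ^ 2 ≤ ⌈(hi / lo) ^ 4⌉₊ ^ 2 * (2 * (c + 1)) * X := by
    have : (k : ℝ) ^ 2 ≤ c / ε := (le_div_iff₀ hε).2 hk
    -- `(k + 1) ^ 2 ≤ 2 * (k ^ 2 + 1)` and `k ^ 2 ≤ c / ε`: the number of tangents is linear in `max
    -- 1 (1 / ε)`.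
    have h₅ : ((k : ℝ) + 1) ^ 2 ≤ 2 * (c + 1) * X := by nlinarith [sq_nonneg ((k : ℝ) - 1)]
    rw [hJ']
    push_cast
    rw [mul_pow, mul_comm, mul_assoc]
    exact mul_le_mul_of_nonneg_left h₅ (by positivity)
  have hceil : (⌈c / ε⌉₊ : ℝ) ≤ (c + 1) * X := by
    have := (Nat.ceil_lt_add_one (div_pos hc hε).le).le
    linarith
  have hn1 : (1 : ℝ) ≤ (W.n : ℝ) ^ 2 := one_le_pow₀ (by exact_mod_cast (by omega : 1 ≤ W.n))
  have hcnt1 : (1 : ℝ) ≤ cnt := by exact_mod_cast hcnt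
  have hL1 : (1 : ℝ) ≤ (h : ℝ) + 1 := by linarith [h.cast_nonneg (α := ℝ)]
  have h₅ : (t : ℝ) ≤ (bottomFactor K + 443 : ℝ) * ((J : ℝ) ^ 2 * (cnt * (W.n : ℝ) ^ 2 *
      ((h : ℝ) + 1))) + 4 * (⌈c / ε⌉₊ : ℝ) := by
    refine h₄.trans_eq ?_
    ring
  have hF : (0 : ℝ) ≤ bottomFactor K + 443 := add_nonneg (Nat.cast_nonneg _) (by norm_num)
  have hR : (0 : ℝ) ≤ ⌈(hi / lo) ^ 4⌉₊ ^ 2 * (2 * (c + 1)) := by positivity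
  exact total_le hX1 (one_le_mul_of_one_le_of_one_le hcnt1 hn1) hF hc.le hL1
    (log_factor_le hn hh) hR hJ2 hceil h₅

end RealRAM

/-! ### Translation to the given input and output -/

namespace RealRAM

theorem toArr_coe {n : ℕ} (f : Fin n → ℝ) (i : Fin n) : toArr f i = f i := by simp [toArr]

theorem toArr_of_lt {n : ℕ} (f : Fin n → ℝ) {i : ℕ} (hi : i < n) : toArr f i = f ⟨i, hi⟩ := by
  simp [toArr, hi]

theorem sum_toArr {n : ℕ} (f : Fin n → ℝ) : ∑ i ∈ range n, toArr f i = ∑ i, f i := by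
  rw [sum_range]
  exact sum_congr rfl fun i _ => toArr_coe f i

end RealRAM

namespace GammaData

open RealRAM

variable {n : ℕ} (D : GammaData n) (time : Fin n → ℝ) {ε c C lo hi : ℝ}

/-- The columns of the input. -/
noncomputable def raw : Raw where
  n := n
  x := toArr fun i => (D.loc i).1
  y := toArr fun i => (D.loc i).2
  t := toArr time
  m := toArr D.m
  b := toArr D.b

variable {D time}

theorem WeightsIn.bounds (hD : D.WeightsIn lo hi) (hn : 2 ≤ n) (hlo : 0 < lo) :
    (D.raw time).Bounds lo hi where
  n_pos := by change 0 < n; omega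
  lo_pos := hlo
  m_ge i hi := ((hD ⟨i, hi⟩).1.1).trans_eq (toArr_of_lt D.m hi).symm
  m_le i hi := (toArr_of_lt D.m hi).trans_le (hD ⟨i, hi⟩).1.2
  b_ge i hi := ((hD ⟨i, hi⟩).2.1).trans_eq (toArr_of_lt D.b hi).symm
  b_le i hi := (toArr_of_lt D.b hi).trans_le (hD ⟨i, hi⟩).2.2

theorem start_input : Start (D.raw time) ε c C (D.input time ε c C) where
  i0 := rfl
  i x hx := if_neg hx
  r0 := rfl
  r1 := rfl
  r2 := rfl
  r3 := rfl
  ra x hx := by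
    obtain ⟨y, rfl⟩ := Nat.exists_eq_add_of_le' hx
    rfl
  x _ _ := rfl
  y _ _ := rfl
  m i hi := by
    have hi : i < n := hi
    change toArr D.shape i * toArr D.y i = toArr D.m i
    rw [toArr_of_lt _ hi, toArr_of_lt _ hi, toArr_of_lt _ hi, m]
  b _ _ := rfl
  t _ _ := rfl

theorem sum_win (f : Fin n → ℝ) (u v : ℝ × ℝ) (τ : ℝ) :
    ∑ i ∈ (D.raw time).win u v τ, toArr f i / ∑ i ∈ range n, toArr f i =
      (∑ i ∈ D.inWindow time u v τ, f i) / ∑ i, f i := by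
  rw [← sum_div, sum_toArr, Raw.win, inWindow, inRect, sum_filter, filter_filter, sum_filter,
    show range (D.raw time).n = range n from rfl, sum_range]
  congr 1
  refine sum_congr rfl fun i _ => ?_
  rw [toArr_coe]
  refine if_congr ?_ rfl rfl
  simp only [raw, toArr_coe, Set.mem_Icc, Prod.le_def]
  tauto

theorem sum_win_m (u v : ℝ × ℝ) (τ : ℝ) :
    ∑ i ∈ (D.raw time).win u v τ, (D.raw time).mN i = D.mFrac (D.inWindow time u v τ) :=
  sum_win D.m u v τ

theorem sum_win_b (u v : ℝ × ℝ) (τ : ℝ) :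
    ∑ i ∈ (D.raw time).win u v τ, (D.raw time).bN i = D.bFrac (D.inWindow time u v τ) :=
  sum_win D.b u v τ

theorem sup_iff {u v : ℝ × ℝ} {τ : ℝ} :
    (D.raw time).Sup C u v τ ↔ D.Supported C (D.inWindow time u v τ) := by
  rw [Raw.Sup, sum_win_m, sum_win_b]
  exact ⟨fun h => ⟨⟨h.m_ge, h.m_le⟩, h.b_ge, h.b_le⟩, fun h => ⟨h.1.1, h.2.1, h.1.2, h.2.2⟩⟩

theorem disc_win (u v : ℝ × ℝ) (τ : ℝ) :
    (D.raw time).disc c u v τ = D.disc c (D.inWindow time u v τ) := by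
  rw [Raw.disc, sum_win_m, sum_win_b, disc]

theorem solvesProspective {s : State} (hs : (D.raw time).Solved ε c C s) :
    D.SolvesProspective time ε c C s := by
  obtain ⟨h₁, h₂, h₃⟩ := hs
  refine ⟨sup_iff.1 h₁, h₂.trans (disc_win _ _ _), fun u v τ h => ?_⟩
  rw [← disc_win]
  exact h₃ u v τ (sup_iff.2 h)

theorem inWindow_zero {u v : ℝ × ℝ} {τ : ℝ} (hτ : τ ≤ 0) :
    D.inWindow (fun _ => 0) u v τ = D.inRect u v := filter_true_of_mem fun _ _ => hτ

/-- All time stamps are 0, so a window with `τ > 0` is empty and cannot be supported. -/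
theorem Supported.inWindow_zero (hn : 0 < n) (hC : 0 < C) {u v : ℝ × ℝ} {τ : ℝ}
    (h : D.Supported C (D.inWindow (fun _ => 0) u v τ)) :
    D.inWindow (fun _ => 0) u v τ = D.inRect u v := by
  refine GammaData.inWindow_zero ?_
  by_contra hτ
  have h₁ := h.1.1
  rw [inWindow, filter_false_of_mem fun _ _ => hτ, mFrac, sum_empty, zero_div] at h₁
  exact absurd (div_pos hC (Nat.cast_pos.2 hn)) (not_lt.2 h₁)

theorem SolvesProspective.solves {s : State} (hn : 0 < n) (hC : 0 < C)
    (hs : D.SolvesProspective (fun _ => 0) ε c C s) : D.Solves ε c C s := by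
  obtain ⟨h₁, h₂, h₃⟩ := hs
  have e := h₁.inWindow_zero hn hC
  rw [e] at h₁ h₂
  refine ⟨h₁, h₂, fun u v h => ?_⟩
  have h₄ := h₃ u v 0
  rw [GammaData.inWindow_zero le_rfl] at h₄
  exact h₄ h

/-- The constant in the bounds for the running time. -/
noncomputable def timeFactor (c C lo hi : ℝ) : ℝ :=
  ((bottomFactor (fewBound C lo hi) + 443) * (⌈(hi / lo) ^ 4⌉₊ ^ 2 * (2 * (c + 1))) + 4 * (c + 1)) *
    (3 / Real.log 2 ^ 2)

theorem exec_mainProg (hD : D.WeightsIn lo hi) (hn : 2 ≤ n) (hε : 0 < ε) (hc : 0 < c) (hC : 0 < C)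
    (hlo : 0 < lo) {p : Prog} {cnt : ℕ} (hcnt : 1 ≤ cnt)
    (hp : ∀ s' : State, s'.ireg 0 = n → s'.ireg 1 = 0 →
      Run p s' fun s'' t => s'' = s'.setI 4 cnt ∧ t = 1)
    (hcov : ∀ i < n, ∃ κ < cnt, toArr time κ = toArr time i) :
    ∃ (s : State) (t : ℕ), Exec (mainProg p) (D.input time ε c C) s t ∧
      (t : ℝ) ≤ timeFactor c C lo hi * max 1 (1 / ε) * (cnt * (n : ℝ) ^ 2) * Real.log n ^ 2 ∧
      ((∃ u v τ, D.Supported C (D.inWindow time u v τ)) → D.SolvesProspective time ε c C s) := by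
  have hW := hD.bounds (time := time) hn hlo
  obtain ⟨s, t, he, ⟨h, k, hh, hk, ht⟩, hs⟩ := run_mainProg hW hε hc hC start_input hp hcov
  refine ⟨s, t, he, ?_, fun ⟨u, v, τ, hsup⟩ => solvesProspective (hs ⟨u, v, τ, sup_iff.2 hsup⟩)⟩
  refine (time_le hn hh hε hc hlo hW.hi_pos hcnt hk ht).trans_eq ?_
  rw [timeFactor]
  change _ * (_ * (n : ℝ) ^ 2) * (_ * Real.log n ^ 2) = _
  ring

end GammaData

theorem mainTheorem7 :
    (∃ p : RealRAM.Prog, ∀ c C lo hi : ℝ, 0 < c → 0 < C → 0 < lo → ∃ K : ℝ,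
      ∀ (n : ℕ) (D : GammaData n) (ε : ℝ), 2 ≤ n → D.WeightsIn lo hi → 0 < ε →
        ∃ (s : RealRAM.State) (t : ℕ),
          RealRAM.Exec p (D.input (fun _ => 0) ε c C) s t ∧
          (t : ℝ) ≤ K * max 1 (1 / ε) * (n : ℝ) ^ 2 * Real.log n ^ 2 ∧
          ((∃ u v : ℝ × ℝ, D.Supported C (D.inRect u v)) → D.Solves ε c C s)) ∧
    (∃ p : RealRAM.Prog, ∀ c C lo hi : ℝ, 0 < c → 0 < C → 0 < lo → ∃ K : ℝ,
      ∀ (n : ℕ) (D : GammaData n) (time : Fin n → ℝ) (ε : ℝ), 2 ≤ n → D.WeightsIn lo hi → 0 < ε →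
        ∃ (s : RealRAM.State) (t : ℕ),
          RealRAM.Exec p (D.input time ε c C) s t ∧
          (t : ℝ) ≤ K * max 1 (1 / ε) * (n : ℝ) ^ 3 * Real.log n ^ 2 ∧
          ((∃ (u v : ℝ × ℝ) (τ : ℝ), D.Supported C (D.inWindow time u v τ)) →
            D.SolvesProspective time ε c C s)) := by
  constructor
  -- All stamps are 0, so one starting time is enough.
  · refine ⟨RealRAM.mainProg (.iconst 4 1), fun c C lo hi hc hC hlo =>
      ⟨GammaData.timeFactor c C lo hi, fun n D ε hn hD hε => ?_⟩⟩
    obtain ⟨s, t, he, ht, hs⟩ := GammaData.exec_mainProg (time := fun _ => 0) hD hn hε hc hC hlo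
      (p := .iconst 4 1) (cnt := 1) le_rfl (fun s' _ _ => by simp) fun i hi =>
        ⟨0, one_pos, by rw [RealRAM.toArr_of_lt _ hi, RealRAM.toArr_of_lt _ (by omega)]⟩
    rw [Nat.cast_one, one_mul] at ht
    refine ⟨s, t, he, ht, fun ⟨u, v, h⟩ => (hs ⟨u, v, 0, ?_⟩).solves (by omega) hC⟩
    rwa [GammaData.inWindow_zero le_rfl]
  -- Register 1 holds zero, so the instruction copies `n`: every time stamp becomes a starting time,
  -- which accounts for the additional factor `n`.
  · refine ⟨RealRAM.mainProg (.iadd 4 0 1), fun c C lo hi hc hC hlo =>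
      ⟨GammaData.timeFactor c C lo hi, fun n D time ε hn hD hε => ?_⟩⟩
    obtain ⟨s, t, he, ht, hs⟩ := GammaData.exec_mainProg (time := time) hD hn hε hc hC hlo
      (p := .iadd 4 0 1) (cnt := n) (by omega) (fun s' h₀ h₁ => by simp [h₀, h₁]) fun i hi =>
        ⟨i, hi, rfl⟩
    exact ⟨s, t, he, ht.trans_eq (by ring), hs⟩
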